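/- **Setting.** Let $G$ be a compact matrix quantum group with Hopf $*$-algebra $(\mathcal A,\phi,\epsilon,\kappa)$ over $\mathbb C$ (coproduct, counit, antipode; $\mathcal A$ is generated as an algebra by the entries of a finite-dimensional unitary corepresentation). Write $\phi(a)=a^{(1)}\otimes a^{(2)}$ and $\mathrm{ad}(a)=a^{(2)}\otimes\kappa(a^{(1)})a^{(3)}$. Let $\mathfrak{hor}_P=\bigoplus_{k\ge 0}\mathfrak{hor}_P^k$ be a graded $*$-algebra, whose star preserves degrees and satisfies $(\varphi\psi)^*=(-1)^{\partial\varphi\,\partial\psi}\psi^*\varphi^*$, with a grade-preserving unital $*$-homomorphism $F^\star:\mathfrak{hor}_P\to\mathfrak{hor}_P\otimes\mathcal A$ that is a coaction: $(\mathrm{id}\otimes\phi)F^\star=(F^\star\otimes\mathrm{id})F^\star$ and $(\mathrm{id}\otimes\epsilon)F^\star=\mathrm{id}$. Write $F^\star(\varphi)=\sum_k\varphi_k\otimes c_k$. Put $\mathcal B=\mathfrak{hor}_P^0$ and assume that the coaction on $\mathcal B$ is free: every $1\otimes a$ with $a\in\mathcal A$ is of the form $\sum_i q_iF^\star(b_i)$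 with $q_i,b_i\in\mathcal B$. Let $\Omega_M=\{\varphi\in\mathfrak{hor}_P: F^\star(\varphi)=\varphi\otimes1\}$, equipped with a degree-one hermitian differential $d_M$ ($d_M^2=0$, $d_M(\varphi^*)=d_M(\varphi)^*$, graded Leibniz rule). A *preconnection* is a linear map $D:\mathfrak{hor}_P\to\mathfrak{hor}_P$ of degree one with $F^\star D=(D\otimes\mathrm{id})F^\star$, $D|_{\Omega_M}=d_M$, $D(\varphi\psi)=D(\varphi)\psi+(-1)^{\partial\varphi}\varphi D(\psi)$ and $D(\varphi^*)=D(\varphi)^*$. The set $\pi(P)$ of preconnections is a real affine space; assume that it is non-empty. Its vector space $\overrightarrow\pi(P)$ consists of the maps $E$ with the same properties, except that $E|_{\Omega_M}=0$. For $E\in\overrightarrow\pi(P)$ and $D\in\pi(P)$ let $\chi_E^\natural,\varrho_D^\natural:\mathcal A\to\mathfrak{hor}_P$ be the linear maps determined by $$E(\varphi)=-(-1)^{\partial\varphi}\sum_k\varphi_k\chi_E^\natural(c_k),\qquad D^2(\varphi)=-\sum_k\varphi_k\varrho_D^\natural(c_k).$$ Let $\widehat{\mathcal R}$ be the right ideal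 of all $a\in\ker\epsilon$ that are annihilated by every $\chi^\natural_E$ and every $\varrho^\natural_D$, and let $\Psi$ be the corresponding left-covariant first-order calculus on $G$. Its space of left-invariant one-forms is $\Psi_{inv}=\ker\epsilon/\widehat{\mathcal R}$, with the projection $\pi(a)=[a-\epsilon(a)1]$, the right $\mathcal A$-module structure $\pi(a)\circ b=\pi(ab)-\epsilon(a)\pi(b)$, the star $\pi(a)^*=-\pi(\kappa(a)^*)$ and the adjoint coaction $\varpi\pi=(\pi\otimes\mathrm{id})\mathrm{ad}$. Let $\Psi_{inv}^\wedge$ be the tensor algebra of $\Psi_{inv}$ modulo the relations $\pi(r^{(1)})\pi(r^{(2)})=0$, $r\in\widehat{\mathcal R}$. The operation $\circ$ extends to it by $1\circ a=\epsilon(a)1$ and $(\eta\vartheta)\circ a=(\eta\circ a^{(1)})(\vartheta\circ a^{(2)})$, the star extends graded-antimultiplicatively, and $d\pi(a)=-\pi(a^{(1)})\pi(a^{(2)})$. The universal envelope of $\Psi$ is $\Psi^\wedge=\mathcal A\otimes\Psi_{inv}^\wedge$ with the product $(b\otimes\eta)(a\otimes\vartheta)=ba^{(1)}\otimes(\eta\circ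 a^{(2)})\vartheta$. Let $\widehat\varpi:\Psi_{inv}^\wedge\to\Psi_{inv}^\wedge\mathbin{\widehat\otimes}\Psi^\wedge$ be the homomorphism into the graded tensor product that sends $\vartheta\in\Psi_{inv}$ to $\varpi(\vartheta)+1\otimes\vartheta$. Let $\mathfrak{vh}_P=\mathfrak{hor}_P\otimes\Psi_{inv}^\wedge$ be the graded $*$-algebra with $$(\psi\otimes\eta)(\varphi\otimes\vartheta)=(-1)^{\partial\eta\,\partial\varphi}\sum_k\psi\varphi_k\otimes(\eta\circ c_k)\vartheta,\qquad(\varphi\otimes\vartheta)^*=\sum_k\varphi_k^*\otimes(\vartheta^*\circ c_k^*).$$ Both tensor factors are regarded as subalgebras of it. For $D\in\pi(P)$ let $\partial_D$ be the linear map on $\mathfrak{vh}_P$ that obeys the graded Leibniz rule, $\partial_D(\varphi)=D(\varphi)+(-1)^{\partial\varphi}\sum_k\varphi_k\pi(c_k)$ and $\partial_D\pi(a)=\varrho_D^\natural(a)+d\pi(a)$. For $E\in\overrightarrow\pi(P)$ let $h_E$ be the algebra endomorphism of $\mathfrak{vh}_P$ with $h_E(\varphi)=\varphi$ and $h_E(\pi(a))=\pi(a)-\chi_E^\natural(a)$.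 Let $\Omega_P$ be the algebra obtained by gluing the copies of $\mathfrak{vh}_P$ labelled by $D\in\pi(P)$ along the maps $h_E$: its elements are the families $(x_D)_{D\in\pi(P)}$ in $\mathfrak{vh}_P$ with $x_{D+E}=h_E(x_D)$. Let $\pi_D:\Omega_P\to\mathfrak{vh}_P$, $x\mapsto x_D$. The grading and the star of $\Omega_P$, the differential $d_P$ and the pull-back $\widehat F:\Omega_P\to\Omega_P\mathbin{\widehat\otimes}\Psi^\wedge$ are those that correspond under each $\pi_D$ to the grading and the star of $\mathfrak{vh}_P$, to $\partial_D$ and to $\varphi\otimes\vartheta\mapsto F^\star(\varphi)\widehat\varpi(\vartheta)$. Since $h_E$ fixes $\mathfrak{hor}_P$, one has $\mathfrak{hor}_P\subseteq\Omega_P$. A *connection* on $P$ relative to $(\Omega_P,\Psi^\wedge)$ is a linear map $\omega:\Psi_{inv}\to\Omega_P^1$ with $\omega(\vartheta^*)=\omega(\vartheta)^*$ and $\widehat F\omega(\vartheta)=(\omega\otimes\mathrm{id})\varpi(\vartheta)+1\otimes\vartheta$. It is *regular* if $\omega(\vartheta)\varphi=(-1)^{\partial\varphi}\sum_k\varphi_k\,\omega(\vartheta\circ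 c_k)$ for all $\vartheta\in\Psi_{inv}$ and $\varphi\in\mathfrak{hor}_P$. It is *multiplicative* if $\omega\pi(r^{(1)})\,\omega\pi(r^{(2)})=0$ for all $r\in\widehat{\mathcal R}$; then it extends to an algebra homomorphism $\omega^\wedge:\Psi_{inv}^\wedge\to\Omega_P$, and $m_\omega:\mathfrak{hor}_P\otimes\Psi_{inv}^\wedge\to\Omega_P$, $m_\omega(\varphi\otimes\vartheta)=\varphi\,\omega^\wedge(\vartheta)$, is the canonical decomposition map. The *covariant derivative* of $\omega$ on horizontal forms is $D_\omega(\varphi)=d_P(\varphi)-(-1)^{\partial\varphi}\sum_k\varphi_k\,\omega\pi(c_k)$. **Proposition.** The maps $\chi_E^\natural$, $\varrho_D^\natural$, the star of $\Psi_{inv}^\wedge$, $\widehat\varpi$, $h_E$ and $\partial_D$ exist and are uniquely determined by the stated properties, and each $\pi_D$ is an isomorphism of algebras. Moreover: 1. For each $D\in\pi(P)$ the map $\omega_D:\Psi_{inv}\to\Omega_P$, $\omega_D(\vartheta)=\pi_D^{-1}(1\otimes\vartheta)$, is a regular and multiplicative connection on $P$ relative to $(\Omega_P,\Psi^\wedge)$,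 its covariant derivative is $D_{\omega_D}=D$, and $\pi_D^{-1}=m_{\omega_D}$. 2. Conversely, for each regular connection $\omega$ there is a unique $D\in\pi(P)$ with $\omega=\omega_D$. 3. Consequently the regular connections form a non-empty real affine space, and $D\mapsto\omega_D$ is a bijective affine correspondence between the preconnections and the regular connections. -/

import Mathlib

open scoped TensorProduct

noncomputable section

namespace QPB

/-- `A` is the Hopf `*`-algebra of polynomial functions on a compact matrix quantum group: the
coproduct is a `*`-homomorphism and `A` is generated, as an algebra, by the matrix elements of a
finite-dimensional unitary corepresentation `u`. (For a compact matrix quantum group with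
fundamental representation `v`, take for `u` the direct sum of unitary forms of `v` and of its
conjugate. The identity `κ(κ(a)* )* = a` and hermiticity of the counit are automatic.) -/
class CompactMatrixQuantumGroup (A : Type*) [Ring A] [HopfAlgebra ℂ A] [StarRing A]
    [StarModule ℂ A] : Prop where
  comul_star : ∀ a : A,
    Coalgebra.comul (R := ℂ) (star a) = star (Coalgebra.comul (R := ℂ) a)
  exists_unitary : ∃ (n : ℕ) (u : Matrix (Fin n) (Fin n) A),
    (∀ i j, Coalgebra.comul (R := ℂ) (u i j) = ∑ k, u i k ⊗ₜ[ℂ] u k j) ∧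
    u ∈ unitary (Matrix (Fin n) (Fin n) A) ∧
    Algebra.adjoin ℂ (Set.range fun p : Fin n × Fin n => u p.1 p.2) = ⊤

/-- A right ideal of `A` contained in the kernel of the counit. Such right ideals are in canonical
correspondence with the left-covariant first-order differential calculi on the quantum group. -/
structure CalcIdeal (A : Type*) [Ring A] [HopfAlgebra ℂ A] where
  carrier : Submodule ℂ A
  counit_eq_zero : ∀ r ∈ carrier, Coalgebra.counit (R := ℂ) r = 0
  mul_mem : ∀ r ∈ carrier, ∀ a : A, r * a ∈ carrier

namespace CalcIdeal

variable {A : Type*} [Ring A] [HopfAlgebra ℂ A] (R : CalcIdeal A)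

/-- The space of left-invariant elements of the first-order calculus given by `R`. Since
`A = ker ε ⊕ ℂ1`, the quotient `A / (R ⊕ ℂ1)` is `ker ε / R`. -/
def Inv : Type _ := A ⧸ (R.carrier ⊔ Submodule.span ℂ {(1 : A)})

instance : AddCommGroup R.Inv :=
  inferInstanceAs (AddCommGroup (A ⧸ (R.carrier ⊔ Submodule.span ℂ {(1 : A)})))

instance : Module ℂ R.Inv :=
  inferInstanceAs (Module ℂ (A ⧸ (R.carrier ⊔ Submodule.span ℂ {(1 : A)})))

/-- The canonical projection `π : A → ker ε / R`, `π(a) = [a - ε(a)1]`. -/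
def proj : A →ₗ[ℂ] R.Inv := Submodule.mkQ (R.carrier ⊔ Submodule.span ℂ {(1 : A)})

lemma proj_of_mem {r : A} (hr : r ∈ R.carrier) : R.proj r = 0 :=
  (Submodule.Quotient.mk_eq_zero _).2 (Submodule.mem_sup_left hr)

lemma proj_one : R.proj 1 = 0 :=
  (Submodule.Quotient.mk_eq_zero _).2
    (Submodule.mem_sup_right (Submodule.mem_span_singleton_self _))

lemma proj_surjective : Function.Surjective R.proj := Submodule.mkQ_surjective _

/-- Auxiliary: the bilinear map `(a, b) ↦ π(ab) - ε(a)π(b)`. -/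
def circPre : A →ₗ[ℂ] A →ₗ[ℂ] R.Inv :=
  LinearMap.mk₂ ℂ (fun a b => R.proj (a * b) - Coalgebra.counit (R := ℂ) a • R.proj b)
    (fun a a' b => by simp [add_mul, add_smul]; abel)
    (fun c a b => by simp [smul_sub, mul_smul])
    (fun a b b' => by simp [mul_add]; abel)
    (fun c a b => by
      simp only [mul_smul_comm, map_smul, smul_sub]
      rw [smul_comm])

/-- The right `A`-module structure `ϑ ∘ b` on left-invariant forms: `π(a) ∘ b = π(ab) - ε(a)π(b)`
(so `π(a) ∘ b = π(ab)` for `a ∈ ker ε`). -/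
def circ : R.Inv →ₗ[ℂ] A →ₗ[ℂ] R.Inv :=
  Submodule.liftQ _ R.circPre (by
    refine sup_le (fun r hr => ?_) ((Submodule.span_singleton_le_iff_mem _ _).2 ?_)
    · rw [LinearMap.mem_ker]
      ext b
      simp [circPre, R.counit_eq_zero r hr, R.proj_of_mem (R.mul_mem r hr b)]
    · rw [LinearMap.mem_ker]
      ext b
      simp [circPre])

lemma circ_proj (a b : A) : R.circ (R.proj a) b =
    R.proj (a * b) - Coalgebra.counit (R := ℂ) a • R.proj b := rfl

/-- For a linear map `f` on left-invariant forms with values in an algebra, the map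
`a ↦ ∑ f(π(a₁)) f(π(a₂))`. -/
def quad {T : Type*} [Ring T] [Algebra ℂ T] (f : R.Inv →ₗ[ℂ] T) : A →ₗ[ℂ] T :=
  LinearMap.mul' ℂ T ∘ₗ TensorProduct.map (f ∘ₗ R.proj) (f ∘ₗ R.proj) ∘ₗ Coalgebra.comul

/-- The quadratic relations `∑ π(r₁) π(r₂) = 0`, `r ∈ R`. -/
inductive EnvRel : TensorAlgebra ℂ R.Inv → TensorAlgebra ℂ R.Inv → Prop
  | quad (r : A) (hr : r ∈ R.carrier) : EnvRel (R.quad (TensorAlgebra.ι ℂ) r) 0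

/-- The left-invariant part of the universal differential envelope of the calculus: the tensor
algebra over left-invariant one-forms modulo the relations `∑ π(r₁) π(r₂) = 0` for `r ∈ R`. -/
def Env : Type _ := RingQuot R.EnvRel

instance : Ring R.Env := inferInstanceAs (Ring (RingQuot R.EnvRel))
instance : Algebra ℂ R.Env := inferInstanceAs (Algebra ℂ (RingQuot R.EnvRel))

/-- The quotient map. -/
def envMk : TensorAlgebra ℂ R.Inv →ₐ[ℂ] R.Env := RingQuot.mkAlgHom ℂ R.EnvRel

/-- The inclusion of left-invariant one-forms into the left-invariant part of the envelope. -/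
def incl : R.Inv →ₗ[ℂ] R.Env := R.envMk.toLinearMap ∘ₗ TensorAlgebra.ι ℂ

lemma quad_comp {T S : Type*} [Ring T] [Algebra ℂ T] [Ring S] [Algebra ℂ S]
    (f : R.Inv →ₗ[ℂ] T) (g : T →ₐ[ℂ] S) (a : A) :
    g (R.quad f a) = R.quad (g.toLinearMap ∘ₗ f) a := by
  simp only [quad, LinearMap.comp_apply]
  generalize (Coalgebra.comul (R := ℂ) a) = t
  induction t with
  | zero => simp
  | tmul x y => simp
  | add x y hx hy => simp only [map_add, hx, hy]

/-- The algebra homomorphism extending a linear map `f` on left-invariant one-forms that satisfies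
`∑ f(π(r₁)) f(π(r₂)) = 0` for `r ∈ R`. -/
def lift {T : Type*} [Ring T] [Algebra ℂ T] (f : R.Inv →ₗ[ℂ] T)
    (hf : ∀ r ∈ R.carrier, R.quad f r = 0) : R.Env →ₐ[ℂ] T :=
  RingQuot.liftAlgHom ℂ ⟨TensorAlgebra.lift ℂ f, by
    rintro _ _ ⟨r, hr⟩
    rw [quad_comp, map_zero, ← hf r hr]
    congr 1
    ext x
    simp⟩

lemma lift_incl {T : Type*} [Ring T] [Algebra ℂ T] (f : R.Inv →ₗ[ℂ] T)
    (hf : ∀ r ∈ R.carrier, R.quad f r = 0) (x : R.Inv) : R.lift f hf (R.incl x) = f x := by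
  refine (RingQuot.liftAlgHom_mkAlgHom_apply ℂ _ _ _).trans ?_
  simp

lemma quad_incl {r : A} (hr : r ∈ R.carrier) : R.quad R.incl r = 0 := by
  rw [incl, ← quad_comp]
  exact (RingQuot.mkAlgHom_rel ℂ (EnvRel.quad r hr)).trans (map_zero _)

lemma env_induction {p : R.Env → Prop} (halg : ∀ c : ℂ, p (algebraMap ℂ _ c))
    (hincl : ∀ x, p (R.incl x)) (hmul : ∀ x y, p x → p y → p (x * y))
    (hadd : ∀ x y, p x → p y → p (x + y)) (x : R.Env) : p x := by
  obtain ⟨y, rfl⟩ := RingQuot.mkAlgHom_surjective ℂ R.EnvRel x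
  change p (R.envMk y)
  induction y using TensorAlgebra.induction with
  | algebraMap c => simpa using halg c
  | ι x => exact hincl x
  | mul x y hx hy => rw [map_mul]; exact hmul _ _ hx hy
  | add x y hx hy => rw [map_add]; exact hadd _ _ hx hy

/-- The parity automorphism `η ↦ (-1)^{∂η} η`. -/
def envParity : R.Env →ₐ[ℂ] R.Env :=
  R.lift (-R.incl) (fun r hr => by
    rw [← R.quad_incl hr]
    simp only [quad, LinearMap.comp_apply]
    generalize (Coalgebra.comul (R := ℂ) r) = t
    induction t with
    | zero => simp
    | tmul x y => simp
    | add x y hx hy => simp only [map_add, hx, hy])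

lemma envParity_incl (x : R.Inv) : R.envParity (R.incl x) = -R.incl x := R.lift_incl _ _ x

open Coalgebra in
lemma quad_repr {T : Type*} [Ring T] [Algebra ℂ T] (f : R.Inv →ₗ[ℂ] T) (a : A)
    {ι : Type*} (s : Coalgebra.Repr ℂ a ι) :
    R.quad f a = ∑ i ∈ s.index, f (R.proj (s.left i)) * f (R.proj (s.right i)) := by
  simp [quad, ← s.eq]

lemma circ_quad {r : A} (hr : r ∈ R.carrier) {ι κ : Type*} (s : Coalgebra.Repr ℂ r ι)
    (a : A) (t : Coalgebra.Repr ℂ a κ) :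
    ∑ i ∈ s.index, ∑ j ∈ t.index, R.incl (R.circ (R.proj (s.left i)) (t.left j)) *
      R.incl (R.circ (R.proj (s.right i)) (t.right j)) = 0 := by
  have h1 : ∑ i ∈ s.index, ∑ j ∈ t.index, R.incl (R.proj (s.left i * t.left j)) *
      R.incl (R.proj (s.right i * t.right j)) = 0 := by
    rw [← R.quad_incl (R.mul_mem r hr a), quad]
    simp only [LinearMap.comp_apply, Bialgebra.comul_mul]
    rw [← s.eq, ← t.eq]
    simp [Finset.sum_mul_sum]
  have e1 : ∀ b : A, ∑ i ∈ s.index,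
      Coalgebra.counit (R := ℂ) (s.left i) • R.proj (s.right i * b) = 0 := by
    intro b
    have h := Coalgebra.sum_counit_smul (R := ℂ) s
    have h2 : R.proj ((∑ i ∈ s.index, Coalgebra.counit (R := ℂ) (s.left i) • s.right i) * b)
        = 0 := by
      rw [h]; exact R.proj_of_mem (R.mul_mem r hr b)
    simpa [Finset.sum_mul] using h2
  have e2 : ∀ b : A, ∑ i ∈ s.index,
      Coalgebra.counit (R := ℂ) (s.right i) • R.proj (s.left i * b) = 0 := by
    intro b
    have h : ∑ i ∈ s.index, Coalgebra.counit (R := ℂ) (s.right i) • s.left i = r := by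
      have h := congrArg (TensorProduct.rid ℂ A) (Coalgebra.sum_tmul_counit_eq (R := ℂ) s)
      simpa only [map_sum, TensorProduct.rid_tmul, one_smul] using h
    have h2 : R.proj ((∑ i ∈ s.index, Coalgebra.counit (R := ℂ) (s.right i) • s.left i) * b)
        = 0 := by
      rw [h]; exact R.proj_of_mem (R.mul_mem r hr b)
    simpa [Finset.sum_mul] using h2
  have e3 : ∑ i ∈ s.index, Coalgebra.counit (R := ℂ) (s.left i) *
      Coalgebra.counit (R := ℂ) (s.right i) = 0 := by
    have h := congrArg (Coalgebra.counit (R := ℂ)) (Coalgebra.sum_counit_smul (R := ℂ) s)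
    simpa [R.counit_eq_zero r hr] using h
  have key : ∀ i j, R.incl (R.circ (R.proj (s.left i)) (t.left j)) *
      R.incl (R.circ (R.proj (s.right i)) (t.right j)) =
      R.incl (R.proj (s.left i * t.left j)) * R.incl (R.proj (s.right i * t.right j))
      - R.incl (Coalgebra.counit (R := ℂ) (s.right i) • R.proj (s.left i * t.left j)) *
          R.incl (R.proj (t.right j))
      - R.incl (R.proj (t.left j)) *
          R.incl (Coalgebra.counit (R := ℂ) (s.left i) • R.proj (s.right i * t.right j))
      + (Coalgebra.counit (R := ℂ) (s.left i) * Coalgebra.counit (R := ℂ) (s.right i)) •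
          (R.incl (R.proj (t.left j)) * R.incl (R.proj (t.right j))) := by
    intro i j
    simp only [circ_proj, map_sub, map_smul, sub_mul, mul_sub, smul_mul_assoc, mul_smul_comm]
    module
  simp only [key, Finset.sum_add_distrib, Finset.sum_sub_distrib, h1]
  rw [Finset.sum_comm, Finset.sum_comm (s := s.index), Finset.sum_comm (s := s.index)]
  simp only [← Finset.sum_mul, ← Finset.mul_sum, ← Finset.sum_smul, ← map_sum, e1, e2, e3]
  simp

/-- The extension of `∘` to the envelope, as an algebra homomorphism into the convolution algebra
of linear maps on `A`; this encodes `(ηϑ) ∘ a = ∑ (η ∘ a₁)(ϑ ∘ a₂)` and `1 ∘ a = ε(a)1`. -/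
def circConv : R.Env →ₐ[ℂ] WithConv (A →ₗ[ℂ] R.Env) :=
  R.lift ((WithConv.linearEquiv ℂ (A →ₗ[ℂ] R.Env)).symm.toLinearMap ∘ₗ
      (LinearMap.llcomp ℂ A R.Inv R.Env R.incl) ∘ₗ R.circ) (by
    intro r hr
    let s := Coalgebra.Repr.arbitrary ℂ r
    rw [quad_repr _ _ _ s]
    ext a
    change _ = (0 : R.Env)
    rw [← R.circ_quad hr s a (Coalgebra.Repr.arbitrary ℂ a)]
    simp only [WithConv.ofConv_sum, LinearMap.sum_apply]
    refine Finset.sum_congr rfl fun i _ => ?_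
    exact (Coalgebra.Repr.arbitrary ℂ a).convMul_apply _ _)

/-- The right action `η ∘ a` of `A` on the left-invariant part of the envelope. -/
def circEnv : R.Env →ₗ[ℂ] A →ₗ[ℂ] R.Env :=
  (WithConv.linearEquiv ℂ (A →ₗ[ℂ] R.Env)).toLinearMap ∘ₗ R.circConv.toLinearMap

lemma circEnv_incl (x : R.Inv) (a : A) : R.circEnv (R.incl x) a = R.incl (R.circ x a) := by
  change (R.circConv (R.incl x)).ofConv a = _
  rw [circConv, lift_incl]
  rfl

lemma circEnv_one (a : A) : R.circEnv 1 a = algebraMap ℂ _ (Coalgebra.counit (R := ℂ) a) := by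
  change (R.circConv 1).ofConv a = _
  rw [map_one]; rfl

lemma circEnv_algebraMap (c : ℂ) (a : A) :
    R.circEnv (algebraMap ℂ _ c) a = algebraMap ℂ _ (c * Coalgebra.counit (R := ℂ) a) := by
  rw [Algebra.algebraMap_eq_smul_one, map_smul, LinearMap.smul_apply, circEnv_one,
    map_mul, Algebra.smul_def]

lemma circEnv_mul (x y : R.Env) (a : A) {ι : Type*} (s : Coalgebra.Repr ℂ a ι) :
    R.circEnv (x * y) a =
      ∑ i ∈ s.index, R.circEnv x (s.left i) * R.circEnv y (s.right i) := by
  change (R.circConv (x * y)).ofConv a = _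
  rw [map_mul]
  exact s.convMul_apply _ _

lemma circEnv_mul' (x y : R.Env) (a : A) :
    R.circEnv (x * y) a = LinearMap.mul' ℂ _ (TensorProduct.map (R.circEnv x) (R.circEnv y)
      (Coalgebra.comul (R := ℂ) a)) := by
  rw [circEnv_mul _ _ _ _ (Coalgebra.Repr.arbitrary ℂ a),
    ← (Coalgebra.Repr.arbitrary ℂ a).eq]
  simp

lemma circEnv_apply_one (x : R.Env) : R.circEnv x 1 = x := by
  induction x using R.env_induction with
  | halg c => simp [circEnv_algebraMap]
  | hincl x =>
    obtain ⟨a, rfl⟩ := R.proj_surjective x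
    simp [circEnv_incl, circ_proj, proj_one]
  | hmul x y hx hy => simp [circEnv_mul', Algebra.TensorProduct.one_def, hx, hy]
  | hadd x y hx hy => simp [hx, hy]

lemma circEnv_apply_mul (x : R.Env) (a b : A) :
    R.circEnv x (a * b) = R.circEnv (R.circEnv x a) b := by
  induction x using R.env_induction generalizing a b with
  | halg c => rw [circEnv_algebraMap, circEnv_algebraMap, circEnv_algebraMap,
      Bialgebra.counit_mul, mul_assoc]
  | hincl x =>
    obtain ⟨c, rfl⟩ := R.proj_surjective x
    simp only [circEnv_incl, circ_proj, map_sub, map_smul, LinearMap.sub_apply,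
      LinearMap.smul_apply, mul_assoc, Bialgebra.counit_mul, mul_smul, smul_sub]
    abel
  | hmul x y hx hy =>
    let s := Coalgebra.Repr.arbitrary ℂ a
    let t := Coalgebra.Repr.arbitrary ℂ b
    rw [circEnv_mul _ _ _ _ s, circEnv_mul', Bialgebra.comul_mul, ← s.eq, ← t.eq]
    simp only [map_sum, LinearMap.sum_apply, circEnv_mul _ _ _ _ t, Finset.sum_mul_sum,
      Algebra.TensorProduct.tmul_mul_tmul, TensorProduct.map_tmul, LinearMap.mul'_apply, hx, hy]
  | hadd x y hx hy => simp [hx, hy]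

lemma envParity_circEnv (x : R.Env) (a : A) :
    R.envParity (R.circEnv x a) = R.circEnv (R.envParity x) a := by
  induction x using R.env_induction generalizing a with
  | halg c => simp [circEnv_algebraMap]
  | hincl x => simp [circEnv_incl, envParity_incl]
  | hmul x y hx hy =>
    simp [circEnv_mul _ _ _ _ (Coalgebra.Repr.arbitrary ℂ a), hx, hy]
  | hadd x y hx hy => simp [hx, hy]

lemma envParity_envParity (x : R.Env) : R.envParity (R.envParity x) = x := by
  induction x using R.env_induction with
  | halg c => simp
  | hincl x => simp [envParity_incl]
  | hmul x y hx hy => simp [hx, hy]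
  | hadd x y hx hy => simp [hx, hy]

end CalcIdeal

/-- The sign operator `m ⊗ n ↦ (-1)^{∂m ∂n} m ⊗ n`, where `σ`, `τ` are the parity operators
`m ↦ (-1)^{∂m} m`, `n ↦ (-1)^{∂n} n`. -/
def koszul {M N : Type*} [AddCommGroup M] [Module ℂ M] [AddCommGroup N] [Module ℂ N]
    (σ : M →ₗ[ℂ] M) (τ : N →ₗ[ℂ] N) : M ⊗[ℂ] N →ₗ[ℂ] M ⊗[ℂ] N :=
  (1 / 2 : ℂ) • (LinearMap.id + TensorProduct.map σ LinearMap.id +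
    TensorProduct.map LinearMap.id τ - TensorProduct.map σ τ)

/-- An algebra `H` with a right coaction of `A` by an algebra homomorphism and a compatible parity
automorphism (`parity φ = (-1)^{∂φ} φ`). -/
structure ComoduleAlgebra (A H : Type*) [Ring A] [HopfAlgebra ℂ A] [Ring H] [Algebra ℂ H] where
  coact : H →ₐ[ℂ] H ⊗[ℂ] A
  coassoc : ∀ x, TensorProduct.assoc ℂ H A A (coact.toLinearMap.rTensor A (coact x)) =
    (Coalgebra.comul (R := ℂ)).lTensor H (coact x)
  counit : ∀ x, TensorProduct.rid ℂ H ((Coalgebra.counit (R := ℂ)).lTensor H (coact x)) = x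
  parity : H →ₐ[ℂ] H
  parity_parity : ∀ x, parity (parity x) = x
  coact_parity : ∀ x, coact (parity x) = parity.toLinearMap.rTensor A (coact x)

section Smash

variable {A H : Type*} [Ring A] [HopfAlgebra ℂ A] [Ring H] [Algebra ℂ H]

/-- The algebra `H ⊗ Env`, with product
`(ψ ⊗ η)(φ ⊗ ϑ) = (-1)^{∂η ∂φ} ∑ ψ φₖ ⊗ (η ∘ cₖ) ϑ`, where `∑ φₖ ⊗ cₖ` is the coaction on `φ`. -/
def Smash (_X : ComoduleAlgebra A H) (R : CalcIdeal A) : Type _ := H ⊗[ℂ] R.Env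

namespace Smash

variable (X : ComoduleAlgebra A H) (R : CalcIdeal A)

/-- The decomposable element `φ ⊗ η`. -/
def tmul (x : H) (y : R.Env) : Smash X R := x ⊗ₜ[ℂ] y

/-- `η ⊗ φ ↦ (-1)^{∂η ∂φ} ∑ φₖ ⊗ (η ∘ cₖ)`. -/
def swap : R.Env ⊗[ℂ] H →ₗ[ℂ] H ⊗[ℂ] R.Env :=
  (TensorProduct.lift R.circEnv).lTensor H ∘ₗ
    (TensorProduct.leftComm ℂ R.Env H A).toLinearMap ∘ₗ
    X.coact.toLinearMap.lTensor R.Env ∘ₗ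
    koszul R.envParity.toLinearMap X.parity.toLinearMap

/-- The product of `H ⊗ Env`. -/
def mulMap : (H ⊗[ℂ] R.Env) ⊗[ℂ] (H ⊗[ℂ] R.Env) →ₗ[ℂ] H ⊗[ℂ] R.Env :=
  TensorProduct.map (LinearMap.mul' ℂ H) (LinearMap.mul' ℂ R.Env) ∘ₗ
    (TensorProduct.assoc ℂ H H (R.Env ⊗[ℂ] R.Env)).symm.toLinearMap ∘ₗ
    ((TensorProduct.assoc ℂ H R.Env R.Env).toLinearMap ∘ₗ
      (swap X R).rTensor R.Env ∘ₗ
      (TensorProduct.assoc ℂ R.Env H R.Env).symm.toLinearMap).lTensor H ∘ₗ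
    (TensorProduct.assoc ℂ H R.Env (H ⊗[ℂ] R.Env)).toLinearMap

/-- `x ⊗ y ↦ ψ x ⊗ y ϑ`. -/
def outer (ψ : H) (ϑ : R.Env) : H ⊗[ℂ] R.Env →ₗ[ℂ] H ⊗[ℂ] R.Env :=
  TensorProduct.map (LinearMap.mulLeft ℂ ψ) (LinearMap.mulRight ℂ ϑ)

lemma mulMap_tmul (ψ φ : H) (η ϑ : R.Env) :
    mulMap X R ((ψ ⊗ₜ[ℂ] η) ⊗ₜ[ℂ] (φ ⊗ₜ[ℂ] ϑ)) = outer R ψ ϑ (swap X R (η ⊗ₜ φ)) := by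
  simp only [mulMap, LinearMap.comp_apply, LinearEquiv.coe_coe, TensorProduct.assoc_tmul,
    LinearMap.lTensor_tmul, TensorProduct.assoc_symm_tmul, LinearMap.rTensor_tmul]
  generalize swap X R (η ⊗ₜ φ) = t
  induction t with
  | zero => simp
  | tmul a b => simp [outer]
  | add a b ha hb => simp only [TensorProduct.add_tmul, TensorProduct.tmul_add, map_add, ha, hb]

/-- `x ⊗ c ↦ x ⊗ (η ∘ c)`. -/
def push (η : R.Env) : H ⊗[ℂ] A →ₗ[ℂ] H ⊗[ℂ] R.Env := (R.circEnv η).lTensor H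

/-- The exchange rule with `φ` reads `η φ = ∑ φₖ (g(η) ∘ cₖ)`. -/
def Good (g : R.Env →ₐ[ℂ] R.Env) (φ : H) : Prop :=
  ∀ η, swap X R (η ⊗ₜ φ) = push R (g η) (X.coact φ)

variable {X R}

lemma good_even {φ : H} (h : X.parity φ = φ) : Good X R (AlgHom.id ℂ _) φ := by
  intro η
  have hk : koszul R.envParity.toLinearMap X.parity.toLinearMap (η ⊗ₜ[ℂ] φ) = η ⊗ₜ φ := by
    simp only [koszul, LinearMap.smul_apply, LinearMap.add_apply, LinearMap.sub_apply,
      TensorProduct.map_tmul, LinearMap.id_apply, AlgHom.toLinearMap_apply, h]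
    module
  simp only [swap, LinearMap.comp_apply, hk, LinearMap.lTensor_tmul, AlgHom.toLinearMap_apply,
    push, AlgHom.id_apply]
  generalize X.coact φ = t
  induction t with
  | zero => simp
  | tmul a b => simp
  | add a b ha hb => simp only [TensorProduct.tmul_add, map_add, ha, hb]

lemma good_odd {φ : H} (h : X.parity φ = -φ) : Good X R R.envParity φ := by
  intro η
  have hk : koszul R.envParity.toLinearMap X.parity.toLinearMap (η ⊗ₜ[ℂ] φ) =
      R.envParity η ⊗ₜ φ := by
    simp only [koszul, LinearMap.smul_apply, LinearMap.add_apply, LinearMap.sub_apply,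
      TensorProduct.map_tmul, LinearMap.id_apply, AlgHom.toLinearMap_apply, h,
      TensorProduct.tmul_neg]
    module
  simp only [swap, LinearMap.comp_apply, hk, LinearMap.lTensor_tmul, AlgHom.toLinearMap_apply,
    push]
  generalize X.coact φ = t
  induction t with
  | zero => simp
  | tmul a b => simp
  | add a b ha hb => simp only [TensorProduct.tmul_add, map_add, ha, hb]


/-- A good element with good coefficients. -/
def VeryGood (X : ComoduleAlgebra A H) (R : CalcIdeal A) (g : R.Env →ₐ[ℂ] R.Env) (φ : H) : Prop :=
  Good X R g φ ∧ ((g = AlgHom.id ℂ _ ∧ X.parity φ = φ) ∨ (g = R.envParity ∧ X.parity φ = -φ)) ∧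
    ∃ (S : Finset (H × A)) (x : H × A → H),
      X.coact φ = ∑ i ∈ S, x i ⊗ₜ[ℂ] i.2 ∧ ∀ i, Good X R g (x i)

lemma veryGood_even {φ : H} (h : X.parity φ = φ) : VeryGood X R (AlgHom.id ℂ _) φ := by
  refine ⟨good_even h, Or.inl ⟨rfl, h⟩, ?_⟩
  obtain ⟨S, hS⟩ := TensorProduct.exists_finset (X.coact φ)
  refine ⟨S, fun i => (1 / 2 : ℂ) • (i.1 + X.parity i.1), ?_, fun i => good_even ?_⟩
  · have h2 := X.coact_parity φ
    rw [h, hS] at h2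
    have h3 : X.coact φ = (1 / 2 : ℂ) • (X.coact φ + X.coact φ) := by module
    rw [h3]
    nth_rewrite 2 [hS]
    rw [h2, hS, map_sum, ← Finset.sum_add_distrib, Finset.smul_sum]
    exact Finset.sum_congr rfl fun i _ => by
      simp [TensorProduct.add_tmul, TensorProduct.smul_tmul']
  · simp [X.parity_parity, add_comm]

lemma veryGood_odd {φ : H} (h : X.parity φ = -φ) : VeryGood X R R.envParity φ := by
  refine ⟨good_odd h, Or.inr ⟨rfl, h⟩, ?_⟩
  obtain ⟨S, hS⟩ := TensorProduct.exists_finset (X.coact φ)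
  refine ⟨S, fun i => (1 / 2 : ℂ) • (i.1 - X.parity i.1), ?_, fun i => good_odd ?_⟩
  · have h2 := X.coact_parity φ
    rw [h, map_neg] at h2
    have h3 : X.coact φ = (1 / 2 : ℂ) • (X.coact φ - -X.coact φ) := by module
    rw [h3, h2, hS, map_sum, ← Finset.sum_sub_distrib, Finset.smul_sum]
    exact Finset.sum_congr rfl fun i _ => by
      rw [← TensorProduct.smul_tmul', TensorProduct.sub_tmul]; rfl
  · simp [X.parity_parity, ← smul_neg]

lemma homogeneous_induction (X : ComoduleAlgebra A H) (R : CalcIdeal A) {p : H → Prop}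
    (h : ∀ g φ, VeryGood X R g φ → p φ)
    (hadd : ∀ x y, p x → p y → p (x + y)) (φ : H) : p φ := by
  have e : φ = (1 / 2 : ℂ) • (φ + X.parity φ) + (1 / 2 : ℂ) • (φ - X.parity φ) := by module
  rw [e]
  refine hadd _ _ (h _ _ (veryGood_even ?_)) (h _ _ (veryGood_odd ?_))
  · simp [X.parity_parity, add_comm]
  · simp [X.parity_parity, ← smul_neg]

lemma outer_tmul (R : CalcIdeal A) (ψ x : H) (ϑ y : R.Env) :
    outer R ψ ϑ (x ⊗ₜ y) = (ψ * x) ⊗ₜ (y * ϑ) := rfl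

lemma outer_outer (R : CalcIdeal A) (ψ x : H) (ϑ y : R.Env) (t : H ⊗[ℂ] R.Env) :
    outer R ψ ϑ (outer R x y t) = outer R (ψ * x) (y * ϑ) t := by
  induction t with
  | zero => simp only [map_zero]
  | tmul a b => simp only [outer_tmul, mul_assoc]
  | add a b ha hb => simp only [map_add, ha, hb]

lemma swap_mul (η η' : R.Env) (φ : H) :
    swap X R ((η * η') ⊗ₜ φ) = mulMap X R ((1 ⊗ₜ η) ⊗ₜ swap X R (η' ⊗ₜ φ)) := by
  induction φ using homogeneous_induction X R generalizing η η' with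
  | h g φ hφ =>
    obtain ⟨hg, -, S, x, hS, hx⟩ := hφ
    let K : (H ⊗[ℂ] A) ⊗[ℂ] A →ₗ[ℂ] H ⊗[ℂ] R.Env :=
      (LinearMap.mul' ℂ R.Env ∘ₗ
        TensorProduct.map (R.circEnv (g η)) (R.circEnv (g η'))).lTensor H ∘ₗ
        (TensorProduct.assoc ℂ H A A).toLinearMap
    have h1 : swap X R ((η * η') ⊗ₜ φ) = K (X.coact.toLinearMap.rTensor A (X.coact φ)) := by
      simp only [K, LinearMap.comp_apply, LinearEquiv.coe_coe, X.coassoc]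
      rw [hg, map_mul, push]
      generalize X.coact φ = t
      induction t with
      | zero => simp
      | tmul a b =>
        simp only [LinearMap.lTensor_tmul, LinearMap.comp_apply, R.circEnv_mul']
      | add a b ha hb => simp only [map_add, ha, hb]
    have h2 : ∀ (t : H ⊗[ℂ] A) (c : A), K (t ⊗ₜ c) =
        outer R 1 (R.circEnv (g η') c) (push R (g η) t) := by
      intro t c
      induction t with
      | zero => simp
      | tmul a b => simp [K, push, outer_tmul]
      | add a b ha hb => simp only [TensorProduct.add_tmul, map_add, ha, hb]
    rw [h1, hg, hS]
    simp only [map_sum, TensorProduct.tmul_sum, LinearMap.rTensor_tmul, h2, push,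
      LinearMap.lTensor_tmul, mulMap_tmul]
    refine Finset.sum_congr rfl fun i _ => ?_
    rw [hx i]
    rfl
  | hadd x y hx hy => simp only [TensorProduct.tmul_add, map_add, hx, hy]

lemma VeryGood.mul {g g' : R.Env →ₐ[ℂ] R.Env} {φ φ' : H} (h : VeryGood X R g φ)
    (h' : VeryGood X R g' φ') : Good X R (g'.comp g) (φ * φ') := by
  rcases h.2.1 with ⟨rfl, h1⟩ | ⟨rfl, h1⟩ <;> rcases h'.2.1 with ⟨rfl, h2⟩ | ⟨rfl, h2⟩
  · exact good_even (by rw [map_mul, h1, h2])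
  · exact good_odd (by rw [map_mul, h1, h2, mul_neg])
  · exact good_odd (by rw [map_mul, h1, h2, neg_mul])
  · intro η
    rw [good_even (by rw [map_mul, h1, h2, neg_mul_neg]) η, AlgHom.comp_apply,
      R.envParity_envParity, AlgHom.id_apply]

lemma VeryGood.circ {g : R.Env →ₐ[ℂ] R.Env} {φ : H} (h : VeryGood X R g φ) (η : R.Env) (c : A) :
    g (R.circEnv η c) = R.circEnv (g η) c := by
  rcases h.2.1 with ⟨rfl, -⟩ | ⟨rfl, -⟩
  · rfl
  · exact R.envParity_circEnv _ _

lemma swap_mul_right (η : R.Env) (φ φ' : H) :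
    swap X R (η ⊗ₜ (φ * φ')) = mulMap X R (swap X R (η ⊗ₜ φ) ⊗ₜ (φ' ⊗ₜ 1)) := by
  induction φ using homogeneous_induction X R with
  | hadd x y hx hy =>
    simp only [add_mul, TensorProduct.tmul_add, TensorProduct.add_tmul, map_add, hx, hy]
  | h g φ hφ =>
  induction φ' using homogeneous_induction X R with
  | hadd x y hx hy =>
    simp only [mul_add, TensorProduct.tmul_add, TensorProduct.add_tmul, map_add, hx, hy]
  | h g' φ' hφ' =>
  rw [hφ.mul hφ', hφ.1, map_mul]
  generalize X.coact φ = t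
  induction t with
  | zero => simp
  | add a b ha hb => simp only [add_mul, TensorProduct.add_tmul, map_add, ha, hb]
  | tmul x c =>
    have e : push R (g η) (x ⊗ₜ[ℂ] c) = x ⊗ₜ R.circEnv (g η) c := rfl
    rw [e, mulMap_tmul, hφ'.1, hφ'.circ]
    generalize X.coact φ' = t
    induction t with
    | zero => simp
    | add a b ha hb => simp only [mul_add, map_add, ha, hb]
    | tmul y d => simp [push, outer_tmul, R.circEnv_apply_mul]

lemma mulMap_left (x : H) (y : R.Env) (t : H ⊗[ℂ] R.Env) :
    mulMap X R ((x ⊗ₜ y) ⊗ₜ t) = outer R x 1 (mulMap X R ((1 ⊗ₜ y) ⊗ₜ t)) := by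
  induction t with
  | zero => simp only [TensorProduct.tmul_zero, map_zero]
  | add a b ha hb => simp only [TensorProduct.tmul_add, map_add, ha, hb]
  | tmul a b => simp only [mulMap_tmul, outer_outer, mul_one]

lemma mulMap_right (x : H) (y : R.Env) (t : H ⊗[ℂ] R.Env) :
    mulMap X R (t ⊗ₜ (x ⊗ₜ y)) = outer R 1 y (mulMap X R (t ⊗ₜ (x ⊗ₜ 1))) := by
  induction t with
  | zero => simp only [TensorProduct.zero_tmul, map_zero]
  | add a b ha hb => simp only [TensorProduct.add_tmul, map_add, ha, hb]
  | tmul a b => simp only [mulMap_tmul, outer_outer, one_mul]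

lemma mulMap_assoc (a b c : H ⊗[ℂ] R.Env) :
    mulMap X R (mulMap X R (a ⊗ₜ b) ⊗ₜ c) = mulMap X R (a ⊗ₜ mulMap X R (b ⊗ₜ c)) := by
  induction a with
  | zero => simp only [TensorProduct.zero_tmul, map_zero]
  | add a a' ha ha' => simp only [TensorProduct.add_tmul, map_add, ha, ha']
  | tmul ψ η =>
  induction b with
  | zero => simp only [TensorProduct.zero_tmul, TensorProduct.tmul_zero, map_zero]
  | add b b' hb hb' => simp only [TensorProduct.add_tmul, TensorProduct.tmul_add, map_add, hb, hb']
  | tmul φ ϑ =>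
  induction c with
  | zero => simp only [TensorProduct.tmul_zero, map_zero]
  | add c c' hc hc' => simp only [TensorProduct.tmul_add, map_add, hc, hc']
  | tmul χ ζ =>
  rw [mulMap_tmul, mulMap_tmul]
  have hl : ∀ s : H ⊗[ℂ] R.Env, mulMap X R (outer R ψ ϑ s ⊗ₜ (χ ⊗ₜ ζ)) =
      outer R ψ ζ (mulMap X R (s ⊗ₜ swap X R (ϑ ⊗ₜ χ))) := by
    intro s
    induction s with
    | zero => simp only [TensorProduct.zero_tmul, map_zero]
    | add a b ha hb => simp only [TensorProduct.add_tmul, map_add, ha, hb]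
    | tmul x y =>
      rw [outer_tmul, mulMap_tmul, swap_mul, mulMap_left x y, outer_outer, one_mul]
  have hr : ∀ t : H ⊗[ℂ] R.Env, mulMap X R ((ψ ⊗ₜ η) ⊗ₜ outer R φ ζ t) =
      outer R ψ ζ (mulMap X R (swap X R (η ⊗ₜ φ) ⊗ₜ t)) := by
    intro t
    induction t with
    | zero => simp only [TensorProduct.tmul_zero, map_zero]
    | add a b ha hb => simp only [TensorProduct.tmul_add, map_add, ha, hb]
    | tmul x y =>
      rw [outer_tmul, mulMap_tmul, swap_mul_right, mulMap_right x y, outer_outer, mul_one]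
  rw [hl, hr]

lemma swap_one_left (φ : H) : swap X R (1 ⊗ₜ φ) = φ ⊗ₜ 1 := by
  induction φ using homogeneous_induction X R with
  | hadd x y hx hy => simp only [TensorProduct.tmul_add, TensorProduct.add_tmul, map_add, hx, hy]
  | h g φ hφ =>
    rw [hφ.1, map_one]
    conv_rhs => rw [← X.counit φ]
    generalize X.coact φ = t
    induction t with
    | zero => simp
    | add a b ha hb => simp only [TensorProduct.add_tmul, map_add, ha, hb]
    | tmul x c =>
      simp [push, R.circEnv_one, Algebra.algebraMap_eq_smul_one, TensorProduct.smul_tmul]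

lemma swap_one_right (η : R.Env) : swap X R (η ⊗ₜ 1) = 1 ⊗ₜ η := by
  rw [good_even (map_one _), map_one]
  simp [push, Algebra.TensorProduct.one_def, R.circEnv_apply_one]

lemma one_mulMap (t : H ⊗[ℂ] R.Env) : mulMap X R ((1 ⊗ₜ 1) ⊗ₜ t) = t := by
  induction t with
  | zero => simp only [TensorProduct.tmul_zero, map_zero]
  | add a b ha hb => simp only [TensorProduct.tmul_add, map_add, ha, hb]
  | tmul a b => rw [mulMap_tmul, swap_one_left, outer_tmul, one_mul, one_mul]

lemma mulMap_one (t : H ⊗[ℂ] R.Env) : mulMap X R (t ⊗ₜ (1 ⊗ₜ 1)) = t := by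
  induction t with
  | zero => simp only [TensorProduct.zero_tmul, map_zero]
  | add a b ha hb => simp only [TensorProduct.add_tmul, map_add, ha, hb]
  | tmul a b => rw [mulMap_tmul, swap_one_right, outer_tmul, mul_one, mul_one]

variable (X R) in
instance : Mul (Smash X R) := ⟨fun x y => mulMap X R (x ⊗ₜ[ℂ] y)⟩

variable (X R) in
instance : One (Smash X R) := ⟨tmul X R 1 1⟩

instance : Ring (Smash X R) where
  __ := (inferInstanceAs (AddCommGroup (H ⊗[ℂ] R.Env)) : AddCommGroup (Smash X R))
  mul_assoc a b c := mulMap_assoc a b c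
  one_mul := one_mulMap
  mul_one := mulMap_one
  left_distrib a b c :=
    (congrArg (mulMap X R) (TensorProduct.tmul_add (R := ℂ) (M := H ⊗[ℂ] R.Env)
      (N := H ⊗[ℂ] R.Env) a b c)).trans ((mulMap X R).map_add _ _)
  right_distrib a b c :=
    (congrArg (mulMap X R) (TensorProduct.add_tmul (R := ℂ) (M := H ⊗[ℂ] R.Env)
      (N := H ⊗[ℂ] R.Env) a b c)).trans ((mulMap X R).map_add _ _)
  zero_mul a :=
    (congrArg (mulMap X R) (TensorProduct.zero_tmul (R := ℂ) (M := H ⊗[ℂ] R.Env)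
      (N := H ⊗[ℂ] R.Env) a)).trans (mulMap X R).map_zero
  mul_zero a :=
    (congrArg (mulMap X R) (TensorProduct.tmul_zero (R := ℂ) (M := H ⊗[ℂ] R.Env)
      (N := H ⊗[ℂ] R.Env) a)).trans (mulMap X R).map_zero

instance : Algebra ℂ (Smash X R) :=
  letI : Module ℂ (Smash X R) := inferInstanceAs (Module ℂ (H ⊗[ℂ] R.Env))
  Algebra.ofModule
    (fun c x y => ((mulMap X R).map_smul c (TensorProduct.tmul ℂ (M := H ⊗[ℂ] R.Env)
      (N := H ⊗[ℂ] R.Env) x y)))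
    (fun c x y => (congrArg (mulMap X R) (TensorProduct.tmul_smul (R := ℂ) (M := H ⊗[ℂ] R.Env)
      (N := H ⊗[ℂ] R.Env) c x y)).trans ((mulMap X R).map_smul _ _))

variable (X R) in
/-- The identity map from the underlying tensor product. -/
def ofTensor : H ⊗[ℂ] R.Env ≃ₗ[ℂ] Smash X R := LinearEquiv.refl ℂ (H ⊗[ℂ] R.Env)

lemma ofTensor_tmul (x : H) (y : R.Env) : ofTensor X R (x ⊗ₜ y) = tmul X R x y := rfl

lemma ofTensor_mul (s t : H ⊗[ℂ] R.Env) :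
    ofTensor X R s * ofTensor X R t = ofTensor X R (mulMap X R (s ⊗ₜ t)) := rfl

end Smash
end Smash

/-- `A` coacting on itself by the coproduct, all elements being even. -/
def ComoduleAlgebra.self (A : Type*) [Ring A] [HopfAlgebra ℂ A] : ComoduleAlgebra A A where
  coact := Bialgebra.comulAlgHom ℂ A
  coassoc x := Coalgebra.coassoc_apply x
  counit x := by
    have h := congrArg (TensorProduct.rid ℂ A) (Coalgebra.lTensor_counit_comul (R := ℂ) x)
    rw [TensorProduct.rid_tmul, one_smul] at h
    exact h
  parity := AlgHom.id ℂ A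
  parity_parity _ := rfl
  coact_parity x := by
    rw [AlgHom.id_apply, AlgHom.toLinearMap_id, LinearMap.rTensor_id, LinearMap.id_apply]

/-- A graded `*`-algebra `H = ⨁ deg n` of horizontal forms on a quantum principal bundle, with the
right coaction `coact` of `A`. The algebra of functions on the bundle is `deg 0`; its coaction is the
restriction of `coact`, and is free. The `*`-structures on graded algebras are
graded-antimultiplicative: `(φψ)* = (-1)^{∂φ ∂ψ} ψ* φ*`. -/
structure HorizontalForms (A H : Type*) [Ring A] [HopfAlgebra ℂ A] [StarRing A] [StarModule ℂ A]
    [Ring H] [Algebra ℂ H] [StarAddMonoid H] [StarModule ℂ H] where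
  /-- The homogeneous components. -/
  deg : ℕ → Submodule ℂ H
  [graded : GradedAlgebra deg]
  /-- The `*`-structure preserves degrees and is graded-antimultiplicative. -/
  star_mem : ∀ n, ∀ φ ∈ deg n, star φ ∈ deg n
  star_mul : ∀ m n, ∀ φ ∈ deg m, ∀ ψ ∈ deg n,
    star (φ * ψ) = (-1 : ℂ) ^ (m * n) • (star ψ * star φ)
  /-- The coaction, a grade-preserving `*`-homomorphism. -/
  coact : H →ₐ[ℂ] H ⊗[ℂ] A
  coact_deg : ∀ n, ∀ φ ∈ deg n, coact φ ∈ LinearMap.range ((deg n).subtype.rTensor A)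
  coact_star : ∀ φ, coact (star φ) = star (coact φ)
  coassoc : ∀ φ, TensorProduct.assoc ℂ H A A (coact.toLinearMap.rTensor A (coact φ)) =
    (Coalgebra.comul (R := ℂ)).lTensor H (coact φ)
  counit : ∀ φ, TensorProduct.rid ℂ H ((Coalgebra.counit (R := ℂ)).lTensor H (coact φ)) = φ
  /-- Freeness: every `1 ⊗ a` is of the form `∑ qᵢ F(bᵢ)`. -/
  free : ∀ a : A, ∃ (n : ℕ) (q b : Fin n → H), (∀ i, q i ∈ deg 0 ∧ b i ∈ deg 0) ∧
    ∑ i, (q i ⊗ₜ[ℂ] (1 : A)) * coact (b i) = 1 ⊗ₜ[ℂ] a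

namespace HorizontalForms

variable {A H : Type*} [Ring A] [HopfAlgebra ℂ A] [StarRing A] [StarModule ℂ A]
    [Ring H] [Algebra ℂ H] [StarAddMonoid H] [StarModule ℂ H] (P : HorizontalForms A H)

instance : GradedAlgebra P.deg := P.graded

/-- The algebra of forms on the base: the coaction-invariant elements. -/
def base : Subalgebra ℂ H := AlgHom.equalizer P.coact Algebra.TensorProduct.includeLeft

lemma mem_base {φ : H} : φ ∈ P.base ↔ P.coact φ = φ ⊗ₜ 1 := Iff.rfl

lemma star_mem_base {φ : H} (h : φ ∈ P.base) : star φ ∈ P.base := by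
  rw [mem_base, P.coact_star, P.mem_base.1 h, TensorProduct.star_tmul, star_one]

/-- The map `φ ↦ (-1)^{∂φ} φ`. -/
def parityLin : H →ₗ[ℂ] H :=
  DirectSum.toModule ℂ ℕ H (fun n => (-1 : ℂ) ^ n • (P.deg n).subtype) ∘ₗ
    (DirectSum.decomposeLinearEquiv P.deg).toLinearMap

lemma parityLin_of_mem {n : ℕ} {φ : H} (h : φ ∈ P.deg n) : P.parityLin φ = (-1 : ℂ) ^ n • φ := by
  change DirectSum.toModule ℂ ℕ H _ (DirectSum.decompose P.deg φ) = _
  rw [DirectSum.decompose_of_mem _ h, ← DirectSum.lof_eq_of ℂ, DirectSum.toModule_lof]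
  rfl

lemma deg_induction {p : H → Prop} (h : ∀ n, ∀ φ ∈ P.deg n, p φ) (h0 : p 0)
    (hadd : ∀ x y, p x → p y → p (x + y)) (φ : H) : p φ :=
  DirectSum.Decomposition.inductionOn P.deg h0 (fun {i} m => h i m.1 m.2) hadd φ

/-- The parity automorphism `φ ↦ (-1)^{∂φ} φ`. -/
def parity : H →ₐ[ℂ] H :=
  AlgHom.ofLinearMap P.parityLin
    (by
      have h := P.parityLin_of_mem (n := 0) (φ := 1) SetLike.GradedOne.one_mem
      simpa using h)
    (by
      intro x y
      induction x using P.deg_induction with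
      | h0 => simp
      | hadd a b ha hb => simp only [add_mul, map_add, ha, hb]
      | h m x hx =>
        induction y using P.deg_induction with
        | h0 => simp
        | hadd a b ha hb => simp only [mul_add, map_add, ha, hb]
        | h n y hy =>
          rw [P.parityLin_of_mem hx, P.parityLin_of_mem hy,
            P.parityLin_of_mem (SetLike.GradedMul.mul_mem hx hy), pow_add, smul_mul_smul_comm])

lemma parity_of_mem {n : ℕ} {φ : H} (h : φ ∈ P.deg n) : P.parity φ = (-1 : ℂ) ^ n • φ :=
  P.parityLin_of_mem h

/-- Horizontal forms as a comodule algebra with parity. -/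
def comodule : ComoduleAlgebra A H where
  coact := P.coact
  coassoc := P.coassoc
  counit := P.counit
  parity := P.parity
  parity_parity x := by
    induction x using P.deg_induction with
    | h0 => simp
    | hadd a b ha hb => simp only [map_add, ha, hb]
    | h m x hx =>
      rw [P.parity_of_mem hx, map_smul, P.parity_of_mem hx, smul_smul, ← mul_pow]
      simp
  coact_parity x := by
    induction x using P.deg_induction with
    | h0 => simp
    | hadd a b ha hb => simp only [map_add, ha, hb]
    | h m x hx =>
      rw [P.parity_of_mem hx, map_smul]
      obtain ⟨t, ht⟩ := P.coact_deg m x hx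
      rw [← ht]
      clear ht
      induction t with
      | zero => simp
      | add a b ha hb => simp only [map_add, smul_add, ha, hb]
      | tmul a b => simp [P.parity_of_mem a.2, TensorProduct.smul_tmul']

/-- The map `φ ↦ ∑ φₖ χ(cₖ)`. -/
def contract (χ : A →ₗ[ℂ] H) : H →ₗ[ℂ] H :=
  LinearMap.mul' ℂ H ∘ₗ χ.lTensor H ∘ₗ P.coact.toLinearMap

lemma contract_mul_mem (T : H →ₗ[ℂ] H) (χ : A →ₗ[ℂ] H)
    (hT : ∀ b ∈ P.deg 0, T b = -P.contract χ b)
    (hder : ∀ b ∈ P.deg 0, ∀ c ∈ P.deg 0, T (b * c) = T b * c + b * T c)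
    {r : A} (hr : Coalgebra.counit (R := ℂ) r = 0) (hχ : χ r = 0) (a : A) : χ (r * a) = 0 := by
  -- evaluating a one-sided tensor on `χ`
  let V : H ⊗[ℂ] A →ₗ[ℂ] H := LinearMap.mul' ℂ H ∘ₗ χ.lTensor H
  have hV : ∀ (q : H) (t : H ⊗[ℂ] A), V ((q ⊗ₜ 1) * t) = q * V t := by
    intro q t
    induction t with
    | zero => simp
    | add x y hx hy => simp only [mul_add, map_add, hx, hy]
    | tmul x y => simp [V, mul_assoc]
  have hc : ∀ b, P.contract χ b = V (P.coact b) := fun b => rfl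
  obtain ⟨n, p, e, hpe, he⟩ := P.free r
  obtain ⟨m, q, b, hqb, hb⟩ := P.free a
  have hpe0 : ∑ j, p j * e j = 0 := by
    have h2 := congrArg
      (fun t => TensorProduct.rid ℂ H ((Coalgebra.counit (R := ℂ)).lTensor H t)) he
    simp only [map_sum] at h2
    have h3 : ∀ (x : H) (t : H ⊗[ℂ] A),
        TensorProduct.rid ℂ H ((Coalgebra.counit (R := ℂ)).lTensor H ((x ⊗ₜ 1) * t)) =
        x * TensorProduct.rid ℂ H ((Coalgebra.counit (R := ℂ)).lTensor H t) := by
      intro x t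
      induction t with
      | zero => simp
      | add x y hx hy => simp only [mul_add, map_add, hx, hy]
      | tmul x y => simp
    simpa [h3, P.counit, hr] using h2
  have h1 : ∀ c ∈ P.deg 0, V ((1 ⊗ₜ r) * P.coact c) = 0 := by
    intro c hcm
    have h4 : V ((1 ⊗ₜ r) * P.coact c) = -∑ j, p j * T (e j * c) := by
      rw [← he, Finset.sum_mul, map_sum, ← Finset.sum_neg_distrib]
      refine Finset.sum_congr rfl fun j _ => ?_
      have hm : e j * c ∈ P.deg 0 := by
        simpa using SetLike.GradedMul.mul_mem (hpe j).2 hcm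
      rw [mul_assoc, ← map_mul, hV, ← hc, hT _ hm, mul_neg, neg_neg]
    have h5 : ∑ j, p j * T (e j) = -χ r := by
      have h6 : ∑ j, p j * P.contract χ (e j) = χ r := by
        have := congrArg V he
        simpa [hV, hc, map_sum, V] using this
      rw [← h6, ← Finset.sum_neg_distrib]
      exact Finset.sum_congr rfl fun j _ => by rw [hT _ (hpe j).2, mul_neg]
    have h7 : ∑ j, p j * T (e j * c) = (∑ j, p j * T (e j)) * c + (∑ j, p j * e j) * T c := by
      rw [Finset.sum_mul, Finset.sum_mul, ← Finset.sum_add_distrib]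
      exact Finset.sum_congr rfl fun j _ => by
        rw [hder _ (hpe j).2 _ hcm, mul_add, mul_assoc, mul_assoc]
    rw [h4, h7, h5, hpe0, hχ]
    simp
  have h8 : χ (r * a) = V ((1 ⊗ₜ r) * (1 ⊗ₜ a)) := by simp [V]
  rw [h8, ← hb, Finset.mul_sum, map_sum]
  refine Finset.sum_eq_zero fun i _ => ?_
  have h9 : (1 ⊗ₜ[ℂ] r) * ((q i ⊗ₜ[ℂ] (1 : A)) * P.coact (b i)) =
      (q i ⊗ₜ[ℂ] (1 : A)) * ((1 ⊗ₜ[ℂ] r) * P.coact (b i)) := by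
    rw [← mul_assoc, ← mul_assoc]
    simp
  rw [h9, hV, h1 _ (hqb i).2, mul_zero]

end HorizontalForms

/-- A quantum principal bundle with a graded `*`-algebra of horizontal forms, together with a
differential `*`-algebra structure `dM` on the algebra of forms on the base. -/
structure QuantumPrincipalBundle (A H : Type*) [Ring A] [HopfAlgebra ℂ A] [StarRing A]
    [StarModule ℂ A] [Ring H] [Algebra ℂ H] [StarAddMonoid H] [StarModule ℂ H] extends
    HorizontalForms A H where
  dM : toHorizontalForms.base →ₗ[ℂ] toHorizontalForms.base
  dM_deg : ∀ n, ∀ φ : toHorizontalForms.base, (φ : H) ∈ deg n → (dM φ : H) ∈ deg (n + 1)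
  dM_mul : ∀ n, ∀ φ ψ : toHorizontalForms.base, (φ : H) ∈ deg n →
    dM (φ * ψ) = dM φ * ψ + (-1 : ℂ) ^ n • (φ * dM ψ)
  dM_dM : ∀ φ, dM (dM φ) = 0
  dM_star : ∀ φ : toHorizontalForms.base,
    (dM ⟨star (φ : H), toHorizontalForms.star_mem_base φ.2⟩ : H) = star (dM φ : H)

namespace QuantumPrincipalBundle

variable {A H : Type*} [Ring A] [HopfAlgebra ℂ A] [StarRing A] [StarModule ℂ A]
    [Ring H] [Algebra ℂ H] [StarAddMonoid H] [StarModule ℂ H] (P : QuantumPrincipalBundle A H)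

/-- Preconnections: hermitian right-covariant first-order antiderivations extending `dM`. -/
structure IsPreconnection (D : H →ₗ[ℂ] H) : Prop where
  deg : ∀ n, ∀ φ ∈ P.deg n, D φ ∈ P.deg (n + 1)
  covariant : ∀ φ, P.coact (D φ) = D.rTensor A (P.coact φ)
  base : ∀ φ : P.base, D φ = P.dM φ
  leibniz : ∀ n, ∀ φ ∈ P.deg n, ∀ ψ, D (φ * ψ) = D φ * ψ + (-1 : ℂ) ^ n • (φ * D ψ)
  hermitian : ∀ φ, D (star φ) = star (D φ)

/-- The vector space of the affine space of preconnections: hermitian right-covariant first-order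
antiderivations that vanish on the forms on the base. -/
structure IsVariation (E : H →ₗ[ℂ] H) : Prop where
  deg : ∀ n, ∀ φ ∈ P.deg n, E φ ∈ P.deg (n + 1)
  covariant : ∀ φ, P.coact (E φ) = E.rTensor A (P.coact φ)
  base : ∀ φ ∈ P.base, E φ = 0
  leibniz : ∀ n, ∀ φ ∈ P.deg n, ∀ ψ, E (φ * ψ) = E φ * ψ + (-1 : ℂ) ^ n • (φ * E ψ)
  hermitian : ∀ φ, E (star φ) = star (E φ)

/-- The real affine space of all preconnections. -/
def preconnections : AffineSubspace ℝ (H →ₗ[ℂ] H) where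
  carrier := {D | P.IsPreconnection D}
  smul_vsub_vadd_mem' := by
    intro c D₁ D₂ D₃ h₁ h₂ h₃
    have key : ∀ φ, (c • (D₁ -ᵥ D₂) +ᵥ D₃) φ = (c : ℂ) • (D₁ φ - D₂ φ) + D₃ φ := fun φ => rfl
    refine ⟨fun n φ hφ => ?_, fun φ => ?_, fun φ => ?_, fun n φ hφ ψ => ?_, fun φ => ?_⟩
    · rw [key]
      exact add_mem (Submodule.smul_mem _ _ (sub_mem (h₁.deg n φ hφ) (h₂.deg n φ hφ)))
        (h₃.deg n φ hφ)
    · have e : (c • (D₁ -ᵥ D₂) +ᵥ D₃) = (c : ℂ) • (D₁ - D₂) + D₃ := rfl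
      rw [key, e, map_add, map_smul, map_sub, h₁.covariant, h₂.covariant, h₃.covariant,
        LinearMap.rTensor_add, LinearMap.rTensor_smul, LinearMap.rTensor_sub]
      rfl
    · rw [key, h₁.base, h₂.base, h₃.base]
      simp
    · simp only [key]
      rw [h₁.leibniz n φ hφ, h₂.leibniz n φ hφ, h₃.leibniz n φ hφ]
      simp only [add_mul, sub_mul, mul_add, mul_sub, smul_mul_assoc, mul_smul_comm]
      module
    · simp only [key]
      rw [h₁.hermitian, h₂.hermitian, h₃.hermitian]
      simp [star_smul]

/-- The property that determines `χ_E`: `E(φ) = -(-1)^{∂φ} ∑ φₖ χ(cₖ)`. -/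
def IsChi (E : H →ₗ[ℂ] H) (χ : A →ₗ[ℂ] H) : Prop :=
  ∀ n, ∀ φ ∈ P.deg n, E φ = -(-1 : ℂ) ^ n • P.contract χ φ

/-- The property that determines `ϱ_D`: `D²(φ) = -∑ φₖ ϱ(cₖ)`. -/
def IsRho (D : H →ₗ[ℂ] H) (ρ : A →ₗ[ℂ] H) : Prop := ∀ φ, D (D φ) = -P.contract ρ φ

open Classical in
/-- The unique linear map `χ_E : A → H` with `IsChi`. -/
def chi (E : H →ₗ[ℂ] H) : A →ₗ[ℂ] H := if h : ∃ χ, P.IsChi E χ then h.choose else 0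

open Classical in
/-- The unique linear map `ϱ_D : A → H` with `IsRho` (the curvature of `D`). -/
def rho (D : H →ₗ[ℂ] H) : A →ₗ[ℂ] H := if h : ∃ ρ, P.IsRho D ρ then h.choose else 0

lemma chi_mul_eq_zero {E : H →ₗ[ℂ] H} (hE : P.IsVariation E) {r : A}
    (hr : Coalgebra.counit (R := ℂ) r = 0) (h : P.chi E r = 0) (a : A) :
    P.chi E (r * a) = 0 := by
  by_cases hex : ∃ χ, P.IsChi E χ
  · have e : P.chi E = hex.choose := dif_pos hex
    rw [e] at h ⊢
    refine P.contract_mul_mem E _ (fun b hb => ?_) (fun b hb c _ => ?_) hr h a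
    · have := hex.choose_spec 0 b hb
      simpa using this
    · have := hE.leibniz 0 b hb c
      simpa using this
  · have e : P.chi E = 0 := dif_neg hex
    rw [e]; rfl

lemma rho_mul_eq_zero {D : H →ₗ[ℂ] H} (hD : P.IsPreconnection D) {r : A}
    (hr : Coalgebra.counit (R := ℂ) r = 0) (h : P.rho D r = 0) (a : A) :
    P.rho D (r * a) = 0 := by
  by_cases hex : ∃ ρ, P.IsRho D ρ
  · have e : P.rho D = hex.choose := dif_pos hex
    rw [e] at h ⊢
    refine P.contract_mul_mem (D ∘ₗ D) _ (fun b _ => hex.choose_spec b) (fun b hb c _ => ?_) hr h a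
    simp only [LinearMap.comp_apply]
    rw [hD.leibniz 0 b hb c, map_add, map_smul, hD.leibniz 1 _ (hD.deg 0 b hb),
      hD.leibniz 0 b hb]
    simp
  · have e : P.rho D = 0 := dif_neg hex
    rw [e]; rfl

/-- The elements of `ker ε` annihilated by all `χ_E` and all `ϱ_D`. This right ideal defines the
first-order calculus `Ψ` on the structure quantum group. -/
def ideal : CalcIdeal A where
  carrier :=
    { carrier := {a | Coalgebra.counit (R := ℂ) a = 0 ∧
        (∀ E, P.IsVariation E → P.chi E a = 0) ∧ ∀ D, P.IsPreconnection D → P.rho D a = 0}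
      zero_mem' := ⟨map_zero _, fun _ _ => map_zero _, fun _ _ => map_zero _⟩
      add_mem' := fun {a b} ha hb =>
        ⟨by rw [map_add, ha.1, hb.1, add_zero],
          fun E hE => by rw [map_add, ha.2.1 E hE, hb.2.1 E hE, add_zero],
          fun D hD => by rw [map_add, ha.2.2 D hD, hb.2.2 D hD, add_zero]⟩
      smul_mem' := fun c a ha =>
        ⟨by rw [map_smul, ha.1, smul_zero],
          fun E hE => by rw [map_smul, ha.2.1 E hE, smul_zero],
          fun D hD => by rw [map_smul, ha.2.2 D hD, smul_zero]⟩ }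
  counit_eq_zero _ hr := hr.1
  mul_mem r hr a :=
    ⟨by rw [Bialgebra.counit_mul, hr.1, zero_mul],
      fun E hE => P.chi_mul_eq_zero hE hr.1 (hr.2.1 E hE) a,
      fun D hD => P.rho_mul_eq_zero hD hr.1 (hr.2.2 D hD) a⟩

/-- Left-invariant one-forms of the calculus `Ψ`. -/
abbrev Inv : Type _ := P.ideal.Inv
/-- Left-invariant part of the universal envelope of `Ψ`. -/
abbrev Env : Type _ := P.ideal.Env
/-- The algebra of vertically-horizontally decomposed forms, `H ⊗ Env`. -/
abbrev VH : Type _ := Smash P.comodule P.ideal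
/-- The universal envelope `Ψ^∧` of `Ψ`: all forms on the structure quantum group. -/
abbrev GForms : Type _ := Smash (ComoduleAlgebra.self A) P.ideal

end QuantumPrincipalBundle

namespace CalcIdeal

variable {A : Type*} [Ring A] [HopfAlgebra ℂ A] (R : CalcIdeal A)

/-- Elements of degree `n`: the span of products of `n` left-invariant one-forms. -/
def envDeg (n : ℕ) : Submodule ℂ R.Env := LinearMap.range R.incl ^ n

/-- The `*`-structure on left-invariant forms: conjugate-linear, graded-antimultiplicative, and
`π(a)* = -π(κ(a)* )`. -/
structure IsEnvStar [StarRing A] (s : R.Env →ₛₗ[starRingEnd ℂ] R.Env) : Prop where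
  one : s 1 = 1
  incl : ∀ a : A, s (R.incl (R.proj a)) =
    -R.incl (R.proj (star (HopfAlgebra.antipode ℂ a)))
  mul : ∀ m n, ∀ x ∈ R.envDeg m, ∀ y ∈ R.envDeg n,
    s (x * y) = (-1 : ℂ) ^ (m * n) • (s y * s x)

open Classical in
/-- The unique map with `IsEnvStar`. -/
def envStar [StarRing A] : R.Env →ₛₗ[starRingEnd ℂ] R.Env :=
  if h : ∃ s, R.IsEnvStar s then h.choose else 0

/-- The adjoint action `ad(a) = ∑ a₂ ⊗ κ(a₁) a₃`. -/
def ad (A : Type*) [Ring A] [HopfAlgebra ℂ A] : A →ₗ[ℂ] A ⊗[ℂ] A :=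
  (LinearMap.mul' ℂ A ∘ₗ (HopfAlgebra.antipode ℂ).rTensor A).lTensor A ∘ₗ
    (TensorProduct.leftComm ℂ A A A).toLinearMap ∘ₗ
    (Coalgebra.comul (R := ℂ)).lTensor A ∘ₗ Coalgebra.comul

/-- The universal differential envelope of the calculus, in its left-invariant decomposition
`A ⊗ Env`, with the product `(b ⊗ η)(a ⊗ ϑ) = ∑ b a₁ ⊗ (η ∘ a₂) ϑ`. -/
abbrev Full : Type _ := Smash (ComoduleAlgebra.self A) R

/-- The inclusion of `A` into the envelope. -/
def ofA : A →ₗ[ℂ] R.Full := (Smash.ofTensor _ R).toLinearMap ∘ₗ (TensorProduct.mk ℂ A R.Env).flip 1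

/-- The parity operator of the envelope (elements of `A` are even). -/
def fullParity : R.Full →ₗ[ℂ] R.Full :=
  (Smash.ofTensor _ R).toLinearMap ∘ₗ R.envParity.toLinearMap.lTensor A ∘ₗ
    (Smash.ofTensor _ R).symm.toLinearMap

/-- The product of the graded tensor product:
`(w ⊗ α)(u ⊗ β) = (-1)^{∂α ∂u} wu ⊗ αβ`. -/
def gradedMul (x y : R.Env ⊗[ℂ] R.Full) : R.Env ⊗[ℂ] R.Full :=
  LinearMap.mul' ℂ (R.Env ⊗[ℂ] R.Full)
    (koszul (R.fullParity.lTensor R.Env) (R.envParity.toLinearMap.rTensor R.Full) (x ⊗ₜ y))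

/-- The extension of the adjoint coaction `ϖ(π(a)) = ∑ π(a₂) ⊗ κ(a₁) a₃` of left-invariant one-forms
to a homomorphism from left-invariant forms to the graded tensor product with all forms:
it sends a left-invariant one-form `ϑ` to `ϖ(ϑ) + 1 ⊗ ϑ`. -/
structure IsAdHat (w : R.Env →ₗ[ℂ] R.Env ⊗[ℂ] R.Full) : Prop where
  one : w 1 = 1
  incl : ∀ a : A, w (R.incl (R.proj a)) =
    TensorProduct.map (R.incl ∘ₗ R.proj) R.ofA (ad A a) +
      1 ⊗ₜ Smash.tmul _ R 1 (R.incl (R.proj a))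
  mul : ∀ x y, w (x * y) = R.gradedMul (w x) (w y)

open Classical in
/-- The unique map with `IsAdHat`. -/
def adHat : R.Env →ₗ[ℂ] R.Env ⊗[ℂ] R.Full :=
  if h : ∃ w, R.IsAdHat w then h.choose else 0

end CalcIdeal

section Affine

variable {M N M' N' : Type*} [AddCommGroup M] [Module ℂ M] [AddCommGroup N] [Module ℂ N]
  [AddCommGroup M'] [Module ℂ M'] [AddCommGroup N'] [Module ℂ N']

lemma map_affine (L : M →ₗ[ℂ] N) (c : ℂ) (x y z : M) :
    L (c • (x - y) + z) = c • (L x - L y) + L z := by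
  rw [map_add, map_smul, map_sub]

lemma map_affine_left (c : ℂ) (f₁ f₂ f₃ : M →ₗ[ℂ] M') (g : N →ₗ[ℂ] N') (t : M ⊗[ℂ] N) :
    TensorProduct.map (c • (f₁ - f₂) + f₃) g t =
      c • (TensorProduct.map f₁ g t - TensorProduct.map f₂ g t) + TensorProduct.map f₃ g t := by
  induction t with
  | zero => simp
  | add x y hx hy => simp only [map_add, hx, hy]; module
  | tmul x y => simp [TensorProduct.add_tmul, TensorProduct.sub_tmul, ← TensorProduct.smul_tmul']

lemma map_affine_right (c : ℂ) (f : M →ₗ[ℂ] M') (g₁ g₂ g₃ : N →ₗ[ℂ] N') (t : M ⊗[ℂ] N) :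
    TensorProduct.map f (c • (g₁ - g₂) + g₃) t =
      c • (TensorProduct.map f g₁ t - TensorProduct.map f g₂ t) + TensorProduct.map f g₃ t := by
  induction t with
  | zero => simp
  | add x y hx hy => simp only [map_add, hx, hy]; module
  | tmul x y => simp [TensorProduct.tmul_add, TensorProduct.tmul_sub]

lemma affine_shift (c : ℂ) (x y z k : M) :
    c • (x + k - (y + k)) + (z + k) = c • (x - y) + z + k := by
  rw [add_sub_add_right_eq_sub, add_assoc]

end Affine

namespace QuantumPrincipalBundle

variable {A H : Type*} [Ring A] [HopfAlgebra ℂ A] [StarRing A] [StarModule ℂ A]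
    [Ring H] [Algebra ℂ H] [StarAddMonoid H] [StarModule ℂ H] (P : QuantumPrincipalBundle A H)

/-- The identification of `H ⊗ Env` with the algebra `P.VH`. -/
def vhMk : H ⊗[ℂ] P.Env ≃ₗ[ℂ] P.VH := Smash.ofTensor P.comodule P.ideal

/-- `φ ↦ φ ⊗ 1`. -/
def horVH : H →ₗ[ℂ] P.VH := P.vhMk.toLinearMap ∘ₗ (TensorProduct.mk ℂ H P.Env).flip 1

/-- `ϑ ↦ 1 ⊗ ϑ`. -/
def verVH : P.Env →ₗ[ℂ] P.VH := P.vhMk.toLinearMap ∘ₗ TensorProduct.mk ℂ H P.Env 1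

/-- Elements of total degree `n`. -/
def vhDeg (n : ℕ) : Submodule ℂ P.VH :=
  (⨆ p ∈ Finset.HasAntidiagonal.antidiagonal n,
    Submodule.map₂ (TensorProduct.mk ℂ H P.Env) (P.deg p.1) (P.ideal.envDeg p.2)).map
      P.vhMk.toLinearMap

/-- The `*`-structure `(φ ⊗ ϑ)* = ∑ φₖ* ⊗ (ϑ* ∘ cₖ* )`. -/
def vhStar : P.VH →ₛₗ[starRingEnd ℂ] P.VH :=
  P.vhMk.toLinearMap.comp <|
    ((TensorProduct.lift P.ideal.circEnv.flip).lTensor H).comp <|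
    (TensorProduct.map (starLinearEquiv ℂ (A := H)).toLinearMap
      (TensorProduct.map (starLinearEquiv ℂ (A := A)).toLinearMap P.ideal.envStar)).comp <|
    ((TensorProduct.assoc ℂ H A P.Env).toLinearMap ∘ₗ
      P.coact.toLinearMap.rTensor P.Env ∘ₗ P.vhMk.symm.toLinearMap)

/-- The properties that determine the differential `∂_D` on decomposed forms:
`∂_D(φ) = D(φ) + (-1)^{∂φ} ∑ φₖ π(cₖ)` on horizontal forms,
`∂_D(ϑ) = ϱ_D(ϑ) + d(ϑ)` on left-invariant one-forms, where `dπ(a) = -∑ π(a₁) π(a₂)`, and the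
graded Leibniz rule. -/
structure IsTotalDifferential (D : H →ₗ[ℂ] H) (δ : P.VH →ₗ[ℂ] P.VH) : Prop where
  hor : ∀ n, ∀ φ ∈ P.deg n, δ (P.horVH φ) = P.horVH (D φ) +
    (-1 : ℂ) ^ n • P.vhMk ((P.ideal.incl ∘ₗ P.ideal.proj).lTensor H (P.coact φ))
  ver : ∀ a : A, δ (P.verVH (P.ideal.incl (P.ideal.proj a))) =
    P.horVH (P.rho D a) - P.verVH (P.ideal.quad P.ideal.incl a)
  leibniz : ∀ n, ∀ x ∈ P.vhDeg n, ∀ y, δ (x * y) = δ x * y + (-1 : ℂ) ^ n • (x * δ y)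

open Classical in
/-- The differential `∂_D`: the unique linear map with `IsTotalDifferential`. -/
def partialD (D : H →ₗ[ℂ] H) : P.VH →ₗ[ℂ] P.VH :=
  if h : ∃ δ, P.IsTotalDifferential D δ then h.choose else 0

/-- The properties that determine the homomorphism `h_E`: `h_E(φ) = φ` on horizontal forms and
`h_E(ϑ) = ϑ - χ_E(ϑ)` on left-invariant one-forms. -/
structure IsGauge (E : H →ₗ[ℂ] H) (h : P.VH →ₐ[ℂ] P.VH) : Prop where
  hor : ∀ φ, h (P.horVH φ) = P.horVH φ
  ver : ∀ a : A, h (P.verVH (P.ideal.incl (P.ideal.proj a))) =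
    P.verVH (P.ideal.incl (P.ideal.proj a)) - P.horVH (P.chi E a)

open Classical in
/-- The unique algebra homomorphism `h_E` with `IsGauge`. -/
def gauge (E : H →ₗ[ℂ] H) : P.VH →ₐ[ℂ] P.VH :=
  if h : ∃ g, P.IsGauge E g then h.choose else AlgHom.id ℂ _

lemma gauge_hor (E : H →ₗ[ℂ] H) (φ : H) : P.gauge E (P.horVH φ) = P.horVH φ := by
  by_cases hex : ∃ g, P.IsGauge E g
  · have e : P.gauge E = hex.choose := dif_pos hex
    rw [e]; exact hex.choose_spec.hor φ
  · have e : P.gauge E = AlgHom.id ℂ _ := dif_neg hex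
    rw [e]; rfl

/-- The gluing of the copies of `P.VH` indexed by preconnections along the isomorphisms `h_E`:
families `x` with `x_{D + E} = h_E(x_D)`. -/
def glued : Subalgebra ℂ (P.preconnections → P.VH) where
  carrier := {x | ∀ D D' : P.preconnections, x D' = P.gauge ((D' : H →ₗ[ℂ] H) - D) (x D)}
  mul_mem' hx hy D D' := by rw [Pi.mul_apply, Pi.mul_apply, map_mul, ← hx D D', ← hy D D']
  add_mem' hx hy D D' := by rw [Pi.add_apply, Pi.add_apply, map_add, ← hx D D', ← hy D D']
  algebraMap_mem' c D D' := by
    rw [Pi.algebraMap_apply, Pi.algebraMap_apply, AlgHom.commutes]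

/-- The algebra `Ω_P` of differential forms on the bundle. An element is a compatible family of
decomposed forms, one in each trivialization `D`; the product, the `*`-structure, the differential
and the pull-back by the right action are computed in the trivializations. -/
def Omega : Type _ := P.glued

instance : Ring P.Omega := inferInstanceAs (Ring P.glued)
instance : Algebra ℂ P.Omega := inferInstanceAs (Algebra ℂ P.glued)

/-- The family of decomposed forms that represents an element of `Ω_P`. -/
def family : P.Omega →ₐ[ℂ] (P.preconnections → P.VH) := P.glued.val

/-- The homomorphism `π_D : Ω_P → P.VH`. -/
def triv (D : P.preconnections) : P.Omega →ₐ[ℂ] P.VH :=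
  (Pi.evalAlgHom ℂ (fun _ : P.preconnections => P.VH) D).comp P.family

/-- The inclusion of horizontal forms into `Ω_P`. -/
def hor : H →ₗ[ℂ] P.Omega where
  toFun φ := (⟨fun _ => P.horVH φ, fun _ _ => (P.gauge_hor _ φ).symm⟩ : P.glued)
  map_add' _ _ := Subtype.ext (funext fun _ => map_add _ _ _)
  map_smul' _ _ := Subtype.ext (funext fun _ => map_smul _ _ _)

/-- The pull-back `F̂ : Ω_P → Ω_P ⊗ Ψ^∧` in a trivialization: `φ ⊗ ϑ ↦ F(φ) ϖ̂(ϑ)`. -/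
def pullbackVH : P.VH →ₗ[ℂ] P.VH ⊗[ℂ] P.GForms :=
  TensorProduct.map P.vhMk.toLinearMap
      (LinearMap.mul' ℂ P.GForms ∘ₗ P.ideal.ofA.rTensor P.GForms) ∘ₗ
    (TensorProduct.tensorTensorTensorComm ℂ H A P.Env P.GForms).toLinearMap ∘ₗ
    TensorProduct.map P.coact.toLinearMap P.ideal.adHat ∘ₗ P.vhMk.symm.toLinearMap

/-- Connections relative to `(Ω_P, Ψ^∧)`: linear maps `ω` from left-invariant one-forms to one-forms on
the bundle with `ω(ϑ* ) = ω(ϑ)*` and `F̂ω(ϑ) = (ω ⊗ id)ϖ(ϑ) + 1 ⊗ ϑ`. The last two conditions are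
stated for `ϑ = π(a)`, for which `ϑ* = -π(κ(a)* )` and `ϖ(ϑ) = (π ⊗ id)ad(a)`. -/
structure IsConnection (ω : P.Inv →ₗ[ℂ] P.Omega) : Prop where
  deg : ∀ D ϑ, P.triv D (ω ϑ) ∈ P.vhDeg 1
  hermitian : ∀ D a, P.triv D (ω (-P.ideal.proj (star (HopfAlgebra.antipode ℂ a)))) =
    P.vhStar (P.triv D (ω (P.ideal.proj a)))
  covariant : ∀ D a, P.pullbackVH (P.triv D (ω (P.ideal.proj a))) =
    TensorProduct.map ((P.triv D).toLinearMap ∘ₗ ω ∘ₗ P.ideal.proj) P.ideal.ofA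
        (CalcIdeal.ad A a) +
      1 ⊗ₜ Smash.tmul _ P.ideal 1 (P.ideal.incl (P.ideal.proj a))

/-- Regular connections: `ω(ϑ)φ = (-1)^{∂φ} ∑ φₖ ω(ϑ ∘ cₖ)` for every horizontal form `φ`. -/
structure IsRegularConnection (ω : P.Inv →ₗ[ℂ] P.Omega) : Prop extends P.IsConnection ω where
  regular : ∀ n, ∀ φ ∈ P.deg n, ∀ ϑ, ω ϑ * P.hor φ =
    (-1 : ℂ) ^ n • LinearMap.mul' ℂ P.Omega
      (TensorProduct.map P.hor (ω ∘ₗ P.ideal.circ ϑ) (P.coact φ))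

/-- The real affine space of regular connections. -/
def regularConnections : AffineSubspace ℝ (P.Inv →ₗ[ℂ] P.Omega) where
  carrier := {ω | P.IsRegularConnection ω}
  smul_vsub_vadd_mem' := by
    intro c ω₁ ω₂ ω₃ h₁ h₂ h₃
    have e : (c • (ω₁ -ᵥ ω₂) +ᵥ ω₃) = (c : ℂ) • (ω₁ - ω₂) + ω₃ := rfl
    have key : ∀ φ, ((c : ℂ) • (ω₁ - ω₂) + ω₃) φ = (c : ℂ) • (ω₁ φ - ω₂ φ) + ω₃ φ := fun _ => rfl
    rw [e]
    refine ⟨⟨fun D ϑ => ?_, fun D a => ?_, fun D a => ?_⟩, fun n φ hφ ϑ => ?_⟩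
    · rw [key, map_add, map_smul, map_sub]
      exact add_mem (Submodule.smul_mem _ _ (sub_mem (h₁.deg D ϑ) (h₂.deg D ϑ))) (h₃.deg D ϑ)
    · rw [key, key, map_add, map_smul, map_sub, h₁.hermitian, h₂.hermitian, h₃.hermitian,
        map_add, map_smul, map_sub, map_add, map_smulₛₗ, map_sub, Complex.conj_ofReal]
    · have hl : (P.triv D).toLinearMap ∘ₗ ((c : ℂ) • (ω₁ - ω₂) + ω₃) ∘ₗ P.ideal.proj =
          (c : ℂ) • ((P.triv D).toLinearMap ∘ₗ ω₁ ∘ₗ P.ideal.proj -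
            (P.triv D).toLinearMap ∘ₗ ω₂ ∘ₗ P.ideal.proj) +
          (P.triv D).toLinearMap ∘ₗ ω₃ ∘ₗ P.ideal.proj := by
        refine LinearMap.ext fun a => ?_
        exact map_affine (P.triv D).toLinearMap c (ω₁ (P.ideal.proj a)) (ω₂ (P.ideal.proj a))
          (ω₃ (P.ideal.proj a))
      rw [hl, map_affine_left, key, map_add, map_smul, map_sub, map_add, map_smul, map_sub,
        h₁.covariant, h₂.covariant, h₃.covariant]
      exact affine_shift _ _ _ _ _
    · have hl : ((c : ℂ) • (ω₁ - ω₂) + ω₃) ∘ₗ P.ideal.circ ϑ =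
          (c : ℂ) • (ω₁ ∘ₗ P.ideal.circ ϑ - ω₂ ∘ₗ P.ideal.circ ϑ) + ω₃ ∘ₗ P.ideal.circ ϑ := rfl
      rw [hl, map_affine_right, key, add_mul, smul_mul_assoc, sub_mul, h₁.regular n φ hφ,
        h₂.regular n φ hφ, h₃.regular n φ hφ, map_add, map_smul, map_sub, smul_add, smul_comm]
      simp only [smul_sub]

/-- Multiplicative connections: those that extend to a homomorphism on the left-invariant part of the
envelope, that is, `∑ ω(π(r₁)) ω(π(r₂)) = 0` for all `r` in the ideal. -/
def IsMultiplicative (ω : P.Inv →ₗ[ℂ] P.Omega) : Prop :=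
  ∀ r ∈ P.ideal.carrier, P.ideal.quad ω r = 0

/-- The canonical decomposition map `m_ω : H ⊗ Env → Ω_P`, `m_ω(φ ⊗ ϑ) = φ ω^∧(ϑ)`, where `ω^∧` is
the multiplicative extension of `ω`. -/
def decomposition (ω : P.Inv →ₗ[ℂ] P.Omega) (hω : P.IsMultiplicative ω) :
    H ⊗[ℂ] P.Env →ₗ[ℂ] P.Omega :=
  LinearMap.mul' ℂ P.Omega ∘ₗ TensorProduct.map P.hor (P.ideal.lift ω hω).toLinearMap

/-- The differential of `Ω_P`, computed in the trivializations: `π_D d_P = ∂_D π_D`. -/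
def dP : P.Omega →ₗ[ℂ] (P.preconnections → P.VH) :=
  LinearMap.pi fun D => P.partialD D ∘ₗ (P.triv D).toLinearMap

/-- `T` is the covariant derivative of `ω`: on horizontal forms,
`T(φ) = d_P(φ) - (-1)^{∂φ} ∑ φₖ ω(π(cₖ))`. -/
def IsCovariantDerivative (ω : P.Inv →ₗ[ℂ] P.Omega) (T : H →ₗ[ℂ] H) : Prop :=
  ∀ n, ∀ φ ∈ P.deg n, P.family (P.hor (T φ)) = P.dP (P.hor φ) -
    (-1 : ℂ) ^ n • P.family (LinearMap.mul' ℂ P.Omega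
      (TensorProduct.map P.hor (ω ∘ₗ P.ideal.proj) (P.coact φ)))

/-- The map `ϑ ↦ τ⁻¹(1 ⊗ ϑ)`; for `τ = π_D` this is `ω_D`. -/
def connectionOf (τ : P.Omega ≃ₐ[ℂ] P.VH) : P.Inv →ₗ[ℂ] P.Omega :=
  τ.symm.toLinearMap ∘ₗ P.verVH ∘ₗ P.ideal.incl

/-- The maps that enter the construction of `Ω_P` exist and are unique. -/
structure IsWellPosed : Prop where
  chi : ∀ E, P.IsVariation E → ∃! χ, P.IsChi E χ
  rho : ∀ D, P.IsPreconnection D → ∃! ρ, P.IsRho D ρ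
  envStar : ∃! s, P.ideal.IsEnvStar s
  adHat : ∃! w, P.ideal.IsAdHat w
  gauge : ∀ E, P.IsVariation E → ∃! h, P.IsGauge E h
  differential : ∀ D, P.IsPreconnection D → ∃! δ, P.IsTotalDifferential D δ

end QuantumPrincipalBundle

end QPB

end

/-! Passing from the trivialization D to D + E replaces π(a) by π(a) − χ_E(a). Hence ω_D, which is
the tautological map ϑ ↦ 1 ⊗ ϑ in the trivialization D, reads ϑ − χ_{D'−D}(ϑ) in the trivialization
D'. Conversely, the covariance condition forces every connection to have the form ϑ + λ(ϑ) in the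
trivialization D, with λ horizontal of degree one. If the connection is regular, λ satisfies the
commutation, covariance and hermiticity rules of the maps χ_E, and these rules make E(φ) =
−(−1)^{∂φ} ∑ φₖ λ(cₖ) an element of the vector space of preconnections with χ_E = λ. So the
connection is ω_{D+E}. Since E depends linearly on λ, the correspondence is affine.

The main work is the existence of the maps in the construction. By `exists_contract`, an operator T
that is left linear over the base is of the form φ ↦ ∑ φₖ χ(cₖ): freeness writes 1 ⊗ a as ∑ qᵢ
F(bᵢ), the Haar functional averages the left factors into the base, and T moves past them. The Haar
functional itself comes from linear algebra on finite-dimensional unitary corepresentations. Applied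
to E composed with the parity and to D², this gives χ_E and ϱ_D. Freeness also turns the Leibniz
rule, covariance and hermiticity of E and D² into identities for χ_E and ϱ_D
(`IsContraction.mul_eq`, `IsContraction.coact_apply`, `IsContraction.star_apply`).

These identities make the ideal stable under r ↦ κ(r)* and under ad, which yields the star and ϖ̂.
The polarization (D+E)² + (D−E)² − 2D² = 2E² shows that ∑ χ_E(r₁)χ_E(r₂) = 0 on the ideal
(`chi_conv_eq_zero`); this is where the presence of the curvatures in its definition is used, and it
lets h_E respect the quadratic relations. The differential ∂_D is the corner of a homomorphism into
upper triangular matrices, obtained from the universal property `Smash.liftHom`. Finally χ is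
additive in E, so the maps h_E compose additively and every π_D is bijective. -/

noncomputable section

set_option linter.unusedSectionVars false

namespace QPB

/-! ### Matrices of corepresentations and the antipode. -/

section Corep

variable {A : Type*} [Ring A] [HopfAlgebra ℂ A]

/-- The matrix of a finite-dimensional corepresentation. -/
structure IsCorep {ι : Type*} [Fintype ι] [DecidableEq ι] (w : Matrix ι ι A) : Prop where
  comul : ∀ i j, Coalgebra.comul (R := ℂ) (w i j) = ∑ k, w i k ⊗ₜ[ℂ] w k j
  counit : ∀ i j, Coalgebra.counit (R := ℂ) (w i j) = if i = j then 1 else 0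

namespace IsCorep

variable {ι : Type*} [Fintype ι] [DecidableEq ι] {w : Matrix ι ι A}

lemma antipode_mul (h : IsCorep w) (i j : ι) :
    ∑ k, HopfAlgebra.antipode ℂ (w i k) * w k j = if i = j then 1 else 0 := by
  have := HopfAlgebra.mul_antipode_rTensor_comul_apply (R := ℂ) (w i j)
  rw [h.comul, h.counit] at this
  simpa [apply_ite] using this

lemma mul_antipode (h : IsCorep w) (i j : ι) :
    ∑ k, w i k * HopfAlgebra.antipode ℂ (w k j) = if i = j then 1 else 0 := by
  have := HopfAlgebra.mul_antipode_lTensor_comul_apply (R := ℂ) (w i j)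
  rw [h.comul, h.counit] at this
  simpa [apply_ite] using this

/-- Both sides invert the matrix of coproducts of the entries of `w`: the left side is a left
inverse because the coproduct is multiplicative, the right side is a right inverse by the antipode
axiom used in each tensor leg. Left and right inverses coincide. -/
lemma comul_antipode (h : IsCorep w) (i j : ι) :
    Coalgebra.comul (R := ℂ) (HopfAlgebra.antipode ℂ (w i j)) =
      ∑ k, HopfAlgebra.antipode ℂ (w k j) ⊗ₜ[ℂ] HopfAlgebra.antipode ℂ (w i k) := by
  let M : Matrix ι ι (A ⊗[ℂ] A) := Matrix.of fun i j => Coalgebra.comul (R := ℂ) (w i j)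
  let N : Matrix ι ι (A ⊗[ℂ] A) :=
    Matrix.of fun i j => Coalgebra.comul (R := ℂ) (HopfAlgebra.antipode ℂ (w i j))
  let N' : Matrix ι ι (A ⊗[ℂ] A) := Matrix.of fun i j =>
    ∑ k, HopfAlgebra.antipode ℂ (w k j) ⊗ₜ[ℂ] HopfAlgebra.antipode ℂ (w i k)
  have h1 : N * M = 1 := by
    ext i j
    simp only [M, N, Matrix.mul_apply, Matrix.of_apply, ← Bialgebra.comul_mul, ← map_sum,
      h.antipode_mul, Matrix.one_apply]
    split_ifs <;> simp
  have h2 : M * N' = 1 := by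
    ext i j
    simp only [M, N', Matrix.mul_apply, Matrix.of_apply, h.comul, Finset.sum_mul_sum,
      Algebra.TensorProduct.tmul_mul_tmul]
    calc ∑ x, ∑ a, ∑ b, (w i a * HopfAlgebra.antipode ℂ (w b j)) ⊗ₜ[ℂ]
          (w a x * HopfAlgebra.antipode ℂ (w x b))
        = ∑ a, ∑ b, (w i a * HopfAlgebra.antipode ℂ (w b j)) ⊗ₜ[ℂ]
          ∑ x, (w a x * HopfAlgebra.antipode ℂ (w x b)) := by
          rw [Finset.sum_comm]
          refine Finset.sum_congr rfl fun a _ => ?_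
          rw [Finset.sum_comm]
          exact Finset.sum_congr rfl fun b _ => (TensorProduct.tmul_sum _ _ _).symm
      _ = (∑ a, w i a * HopfAlgebra.antipode ℂ (w a j)) ⊗ₜ[ℂ] 1 := by
          rw [TensorProduct.sum_tmul]
          simp [h.mul_antipode, TensorProduct.tmul_ite]
      _ = _ := by
          rw [h.mul_antipode, Matrix.one_apply]
          split_ifs <;> simp [Algebra.TensorProduct.one_def]
  have h3 : N = N' := left_inv_eq_right_inv h1 h2
  exact congrFun (congrFun h3 i) j

lemma ad_apply (h : IsCorep w) (i j : ι) : CalcIdeal.ad A (w i j) =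
    ∑ k, ∑ l, w k l ⊗ₜ[ℂ] (HopfAlgebra.antipode ℂ (w i k) * w l j) := by
  simp [CalcIdeal.ad, h.comul, TensorProduct.tmul_sum]

end IsCorep

end Corep

/-! ### Unitary corepresentations and their matrix elements. -/

section Unitary

variable {A : Type*} [Ring A] [HopfAlgebra ℂ A] [StarRing A] [StarModule ℂ A]

/-- The matrix of a finite-dimensional unitary corepresentation. -/
structure IsUnitaryCorep {ι : Type*} [Fintype ι] [DecidableEq ι] (w : Matrix ι ι A) : Prop where
  comul : ∀ i j, Coalgebra.comul (R := ℂ) (w i j) = ∑ k, w i k ⊗ₜ[ℂ] w k j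
  mul_star : ∀ i j, ∑ k, w i k * star (w j k) = if i = j then 1 else 0
  star_mul : ∀ i j, ∑ k, star (w k i) * w k j = if i = j then 1 else 0

namespace IsUnitaryCorep

variable {ι κ : Type*} [Fintype ι] [DecidableEq ι] [Fintype κ] [DecidableEq κ]
  {w : Matrix ι ι A} {v : Matrix κ κ A}

/-- The counit axiom reads w = ε(w)w; multiplication by w* on the right leaves ε(w) = 1. This is an
identity between multiples of `1` in `A`, and one more application of ε turns it into an identity of
numbers. -/
lemma isCorep (h : IsUnitaryCorep w) : IsCorep w where
  comul := h.comul
  counit i l := by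
    have h1 : ∀ j, w i j = ∑ k, Coalgebra.counit (R := ℂ) (w i k) • w k j := by
      intro j
      have := Coalgebra.rTensor_counit_comul (R := ℂ) (w i j)
      rw [h.comul] at this
      have h2 := congrArg (TensorProduct.lid ℂ A) this
      simpa using h2.symm
    have h2 : ∑ j, w i j * star (w l j) = Coalgebra.counit (R := ℂ) (w i l) • (1 : A) := by
      calc ∑ j, w i j * star (w l j)
          = ∑ j, ∑ k, Coalgebra.counit (R := ℂ) (w i k) • (w k j * star (w l j)) := by
            refine Finset.sum_congr rfl fun j _ => ?_
            nth_rewrite 1 [h1 j]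
            simp [Finset.sum_mul]
        _ = _ := by
            rw [Finset.sum_comm]
            simp [← Finset.smul_sum, h.mul_star]
    rw [h.mul_star] at h2
    have h3 := congrArg (Coalgebra.counit (R := ℂ)) h2
    rw [map_smul, Bialgebra.counit_one, smul_eq_mul, mul_one] at h3
    rw [← h3]
    split_ifs <;> simp

/-- The matrices κ(w) and w* both invert w. -/
lemma antipode (h : IsUnitaryCorep w) (i l : ι) :
    HopfAlgebra.antipode ℂ (w i l) = star (w l i) := by
  calc HopfAlgebra.antipode ℂ (w i l)
      = ∑ k, HopfAlgebra.antipode ℂ (w i k) * ∑ j, w k j * star (w l j) := by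
        simp [h.mul_star]
    _ = ∑ j, (∑ k, HopfAlgebra.antipode ℂ (w i k) * w k j) * star (w l j) := by
        simp only [Finset.mul_sum, Finset.sum_mul, mul_assoc]
        rw [Finset.sum_comm]
    _ = star (w l i) := by simp [h.isCorep.antipode_mul]

lemma reindex (h : IsUnitaryCorep w) (e : κ ≃ ι) :
    IsUnitaryCorep (fun i j => w (e i) (e j) : Matrix κ κ A) where
  comul i j := by
    rw [h.comul]; exact (e.sum_comp fun k => w (e i) k ⊗ₜ[ℂ] w k (e j)).symm
  mul_star i j := by
    rw [e.sum_comp fun k => w (e i) k * star (w (e j) k), h.mul_star]; simp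
  star_mul i j := by
    rw [e.sum_comp fun k => star (w k (e i)) * w k (e j), h.star_mul]; simp

lemma directSum (h : IsUnitaryCorep w) (h' : IsUnitaryCorep v) :
    IsUnitaryCorep (Matrix.fromBlocks w 0 0 v) where
  comul i j := by
    rcases i with i | i <;> rcases j with j | j <;> simp [h.comul, h'.comul]
  mul_star i j := by
    rcases i with i | i <;> rcases j with j | j <;> simp [h.mul_star, h'.mul_star]
  star_mul i j := by
    rcases i with i | i <;> rcases j with j | j <;> simp [h.star_mul, h'.star_mul]

lemma tensor (h : IsUnitaryCorep w) (h' : IsUnitaryCorep v) :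
    IsUnitaryCorep (fun p q => w p.1 q.1 * v p.2 q.2 : Matrix (ι × κ) (ι × κ) A) where
  comul i j := by
    simp [Bialgebra.comul_mul, h.comul, h'.comul, Finset.sum_mul_sum, Fintype.sum_prod_type]
  mul_star i j := by
    simp only [Fintype.sum_prod_type, StarMul.star_mul]
    have : ∀ x y, w i.1 x * v i.2 y * (star (v j.2 y) * star (w j.1 x)) =
      w i.1 x * (v i.2 y * star (v j.2 y)) * star (w j.1 x) := fun x y => by
        simp only [mul_assoc]
    simp only [this, ← Finset.mul_sum, ← Finset.sum_mul, h'.mul_star]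
    by_cases h2 : i.2 = j.2 <;> simp [h2, h.mul_star, Prod.ext_iff]
  star_mul i j := by
    simp only [Fintype.sum_prod_type, StarMul.star_mul]
    rw [Finset.sum_comm]
    have : ∀ x y, star (v y i.2) * star (w x i.1) * (w x j.1 * v y j.2) =
      star (v y i.2) * (star (w x i.1) * w x j.1) * v y j.2 := fun x y => by
        simp only [mul_assoc]
    simp only [this, ← Finset.mul_sum, ← Finset.sum_mul, h.star_mul]
    by_cases h2 : i.1 = j.1 <;> simp [h2, h'.star_mul, Prod.ext_iff]

lemma trivial : IsUnitaryCorep (fun _ _ => 1 : Matrix (Fin 1) (Fin 1) A) where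
  comul i j := by simp [Bialgebra.comul_one, Algebra.TensorProduct.one_def]
  mul_star i j := by simp [Subsingleton.elim i j]
  star_mul i j := by simp [Subsingleton.elim i j]

end IsUnitaryCorep

/-- The span of the matrix elements. -/
def coeffSpan {ι : Type*} (w : Matrix ι ι A) : Submodule ℂ A :=
  Submodule.span ℂ (Set.range fun p : ι × ι => w p.1 p.2)

lemma mem_coeffSpan {ι : Type*} (w : Matrix ι ι A) (i j : ι) : w i j ∈ coeffSpan w :=
  Submodule.subset_span ⟨(i, j), rfl⟩

lemma coeffSpan_le {ι : Type*} {w : Matrix ι ι A} {S : Submodule ℂ A} (h : ∀ i j, w i j ∈ S) :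
    coeffSpan w ≤ S :=
  Submodule.span_le.2 (by rintro _ ⟨p, rfl⟩; exact h _ _)

lemma exists_fin_coeffSpan {ι : Type*} [Fintype ι] [DecidableEq ι] {w : Matrix ι ι A}
    (h : IsUnitaryCorep w) :
    ∃ (n : ℕ) (v : Matrix (Fin n) (Fin n) A), IsUnitaryCorep v ∧ coeffSpan w ≤ coeffSpan v := by
  let e := (Fintype.equivFin ι).symm
  refine ⟨Fintype.card ι, _, h.reindex e, coeffSpan_le fun i j => ?_⟩
  have := mem_coeffSpan (fun i j => w (e i) (e j) : Matrix _ _ A) (e.symm i) (e.symm j)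
  simpa using this

variable [CompactMatrixQuantumGroup A]

/-- Direct sums account for sums, tensor products for products and the trivial corepresentation for
scalars. The elements covered therefore form a subalgebra, and it contains the generators of `A`. -/
lemma exists_mem_coeffSpan (a : A) :
    ∃ (n : ℕ) (w : Matrix (Fin n) (Fin n) A), IsUnitaryCorep w ∧ a ∈ coeffSpan w := by
  obtain ⟨n, u, hu, hu', hgen⟩ := CompactMatrixQuantumGroup.exists_unitary (A := A)
  have ha : a ∈ Algebra.adjoin ℂ (Set.range fun p : Fin n × Fin n => u p.1 p.2) := by
    rw [hgen]; trivial
  have huc : IsUnitaryCorep u := by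
    obtain ⟨h1, h2⟩ := Unitary.mem_iff.1 hu'
    refine ⟨hu, fun i j => ?_, fun i j => ?_⟩
    · simpa [Matrix.mul_apply, Matrix.one_apply, Matrix.star_apply] using congrFun (congrFun h2 i) j
    · simpa [Matrix.mul_apply, Matrix.one_apply, Matrix.star_apply] using congrFun (congrFun h1 i) j
  induction ha using Algebra.adjoin_induction with
  | mem x hx =>
    obtain ⟨p, rfl⟩ := hx
    exact ⟨n, u, huc, mem_coeffSpan u _ _⟩
  | algebraMap c =>
    refine ⟨1, _, IsUnitaryCorep.trivial, ?_⟩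
    rw [Algebra.algebraMap_eq_smul_one]
    exact Submodule.smul_mem _ _ (mem_coeffSpan (fun _ _ => 1 : Matrix (Fin 1) (Fin 1) A) 0 0)
  | add x y _ _ hx hy =>
    obtain ⟨m, w, hw, hxw⟩ := hx
    obtain ⟨k, v, hv, hyv⟩ := hy
    obtain ⟨l, z, hz, hle⟩ := exists_fin_coeffSpan (hw.directSum hv)
    refine ⟨l, z, hz, hle (add_mem (coeffSpan_le (fun i j => ?_) hxw)
      (coeffSpan_le (fun i j => ?_) hyv))⟩
    · exact mem_coeffSpan (Matrix.fromBlocks w 0 0 v) (Sum.inl i) (Sum.inl j)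
    · exact mem_coeffSpan (Matrix.fromBlocks w 0 0 v) (Sum.inr i) (Sum.inr j)
  | mul x y _ _ hx hy =>
    obtain ⟨m, w, hw, hxw⟩ := hx
    obtain ⟨k, v, hv, hyv⟩ := hy
    obtain ⟨l, z, hz, hle⟩ := exists_fin_coeffSpan (hw.tensor hv)
    refine ⟨l, z, hz, hle ?_⟩
    have h1 : coeffSpan w * coeffSpan v ≤ coeffSpan (fun p q => w p.1 q.1 * v p.2 q.2 :
        Matrix (Fin m × Fin k) (Fin m × Fin k) A) := by
      rw [coeffSpan, coeffSpan, Submodule.span_mul_span]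
      refine Submodule.span_le.2 ?_
      rintro _ ⟨_, ⟨p, rfl⟩, _, ⟨q, rfl⟩, rfl⟩
      exact Submodule.subset_span ⟨((p.1, q.1), (p.2, q.2)), rfl⟩
    exact h1 (Submodule.mul_mem_mul hxw hyv)

/-- Linear maps on `A` that agree on the entries of unitary corepresentations are equal. -/
lemma ext_corep {S : Type*} [AddCommMonoid S] [Module ℂ S] {f g : A →ₗ[ℂ] S}
    (h : ∀ (n : ℕ) (w : Matrix (Fin n) (Fin n) A), IsUnitaryCorep w → IsCorep w →
      ∀ i j, f (w i j) = g (w i j)) : f = g := by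
  ext a
  obtain ⟨n, w, hw, ha⟩ := exists_mem_coeffSpan a
  have : coeffSpan w ≤ LinearMap.eqLocus f g := coeffSpan_le (h n w hw hw.isCorep)
  exact this ha

lemma exists_common_coeffSpan {m k : ℕ} {w : Matrix (Fin m) (Fin m) A}
    {v : Matrix (Fin k) (Fin k) A} (hw : IsUnitaryCorep w) (hv : IsUnitaryCorep v) :
    ∃ (l : ℕ) (z : Matrix (Fin l) (Fin l) A), IsUnitaryCorep z ∧
      coeffSpan w ≤ coeffSpan z ∧ coeffSpan v ≤ coeffSpan z := by
  obtain ⟨l, z, hz, hle⟩ := exists_fin_coeffSpan (hw.directSum hv)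
  refine ⟨l, z, hz, (coeffSpan_le fun i j => ?_).trans hle, (coeffSpan_le fun i j => ?_).trans hle⟩
  · exact mem_coeffSpan (Matrix.fromBlocks w 0 0 v) (Sum.inl i) (Sum.inl j)
  · exact mem_coeffSpan (Matrix.fromBlocks w 0 0 v) (Sum.inr i) (Sum.inr j)

end Unitary

/-! ### Integrals in finite-dimensional matrix `*`-algebras. -/

section Integral

open scoped ComplexOrder Matrix

variable {n : Type*} [Fintype n] [DecidableEq n]

/-- The Gram matrix of T^(k+1) y equals y* T^k T^(k+2) y, so powers of T can be removed one at a
time until a single one is left. -/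
lemma isHermitian_mul_eq_zero_of_pow {T : Matrix n n ℂ} (hT : T.IsHermitian) (k : ℕ)
    {y : Matrix n n ℂ} (h : T ^ k * y = 0) : T * y = 0 := by
  induction k with
  | zero => rw [pow_zero, one_mul] at h; rw [h, mul_zero]
  | succ k ih =>
    rcases k with _ | k
    · simpa using h
    · refine ih ?_
      rw [← Matrix.conjTranspose_mul_self_eq_zero, Matrix.conjTranspose_mul,
        Matrix.conjTranspose_pow, hT.eq, mul_assoc, ← mul_assoc (T ^ (k + 1)), ← pow_add,
        show k + 1 + (k + 1) = k + (k + 1 + 1) by omega, pow_add, mul_assoc, h, mul_zero, mul_zero]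

/-- A unital `*`-algebra of pairs (matrix, character value) contains a two-sided integral. -/
lemma exists_matrix_integral (S : Subalgebra ℂ (Matrix n n ℂ × ℂ))
    (hS : ∀ x ∈ S, star x ∈ S) :
    ∃ p : Matrix n n ℂ, (p, (1 : ℂ)) ∈ S ∧ ∀ x ∈ S, x.1 * p = x.2 • p ∧ p * x.1 = x.2 • p := by
  -- The kernel of the character. The element sought has character value 1 and is annihilated by `K`
  -- from both sides.
  let K : Submodule ℂ (Matrix n n ℂ × ℂ) :=
    Subalgebra.toSubmodule S ⊓ LinearMap.ker (LinearMap.snd ℂ (Matrix n n ℂ) ℂ)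
  obtain ⟨F, hF⟩ := (IsNoetherian.noetherian K : K.FG)
  have hFK : ∀ x ∈ F, x ∈ S ∧ x.2 = 0 := fun x hx => by
    have : x ∈ K := hF ▸ Submodule.subset_span hx
    exact ⟨this.1, this.2⟩
  -- The generators of `K` are stacked into one matrix, so that T = N*N = ∑ x*x. Then Ty = 0 forces
  -- Ny = 0, hence xy = 0 for all x in `K`.
  let N : Matrix (F × n) n ℂ := Matrix.of fun p j => (p.1 : Matrix n n ℂ × ℂ).1 p.2 j
  let T : Matrix n n ℂ := Nᴴ * N
  have hT : T.IsHermitian := Matrix.isHermitian_conjTranspose_mul_self N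
  have hTsum : T = ∑ x ∈ F, x.1ᴴ * x.1 := by
    ext i j
    simp only [T, Matrix.mul_apply, Fintype.sum_prod_type, Matrix.sum_apply]
    exact Finset.sum_coe_sort F (fun x => ∑ k, x.1ᴴ i k * x.1 k j)
  have hTS : (T, (0 : ℂ)) ∈ S := by
    have : (T, (0 : ℂ)) = ∑ x ∈ F, star x * x := by
      refine Prod.ext ?_ ?_
      · rw [hTsum, Prod.fst_sum]; rfl
      · rw [Prod.snd_sum]
        exact (Finset.sum_eq_zero fun x hx => by simp [(hFK x hx).2]).symm
    rw [this]
    exact sum_mem fun x hx => mul_mem (hS x (hFK x hx).1) (hFK x hx).1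
  -- The minimal polynomial of T is X^m q with q(0) ≠ 0. Then q(T)/q(0) is the projection onto the
  -- kernel of T, and its character value is q(0)/q(0) = 1 because T has character value 0.
  obtain ⟨q, hq, hq0⟩ := Polynomial.exists_eq_pow_rootMultiplicity_mul_and_not_dvd
    (minpoly ℂ T) (minpoly.ne_zero (Matrix.isIntegral T)) 0
  rw [Polynomial.dvd_iff_isRoot, Polynomial.IsRoot.def] at hq0
  rw [map_zero, sub_zero] at hq
  have hTq : T * Polynomial.aeval T q = 0 := by
    refine isHermitian_mul_eq_zero_of_pow hT (Polynomial.rootMultiplicity 0 (minpoly ℂ T)) ?_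
    have h := minpoly.aeval ℂ T
    rw [hq, map_mul, map_pow, Polynomial.aeval_X] at h
    exact h
  let p : Matrix n n ℂ := (q.eval 0)⁻¹ • Polynomial.aeval T q
  have hTp : T * p = 0 := by simp only [p, mul_smul_comm, hTq, smul_zero]
  have hpT : p * T = 0 := by
    have hc : Commute T (Polynomial.aeval T q) := by
      have := (Polynomial.commute_X q).map (Polynomial.aeval (R := ℂ) T)
      simpa using this
    simp only [p, smul_mul_assoc, ← hc.eq, hTq, smul_zero]
  have key : ∀ y : Matrix n n ℂ, T * y = 0 → ∀ x ∈ K, x.1 * y = 0 := by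
    intro y hy
    have hN : N * y = 0 := by
      rw [← Matrix.conjTranspose_mul_self_eq_zero, Matrix.conjTranspose_mul, Matrix.mul_assoc,
        ← Matrix.mul_assoc Nᴴ]
      change yᴴ * (T * y) = 0
      rw [hy, mul_zero]
    intro x hx
    rw [← hF] at hx
    induction hx using Submodule.span_induction with
    | mem x hx =>
      ext i j
      have := congrFun (congrFun hN (⟨x, hx⟩, i)) j
      simpa [N, Matrix.mul_apply] using this
    | zero => simp
    | add x y _ _ hx hy => simp [add_mul, hx, hy]
    | smul c x _ hx => simp [hx]
  have hKS : ∀ x ∈ S, x - algebraMap ℂ _ x.2 ∈ K := fun x hx =>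
    ⟨sub_mem hx (S.algebraMap_mem _), by simp [Prod.algebraMap_apply]⟩
  refine ⟨p, ?_, fun x hx => ⟨?_, ?_⟩⟩
  · have h1 : Polynomial.aeval ((T, 0) : Matrix n n ℂ × ℂ) q ∈ S := by
      have := Polynomial.aeval_algHom_apply S.val ⟨_, hTS⟩ q
      exact this ▸ (Polynomial.aeval (⟨_, hTS⟩ : S) q).2
    have h2 := S.smul_mem h1 (q.eval 0)⁻¹
    convert h2 using 1
    refine Prod.ext ?_ ?_
    · simp [p, Polynomial.aeval_prod]
    · simp [Polynomial.aeval_prod, Polynomial.coe_aeval_eq_eval, hq0]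
  · have := key p hTp _ (hKS x hx)
    rw [Prod.fst_sub, Prod.algebraMap_apply, sub_mul, sub_eq_zero] at this
    rw [this, Algebra.smul_def]
  -- `S` is closed under the star, so the right-hand identity for `p` is the adjoint of the
  -- left-hand identity for its conjugate transpose.
  · have hT' : T * pᴴ = 0 := by
      rw [← hT.eq, ← Matrix.conjTranspose_mul, hpT, Matrix.conjTranspose_zero]
    have := key _ hT' _ (hKS _ (hS x hx))
    rw [Prod.fst_sub, Prod.algebraMap_apply, sub_mul, sub_eq_zero] at this
    have h2 := congrArg Matrix.conjTranspose this
    simpa [← Algebra.smul_def, Matrix.star_eq_conjTranspose] using h2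

end Integral

/-! ### The Haar functional. -/

section Haar

variable {A : Type*} [Ring A] [HopfAlgebra ℂ A] [StarRing A] [StarModule ℂ A]

/-- The convolution product of linear functionals. -/
def dualConv (f g : A →ₗ[ℂ] ℂ) : A →ₗ[ℂ] ℂ :=
  LinearMap.mul' ℂ ℂ ∘ₗ TensorProduct.map f g ∘ₗ Coalgebra.comul

/-- `g` behaves on `a` as a two-sided integral. -/
def IsIntegralAt (g : A →ₗ[ℂ] ℂ) (a : A) : Prop :=
  ∀ f : A →ₗ[ℂ] ℂ, dualConv f g a = f 1 * g a ∧ dualConv g f a = f 1 * g a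

/-- The convolution g * g' at `a` is g'(a) since g' is an integral, and g(a) since g is. -/
lemma IsIntegralAt.unique {g g' : A →ₗ[ℂ] ℂ} {a : A} (h : IsIntegralAt g a)
    (h' : IsIntegralAt g' a) (h1 : g 1 = 1) (h1' : g' 1 = 1) : g a = g' a := by
  have e := (h' g).1
  rw [(h g').2, h1, h1', one_mul, one_mul] at e
  exact e

/-- Sending a functional f to the pair of the matrix f(w) and the number f(1) turns convolution into
multiplication. The image is a unital `*`-algebra of pairs, and a functional representing the
integral of `exists_matrix_integral` is the one wanted. -/
lemma exists_integral_coeffSpan {n : ℕ} {w : Matrix (Fin n) (Fin n) A} (h : IsUnitaryCorep w) :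
    ∃ g : A →ₗ[ℂ] ℂ, g 1 = 1 ∧ ∀ a ∈ coeffSpan w, IsIntegralAt g a := by
  let M : (A →ₗ[ℂ] ℂ) → Matrix (Fin n) (Fin n) ℂ := fun f => Matrix.of fun i j => f (w i j)
  have hconv : ∀ f g i j, dualConv f g (w i j) = (M f * M g) i j := fun f g i j => by
    simp [dualConv, h.comul, M, Matrix.mul_apply]
  have hconv1 : ∀ f g : A →ₗ[ℂ] ℂ, dualConv f g 1 = f 1 * g 1 := fun f g => by
    simp [dualConv, Bialgebra.comul_one, Algebra.TensorProduct.one_def]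
  have hunit : M Coalgebra.counit = 1 := by
    ext i j
    simp [M, h.isCorep.counit, Matrix.one_apply]
  let S : Subalgebra ℂ (Matrix (Fin n) (Fin n) ℂ × ℂ) :=
    { carrier := {x | ∃ f : A →ₗ[ℂ] ℂ, x = (M f, f 1)}
      mul_mem' := by
        rintro _ _ ⟨f, rfl⟩ ⟨g, rfl⟩
        refine ⟨dualConv f g, Prod.ext ?_ (hconv1 f g).symm⟩
        ext i j
        exact (hconv f g i j).symm
      add_mem' := by
        rintro _ _ ⟨f, rfl⟩ ⟨g, rfl⟩
        exact ⟨f + g, rfl⟩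
      algebraMap_mem' := fun c => by
        refine ⟨c • Coalgebra.counit, ?_⟩
        have : M (c • Coalgebra.counit) = c • M Coalgebra.counit := rfl
        rw [this, hunit, Algebra.algebraMap_eq_smul_one]
        simp [Prod.ext_iff] }
  obtain ⟨p, ⟨g, hg⟩, hp⟩ := exists_matrix_integral S (by
    rintro _ ⟨f, rfl⟩
    -- This functional represents the adjoint matrix, since κ(w_ij)* = w_ji for unitary `w`.
    let f' : A →ₗ[ℂ] ℂ :=
      { toFun := fun a => star (f (star (HopfAlgebra.antipode ℂ a)))
        map_add' := fun x y => by simp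
        map_smul' := fun c x => by simp [star_smul] }
    refine ⟨f', Prod.ext ?_ ?_⟩
    · ext i j
      simp [M, f', h.antipode, Matrix.star_apply]
    · simp [f', HopfAlgebra.antipode_one])
  rw [Prod.ext_iff] at hg
  obtain ⟨rfl, hg1 : 1 = g 1⟩ := hg
  refine ⟨g, hg1.symm, fun a ha f => ?_⟩
  have hle : coeffSpan w ≤ LinearMap.eqLocus (dualConv f g) (f 1 • g) ⊓
      LinearMap.eqLocus (dualConv g f) (f 1 • g) := by
    refine coeffSpan_le fun i j => ⟨?_, ?_⟩
    · change dualConv f g (w i j) = _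
      rw [hconv, (hp (M f, f 1) ⟨f, rfl⟩).1]
      rfl
    · change dualConv g f (w i j) = _
      rw [hconv, (hp (M f, f 1) ⟨f, rfl⟩).2]
      rfl
  exact hle ha

variable [CompactMatrixQuantumGroup A]

variable (A) in
/-- The Haar functional. -/
lemma exists_haar : ∃ h : A →ₗ[ℂ] ℂ, h 1 = 1 ∧
    ∀ a, TensorProduct.rid ℂ A (h.lTensor A (Coalgebra.comul (R := ℂ) a)) = h a • 1 := by
  have hex : ∀ a : A, ∃ g : A →ₗ[ℂ] ℂ, g 1 = 1 ∧ IsIntegralAt g a := fun a => by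
    obtain ⟨n, w, hw, ha⟩ := exists_mem_coeffSpan a
    obtain ⟨g, hg, hg'⟩ := exists_integral_coeffSpan hw
    exact ⟨g, hg, hg' a ha⟩
  choose G hG1 hG using hex
  -- `G a` depends on `a`, but normalized integrals agree wherever both are integrals. Comparison
  -- with one integral on a common span of matrix elements shows that the diagonal choice is linear.
  let h : A →ₗ[ℂ] ℂ :=
    { toFun := fun a => G a a
      map_add' := fun a b => by
        obtain ⟨m, w, hw, ha⟩ := exists_mem_coeffSpan a
        obtain ⟨k, v, hv, hb⟩ := exists_mem_coeffSpan b
        obtain ⟨l, z, hz, hwz, hvz⟩ := exists_common_coeffSpan hw hv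
        obtain ⟨g, hg1, hg⟩ := exists_integral_coeffSpan hz
        rw [(hG a).unique (hg a (hwz ha)) (hG1 a) hg1, (hG b).unique (hg b (hvz hb)) (hG1 b) hg1,
          (hG (a + b)).unique (hg _ (add_mem (hwz ha) (hvz hb))) (hG1 _) hg1, map_add]
      map_smul' := fun c a => by
        obtain ⟨m, w, hw, ha⟩ := exists_mem_coeffSpan a
        obtain ⟨g, hg1, hg⟩ := exists_integral_coeffSpan hw
        rw [(hG a).unique (hg a ha) (hG1 a) hg1,
          (hG (c • a)).unique (hg _ (Submodule.smul_mem _ c ha)) (hG1 _) hg1, map_smul]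
        rfl }
  have hh : ∀ {n : ℕ} {w : Matrix (Fin n) (Fin n) A} {g : A →ₗ[ℂ] ℂ}, g 1 = 1 →
      (∀ a ∈ coeffSpan w, IsIntegralAt g a) → ∀ a ∈ coeffSpan w, h a = g a :=
    fun hg1 hg a ha => (hG a).unique (hg a ha) (hG1 a) hg1
  refine ⟨h, hG1 1, fun a => ?_⟩
  let L : A →ₗ[ℂ] A := (TensorProduct.rid ℂ A).toLinearMap ∘ₗ h.lTensor A ∘ₗ Coalgebra.comul
  have hL : L = h.smulRight 1 := by
    refine ext_corep fun n w hw hw' i j => ?_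
    obtain ⟨g, hg1, hg⟩ := exists_integral_coeffSpan hw
    have e : ∀ i j, h (w i j) = g (w i j) := fun i j => hh hg1 hg _ (mem_coeffSpan w i j)
    -- Functionals separate points, and tested against f the claim is the integral property of g
    -- with respect to f.
    rw [← sub_eq_zero, ← Module.forall_dual_apply_eq_zero_iff ℂ]
    intro f
    have h1 := (hg _ (mem_coeffSpan w i j) f).1
    rw [map_sub, sub_eq_zero]
    simpa [L, hw.comul, e, dualConv, mul_comm] using h1
  exact LinearMap.congr_fun hL a

end Haar

/-! ### Finite-dimensional subcomodules of horizontal forms, and freeness. -/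

namespace HorizontalForms

variable {A H : Type*} [Ring A] [HopfAlgebra ℂ A] [StarRing A] [StarModule ℂ A]
    [Ring H] [Algebra ℂ H] [StarAddMonoid H] [StarModule ℂ H] (P : HorizontalForms A H)

/-- A finite family of forms of degree `n` that spans a subcomodule with matrix `v`. -/
structure IsFamily (n : ℕ) {m : ℕ} (x : Fin m → H) (v : Matrix (Fin m) (Fin m) A) : Prop where
  deg : ∀ i, x i ∈ P.deg n
  coact : ∀ i, P.coact (x i) = ∑ j, x j ⊗ₜ[ℂ] v j i
  isCorep : IsCorep v

/-- A basis of the subcomodule provides both the family and the matrix. Dual functionals, extended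
to `H`, read off the corepresentation identities from coassociativity and from the counit axiom. -/
lemma exists_family_of_submodule {n : ℕ} (W : Submodule ℂ H) [FiniteDimensional ℂ W]
    (hdeg : W ≤ P.deg n)
    (hW : ∀ x ∈ W, P.coact x ∈ LinearMap.range (W.subtype.rTensor A)) :
    ∃ (m : ℕ) (x : Fin m → H) (v : Matrix (Fin m) (Fin m) A), P.IsFamily n x v ∧
      W ≤ Submodule.span ℂ (Set.range x) := by
  classical
  let e := Module.finBasis ℂ W
  have h1 : ∀ i, ∃ c : Fin (Module.finrank ℂ W) → A,
      P.coact (e i) = ∑ j, (e j : H) ⊗ₜ[ℂ] c j := by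
    intro i
    obtain ⟨t, ht⟩ := hW _ (e i).2
    obtain ⟨c, hc⟩ := TensorProduct.eq_repr_basis_left e t
    refine ⟨c, ?_⟩
    rw [← ht, ← hc, Finsupp.sum_fintype _ _ (by simp)]
    simp
  choose c hc using h1
  have h2 : ∀ k, ∃ f : H →ₗ[ℂ] ℂ, ∀ j, f (e j) = if j = k then 1 else 0 := by
    intro k
    obtain ⟨f, hf⟩ := LinearMap.exists_extend (e.coord k)
    refine ⟨f, fun j => ?_⟩
    have := LinearMap.congr_fun hf (e j)
    simpa [Finsupp.single_apply] using this
  choose f hf using h2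
  refine ⟨_, fun i => (e i : H), Matrix.of fun j i => c i j, ⟨fun i => hdeg (e i).2, hc, ?_, ?_⟩, ?_⟩
  · intro k i
    have h3 := P.coassoc (e i)
    rw [hc] at h3
    simp only [map_sum, LinearMap.rTensor_tmul, AlgHom.toLinearMap_apply, hc,
      TensorProduct.sum_tmul, TensorProduct.assoc_tmul, LinearMap.lTensor_tmul] at h3
    have h4 := congrArg (fun t => TensorProduct.lid ℂ (A ⊗[ℂ] A) ((f k).rTensor (A ⊗[ℂ] A) t)) h3
    simp only [map_sum, LinearMap.rTensor_tmul, hf, TensorProduct.lid_tmul, ite_smul, one_smul,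
      zero_smul, Finset.sum_ite_eq', Finset.mem_univ, if_true] at h4
    exact h4.symm
  · intro k i
    have h3 := P.counit (e i)
    rw [hc] at h3
    have h4 := congrArg (f k) h3
    simp only [map_sum, LinearMap.lTensor_tmul, TensorProduct.rid_tmul, map_smul, hf,
      smul_eq_mul, mul_ite, mul_one, mul_zero, Finset.sum_ite_eq', Finset.mem_univ, if_true] at h4
    rw [Matrix.of_apply, h4]
    exact if_congr eq_comm rfl rfl
  · intro x hx
    have := e.mem_span ⟨x, hx⟩
    have h3 := Submodule.mem_map_of_mem (f := W.subtype) this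
    rw [Submodule.map_span, ← Set.range_comp] at h3
    exact h3

/-- Local finiteness: the coefficients of the coaction on φ, with respect to a basis of `A`, span a
subcomodule, and it contains φ by the counit axiom. They can be chosen in degree `n` because the
coaction preserves degrees. -/
lemma exists_family {n : ℕ} {φ : H} (hφ : φ ∈ P.deg n) :
    ∃ (m : ℕ) (x : Fin m → H) (v : Matrix (Fin m) (Fin m) A), P.IsFamily n x v ∧
      φ ∈ Submodule.span ℂ (Set.range x) := by
  classical
  let b := Module.Basis.ofVectorSpace ℂ A
  obtain ⟨t, ht⟩ := P.coact_deg n φ hφ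
  obtain ⟨d, hd⟩ := TensorProduct.eq_repr_basis_right b t
  have hF : P.coact φ = ∑ i ∈ d.support, (d i : H) ⊗ₜ[ℂ] b i := by
    rw [← ht, ← hd, Finsupp.sum, map_sum]; rfl
  let c : _ → H := fun i => (d i : H)
  let W : Submodule ℂ H := Submodule.span ℂ (Set.range fun i : d.support => c i)
  have hWf : FiniteDimensional ℂ W := FiniteDimensional.span_of_finite ℂ (Set.finite_range _)
  have hcW : ∀ i, c i ∈ W := fun i => by
    by_cases h : i ∈ d.support
    · exact Submodule.subset_span ⟨⟨i, h⟩, rfl⟩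
    · rw [Finsupp.notMem_support_iff] at h
      simp [c, h]
  -- Coassociativity at φ, paired in the last leg with the k-th coordinate functional.
  have hsl : ∀ k, P.coact (c k) = ∑ i ∈ d.support, c i ⊗ₜ[ℂ]
      TensorProduct.rid ℂ A ((b.coord k).lTensor A (Coalgebra.comul (R := ℂ) (b i))) := by
    intro k
    have h3 := P.coassoc φ
    rw [hF] at h3
    let Z : H ⊗[ℂ] (A ⊗[ℂ] A) →ₗ[ℂ] H ⊗[ℂ] A :=
      ((TensorProduct.rid ℂ A).toLinearMap ∘ₗ (b.coord k).lTensor A).lTensor H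
    have h4 := congrArg Z h3
    have h5 : ∀ (s : H ⊗[ℂ] A) (a : A), Z (TensorProduct.assoc ℂ H A A (s ⊗ₜ a)) =
        b.coord k a • s := by
      intro s a
      induction s with
      | zero => simp
      | add x y hx hy => simp only [TensorProduct.add_tmul, map_add, smul_add, hx, hy]
      | tmul x y => simp [Z, TensorProduct.tmul_smul]
    simp only [map_sum, LinearMap.rTensor_tmul, AlgHom.toLinearMap_apply, h5] at h4
    simp only [Module.Basis.coord_apply, Module.Basis.repr_self, Finsupp.single_apply, ite_smul,
      one_smul, zero_smul] at h4
    rw [Finset.sum_ite_eq'] at h4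
    by_cases h : k ∈ d.support
    · rw [if_pos h] at h4
      rw [h4]
      rfl
    · rw [if_neg h] at h4
      rw [Finsupp.notMem_support_iff] at h
      have hk : c k = 0 := by simp [c, h]
      rw [hk, map_zero, h4]
      rfl
  obtain ⟨m, x, v, hx, hle⟩ := P.exists_family_of_submodule (n := n) W
    (Submodule.span_le.2 (by rintro _ ⟨i, rfl⟩; exact (d i).2)) (by
      intro y hy
      have : W ≤ (LinearMap.range (W.subtype.rTensor A)).comap P.coact.toLinearMap := by
        refine Submodule.span_le.2 ?_
        rintro _ ⟨i, rfl⟩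
        change P.coact (c i) ∈ LinearMap.range (W.subtype.rTensor A)
        rw [hsl]
        exact sum_mem fun j _ => ⟨(⟨c j, hcW j⟩ : W) ⊗ₜ _, rfl⟩
      exact this hy)
  refine ⟨m, x, v, hx, hle ?_⟩
  rw [← P.counit φ, hF]
  simp only [map_sum, LinearMap.lTensor_tmul, TensorProduct.rid_tmul]
  exact sum_mem fun i _ => Submodule.smul_mem _ _ (hcW i)

/-- Two linear maps agree in degree `n` if they agree on families spanning subcomodules. -/
lemma eq_of_family {S : Type*} [AddCommMonoid S] [Module ℂ S] {f g : H →ₗ[ℂ] S} {n : ℕ}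
    (h : ∀ (m : ℕ) (x : Fin m → H) (v : Matrix (Fin m) (Fin m) A), P.IsFamily n x v →
      ∀ i, f (x i) = g (x i)) {φ : H} (hφ : φ ∈ P.deg n) : f φ = g φ := by
  obtain ⟨m, x, v, hx, hmem⟩ := P.exists_family hφ
  have : Submodule.span ℂ (Set.range x) ≤ LinearMap.eqLocus f g :=
    Submodule.span_le.2 (by rintro _ ⟨i, rfl⟩; exact h m x v hx i)
  exact this hmem

lemma ext_deg {S : Type*} [AddCommMonoid S] [Module ℂ S] {f g : H →ₗ[ℂ] S}
    (h : ∀ n, ∀ φ ∈ P.deg n, f φ = g φ) : f = g := by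
  ext φ
  induction φ using P.deg_induction with
  | h n φ hφ => exact h n φ hφ
  | h0 => simp
  | hadd x y hx hy => simp [hx, hy]

lemma ext_family {S : Type*} [AddCommMonoid S] [Module ℂ S] {f g : H →ₗ[ℂ] S}
    (h : ∀ (n m : ℕ) (x : Fin m → H) (v : Matrix (Fin m) (Fin m) A), P.IsFamily n x v →
      ∀ i, f (x i) = g (x i)) : f = g :=
  P.ext_deg fun n _ hφ => P.eq_of_family (h n) hφ

variable {P} in
lemma IsFamily.contract {n m : ℕ} {x : Fin m → H} {v : Matrix (Fin m) (Fin m) A}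
    (h : P.IsFamily n x v) (χ : A →ₗ[ℂ] H) (i : Fin m) :
    P.contract χ (x i) = ∑ j, x j * χ (v j i) := by
  simp [HorizontalForms.contract, h.coact]

/-- Evaluation of the second leg by `χ` and multiplication. -/
def evalRight (χ : A →ₗ[ℂ] H) : H ⊗[ℂ] A →ₗ[ℂ] H := LinearMap.mul' ℂ H ∘ₗ χ.lTensor H

lemma contract_eq (χ : A →ₗ[ℂ] H) (φ : H) : P.contract χ φ = evalRight χ (P.coact φ) := rfl

lemma evalRight_tmul (χ : A →ₗ[ℂ] H) (x : H) (a : A) : evalRight χ (x ⊗ₜ a) = x * χ a := rfl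

lemma evalRight_mul (χ : A →ₗ[ℂ] H) (q : H) (t : H ⊗[ℂ] A) :
    evalRight χ ((q ⊗ₜ 1) * t) = q * evalRight χ t := by
  induction t with
  | zero => simp
  | add x y hx hy => simp only [mul_add, map_add, hx, hy]
  | tmul x y => simp [evalRight_tmul, mul_assoc]

/-- The form in which freeness is used. -/
lemma apply_one_tmul_eq_zero {S : Type*} [AddCommGroup S] [Module ℂ S] (L : H ⊗[ℂ] A →ₗ[ℂ] S)
    (act : H → S →ₗ[ℂ] S) (hL : ∀ q t, L ((q ⊗ₜ 1) * t) = act q (L t))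
    (h : ∀ b ∈ P.deg 0, L (P.coact b) = 0) (a : A) : L (1 ⊗ₜ a) = 0 := by
  obtain ⟨n, q, b, hqb, he⟩ := P.free a
  rw [← he, map_sum]
  exact Finset.sum_eq_zero fun i _ => by rw [hL, h _ (hqb i).2, map_zero]

/-- If 1 ⊗ a = ∑ qᵢ F(bᵢ), then χ(a) = ∑ qᵢ · (contraction of bᵢ), so the contraction in degree zero
determines χ. -/
lemma contract_injective {χ χ' : A →ₗ[ℂ] H}
    (h : ∀ b ∈ P.deg 0, P.contract χ b = P.contract χ' b) : χ = χ' := by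
  ext a
  have := P.apply_one_tmul_eq_zero (evalRight χ - evalRight χ') (LinearMap.mulLeft ℂ)
    (fun q t => by simp [evalRight_mul, mul_sub])
    (fun b hb => by simpa [contract_eq, sub_eq_zero] using h b hb) a
  simpa [evalRight_tmul, sub_eq_zero] using this

lemma apply_mem_deg {χ : A →ₗ[ℂ] H} {k : ℕ} (h : ∀ b ∈ P.deg 0, P.contract χ b ∈ P.deg k)
    (a : A) : χ a ∈ P.deg k := by
  obtain ⟨n, q, b, hqb, he⟩ := P.free a
  have : χ a = evalRight χ (1 ⊗ₜ a) := by simp [evalRight_tmul]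
  rw [this, ← he, map_sum]
  refine sum_mem fun i _ => ?_
  rw [evalRight_mul, ← contract_eq]
  simpa using SetLike.GradedMul.mul_mem (hqb i).1 (h _ (hqb i).2)

end HorizontalForms

/-! ### Maps linear over the base are contractions. -/

namespace HorizontalForms

variable {A H : Type*} [Ring A] [HopfAlgebra ℂ A] [StarRing A] [StarModule ℂ A]
    [Ring H] [Algebra ℂ H] [StarAddMonoid H] [StarModule ℂ H] (P : HorizontalForms A H)

/-- The map `q ⊗ b ↦ q F(b)`. -/
def galois : H ⊗[ℂ] H →ₗ[ℂ] H ⊗[ℂ] A :=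
  LinearMap.mul' ℂ (H ⊗[ℂ] A) ∘ₗ
    TensorProduct.map ((TensorProduct.mk ℂ H A).flip 1) P.coact.toLinearMap

lemma galois_tmul (q b : H) : P.galois (q ⊗ₜ b) = (q ⊗ₜ 1) * P.coact b := rfl

/-- A linear choice of preimages of `1 ⊗ a` under `q ⊗ b ↦ q F(b)`. -/
lemma exists_galois_section : ∃ s : A →ₗ[ℂ] P.deg 0 ⊗[ℂ] P.deg 0, ∀ a,
    P.galois (TensorProduct.map (P.deg 0).subtype (P.deg 0).subtype (s a)) = 1 ⊗ₜ a := by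
  let C := P.galois ∘ₗ TensorProduct.map (P.deg 0).subtype (P.deg 0).subtype
  obtain ⟨g, hg⟩ := C.rangeRestrict.exists_rightInverse_of_surjective
    (LinearMap.range_eq_top.2 C.surjective_rangeRestrict)
  have hmem : ∀ a : A, TensorProduct.mk ℂ H A 1 a ∈ LinearMap.range C := by
    intro a
    obtain ⟨n, q, b, hqb, he⟩ := P.free a
    refine ⟨∑ i, (⟨q i, (hqb i).1⟩ : P.deg 0) ⊗ₜ ⟨b i, (hqb i).2⟩, ?_⟩
    simpa [C, galois_tmul] using he
  refine ⟨g ∘ₗ (TensorProduct.mk ℂ H A 1).codRestrict _ hmem, fun a => ?_⟩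
  exact congrArg Subtype.val (LinearMap.congr_fun hg ⟨_, hmem a⟩)

/-- `q ↦ (id ⊗ h(c ·)) F(q)`. -/
def slice (h : A →ₗ[ℂ] ℂ) (c : A) : H →ₗ[ℂ] H :=
  (TensorProduct.rid ℂ H).toLinearMap ∘ₗ (h ∘ₗ LinearMap.mulLeft ℂ c).lTensor H ∘ₗ
    P.coact.toLinearMap

/-- Coassociativity brings ∑ c₁ κ(c₂) into the second leg, which the antipode axiom collapses. The
identity recovers b ⊗ 1 from F(b). -/
lemma coact_mul_antipode {b : H} (hb : b ∈ P.deg 0) :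
    LinearMap.mul' ℂ (H ⊗[ℂ] A) (TensorProduct.map P.coact.toLinearMap
      (TensorProduct.mk ℂ H A 1 ∘ₗ HopfAlgebra.antipode ℂ) (P.coact b)) = b ⊗ₜ 1 := by
  refine P.eq_of_family (f := LinearMap.mul' ℂ (H ⊗[ℂ] A) ∘ₗ TensorProduct.map P.coact.toLinearMap
      (TensorProduct.mk ℂ H A 1 ∘ₗ HopfAlgebra.antipode ℂ) ∘ₗ P.coact.toLinearMap)
    (g := (TensorProduct.mk ℂ H A).flip 1) (fun m x v hx i => ?_) hb
  simp only [LinearMap.comp_apply, AlgHom.toLinearMap_apply, hx.coact, map_sum,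
    TensorProduct.map_tmul, LinearMap.mul'_apply, Finset.sum_mul, TensorProduct.mk_apply,
    Algebra.TensorProduct.tmul_mul_tmul, mul_one, LinearMap.flip_apply]
  rw [Finset.sum_comm]
  simp [← TensorProduct.tmul_sum, hx.isCorep.mul_antipode, TensorProduct.tmul_ite]

/-- For t = ∑ q ⊗ b, replacing b ⊗ 1 by ∑ F(bₖ)(1 ⊗ κ(cₖ)) shows that ∑ F(q)(b ⊗ 1) depends on t
only through ∑ q F(b). When t lies over 1 ⊗ a, the value is h(c κ(a)) 1. -/
lemma slice_mul_galois (h : A →ₗ[ℂ] ℂ) (c : A) (t : P.deg 0 ⊗[ℂ] P.deg 0) :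
    LinearMap.mul' ℂ H (TensorProduct.map (P.slice h c ∘ₗ (P.deg 0).subtype) (P.deg 0).subtype t) =
    TensorProduct.rid ℂ H ((h ∘ₗ LinearMap.mulLeft ℂ c).lTensor H
      (LinearMap.mul' ℂ (H ⊗[ℂ] A) (TensorProduct.map P.coact.toLinearMap
      (TensorProduct.mk ℂ H A 1 ∘ₗ HopfAlgebra.antipode ℂ)
      (P.galois (TensorProduct.map (P.deg 0).subtype (P.deg 0).subtype t))))) := by
  induction t with
  | zero => simp
  | add x y hx hy => simp only [map_add, hx, hy]
  | tmul q b =>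
    have h1 : ∀ s : H ⊗[ℂ] A, LinearMap.mul' ℂ (H ⊗[ℂ] A) (TensorProduct.map P.coact.toLinearMap
        (TensorProduct.mk ℂ H A 1 ∘ₗ HopfAlgebra.antipode ℂ) (((q : H) ⊗ₜ 1) * s)) =
        P.coact q * LinearMap.mul' ℂ (H ⊗[ℂ] A) (TensorProduct.map P.coact.toLinearMap
        (TensorProduct.mk ℂ H A 1 ∘ₗ HopfAlgebra.antipode ℂ) s) := by
      intro s
      induction s with
      | zero => simp
      | add x y hx hy => simp only [mul_add, map_add, hx, hy]
      | tmul x y => simp [mul_assoc]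
    have h2 : ∀ s : H ⊗[ℂ] A, TensorProduct.rid ℂ H ((h ∘ₗ LinearMap.mulLeft ℂ c).lTensor H s) * b =
        TensorProduct.rid ℂ H ((h ∘ₗ LinearMap.mulLeft ℂ c).lTensor H (s * ((b : H) ⊗ₜ 1))) := by
      intro s
      induction s with
      | zero => simp
      | add x y hx hy => simp only [add_mul, map_add, hx, hy]
      | tmul x y => simp
    simp only [TensorProduct.map_tmul, galois_tmul, Submodule.subtype_apply, h1,
      P.coact_mul_antipode b.2, ← h2]
    rfl

variable [CompactMatrixQuantumGroup A]

/-- A map that is linear over the forms on the base is a contraction. -/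
lemma exists_contract (T : H →ₗ[ℂ] H)
    (hT : ∀ x ∈ P.base, ∀ b ∈ P.deg 0, T (x * b) = x * T b) :
    ∃ χ : A →ₗ[ℂ] H, ∀ φ, T φ = P.contract χ φ := by
  obtain ⟨h, h1, hh⟩ := exists_haar A
  obtain ⟨s, hs⟩ := P.exists_galois_section
  -- With s(a) = ∑ q ⊗ b, this is ∑ (id ⊗ h(c ·))F(q) · U(b). Evaluated on the two legs of the
  -- coproduct it gives the candidate `χ U` for the coefficient map of U.
  let G : (H →ₗ[ℂ] H) → A →ₗ[ℂ] A →ₗ[ℂ] H := fun U =>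
    LinearMap.mk₂ ℂ (fun c a => LinearMap.mul' ℂ H (TensorProduct.map
        (P.slice h c ∘ₗ (P.deg 0).subtype) (U ∘ₗ (P.deg 0).subtype) (s a)))
      (fun c c' a => by
        have e : h ∘ₗ LinearMap.mulLeft ℂ (c + c') =
            h ∘ₗ LinearMap.mulLeft ℂ c + h ∘ₗ LinearMap.mulLeft ℂ c' := by
          ext x; simp [add_mul]
        have : P.slice h (c + c') = P.slice h c + P.slice h c' := by
          simp only [slice, e, LinearMap.lTensor_add, LinearMap.comp_add, LinearMap.add_comp]
        rw [this, LinearMap.add_comp, TensorProduct.map_add_left, LinearMap.add_apply, map_add])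
      (fun r c a => by
        have e : h ∘ₗ LinearMap.mulLeft ℂ (r • c) = r • (h ∘ₗ LinearMap.mulLeft ℂ c) := by
          ext x; simp
        have : P.slice h (r • c) = r • P.slice h c := by
          simp only [slice, e, LinearMap.lTensor_smul, LinearMap.comp_smul, LinearMap.smul_comp]
        rw [this, LinearMap.smul_comp, TensorProduct.map_smul_left, LinearMap.smul_apply, map_smul])
      (fun c a a' => by simp only [map_add])
      (fun r c a => by simp only [map_smul])
  let χ : (H →ₗ[ℂ] H) → A →ₗ[ℂ] H := fun U => TensorProduct.lift (G U) ∘ₗ Coalgebra.comul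
  -- Averaging with the Haar functional produces invariant elements.
  have hbase : ∀ φ, P.slice h 1 φ ∈ P.base := by
    intro φ
    have e : P.coact.toLinearMap ∘ₗ P.slice h 1 = (TensorProduct.mk ℂ H A).flip 1 ∘ₗ P.slice h 1 := by
      refine P.ext_family fun n m x v hx i => ?_
      have e1 : P.slice h 1 (x i) = ∑ j, h (v j i) • x j := by simp [slice, hx.coact]
      simp only [LinearMap.comp_apply, e1, map_sum, map_smul, AlgHom.toLinearMap_apply, hx.coact,
        LinearMap.flip_apply, TensorProduct.mk_apply, Finset.smul_sum]
      rw [Finset.sum_comm]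
      refine Finset.sum_congr rfl fun k _ => ?_
      have e2 := hh (v k i)
      rw [hx.isCorep.comul] at e2
      simp only [map_sum, LinearMap.lTensor_tmul, TensorProduct.rid_tmul] at e2
      rw [← TensorProduct.tmul_smul, ← e2, TensorProduct.tmul_sum]
      simp
    exact LinearMap.congr_fun e φ
  -- both sides of the reconstruction, for an arbitrary map in the second leg
  have hsum : ∀ (U : H →ₗ[ℂ] H) {n m : ℕ} (x : Fin m → H) (v : Matrix (Fin m) (Fin m) A),
      P.IsFamily n x v → ∀ i, P.contract (χ U) (x i) = ∑ k, LinearMap.mul' ℂ H (TensorProduct.map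
        (P.slice h 1 ∘ₗ LinearMap.mulLeft ℂ (x k) ∘ₗ (P.deg 0).subtype)
        (U ∘ₗ (P.deg 0).subtype) (s (v k i))) := by
    intro U n m x v hx i
    have e1 : ∀ k (t : P.deg 0 ⊗[ℂ] P.deg 0), LinearMap.mul' ℂ H (TensorProduct.map
        (P.slice h 1 ∘ₗ LinearMap.mulLeft ℂ (x k) ∘ₗ (P.deg 0).subtype)
        (U ∘ₗ (P.deg 0).subtype) t) = ∑ j, x j * LinearMap.mul' ℂ H (TensorProduct.map
        (P.slice h (v j k) ∘ₗ (P.deg 0).subtype) (U ∘ₗ (P.deg 0).subtype) t) := by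
      intro k t
      induction t with
      | zero => simp
      | add y z hy hz => simp only [map_add, mul_add, Finset.sum_add_distrib, hy, hz]
      | tmul q b =>
        have e2 : P.slice h 1 (x k * q) = ∑ j, x j * P.slice h (v j k) q := by
          simp only [slice, LinearMap.comp_apply, AlgHom.toLinearMap_apply, map_mul, hx.coact,
            Finset.sum_mul, map_sum]
          refine Finset.sum_congr rfl fun j _ => ?_
          generalize P.coact q = t
          induction t with
          | zero => simp
          | add y z hy hz => simp only [map_add, mul_add, hy, hz]
          | tmul y z => simp
        simp only [TensorProduct.map_tmul, LinearMap.comp_apply, LinearMap.mul'_apply,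
          LinearMap.mulLeft_apply, Submodule.subtype_apply, e2, Finset.sum_mul, mul_assoc]
    simp only [hx.contract, χ, LinearMap.comp_apply, hx.isCorep.comul, map_sum,
      TensorProduct.lift.tmul, e1, Finset.mul_sum]
    rw [Finset.sum_comm]
    rfl
  -- For U = id the candidate takes the value ∑ h(a₁ κ(a₂)) 1 = ε(a) 1, and contraction with the
  -- counit is the identity. Thus `hsum` with U = id reconstructs the elements of a family.
  have hrec : ∀ φ, P.contract (χ LinearMap.id) φ = φ := by
    intro φ
    refine LinearMap.congr_fun (f := P.contract (χ LinearMap.id)) (g := LinearMap.id) ?_ φ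
    refine P.ext_family fun n m x v hx i => ?_
    have e1 : ∀ c a, G LinearMap.id c a = h (c * HopfAlgebra.antipode ℂ a) • 1 := by
      intro c a
      change LinearMap.mul' ℂ H (TensorProduct.map (P.slice h c ∘ₗ (P.deg 0).subtype)
        (P.deg 0).subtype (s a)) = _
      rw [slice_mul_galois, hs]
      simp
    have e2 : ∀ j, χ LinearMap.id (v j i) = if j = i then 1 else 0 := by
      intro j
      calc χ LinearMap.id (v j i) = ∑ k, G LinearMap.id (v j k) (v k i) := by
            simp only [χ, LinearMap.comp_apply, hx.isCorep.comul, map_sum, TensorProduct.lift.tmul]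
        _ = ∑ k, h (v j k * HopfAlgebra.antipode ℂ (v k i)) • 1 :=
            Finset.sum_congr rfl fun k _ => e1 _ _
        _ = _ := by
            rw [← Finset.sum_smul, ← map_sum, hx.isCorep.mul_antipode]
            split_ifs <;> simp [h1]
    rw [hx.contract]
    simp [e2]
  refine ⟨χ T, fun φ => LinearMap.congr_fun ?_ φ⟩
  refine P.ext_family fun n m x v hx i => ?_
  rw [hsum T x v hx i]
  -- The argument of T is expanded by the reconstruction formula. The averaged left factors lie in
  -- the base, so T moves past them to the right factors, which have degree zero.
  nth_rewrite 1 [← hrec (x i)]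
  rw [hsum LinearMap.id x v hx i, map_sum]
  refine Finset.sum_congr rfl fun k _ => ?_
  generalize s (v k i) = t
  induction t with
  | zero => simp
  | add y z hy hz => simp only [map_add, hy, hz]
  | tmul q b => exact hT _ (hbase _) _ b.2

end HorizontalForms

/-! ### The star, the counit and the antipode. -/

section Star

variable {A : Type*} [Ring A] [HopfAlgebra ℂ A] [StarRing A] [StarModule ℂ A]
  [CompactMatrixQuantumGroup A]

lemma comul_star (a : A) :
    Coalgebra.comul (R := ℂ) (star a) = star (Coalgebra.comul (R := ℂ) a) :=
  CompactMatrixQuantumGroup.comul_star a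

/-- On a unitary corepresentation w_ij* = κ(w_ji), and the counit is invariant under the antipode.
-/
lemma counit_star (a : A) :
    Coalgebra.counit (R := ℂ) (star a) = star (Coalgebra.counit (R := ℂ) a) := by
  obtain ⟨n, w, hw, ha⟩ := exists_mem_coeffSpan a
  induction ha using Submodule.span_induction with
  | mem x hx =>
    obtain ⟨⟨i, j⟩, rfl⟩ := hx
    change Coalgebra.counit (R := ℂ) (star (w i j)) = star (Coalgebra.counit (R := ℂ) (w i j))
    rw [← hw.antipode, HopfAlgebra.counit_antipode, hw.isCorep.counit, hw.isCorep.counit]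
    by_cases h : i = j <;> simp [h, eq_comm]
  | zero => simp
  | add x y _ _ hx hy => simp [hx, hy]
  | smul c x _ hx => simp [star_smul, hx]

lemma IsCorep.comul_star_antipode {ι : Type*} [Fintype ι] [DecidableEq ι] {w : Matrix ι ι A}
    (h : IsCorep w) (i j : ι) :
    Coalgebra.comul (R := ℂ) (star (HopfAlgebra.antipode ℂ (w i j))) =
      ∑ k, star (HopfAlgebra.antipode ℂ (w k j)) ⊗ₜ[ℂ] star (HopfAlgebra.antipode ℂ (w i k)) := by
  rw [comul_star, h.comul_antipode, star_sum]
  simp [TensorProduct.star_tmul]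

lemma IsCorep.counit_star_antipode {ι : Type*} [Fintype ι] [DecidableEq ι] {w : Matrix ι ι A}
    (h : IsCorep w) (i j : ι) :
    Coalgebra.counit (R := ℂ) (star (HopfAlgebra.antipode ℂ (w i j))) = if i = j then 1 else 0 := by
  rw [counit_star, HopfAlgebra.counit_antipode, h.counit]
  split_ifs <;> simp

lemma IsCorep.star_mul_antipode {ι : Type*} [Fintype ι] [DecidableEq ι] {w : Matrix ι ι A}
    (h : IsCorep w) (i j : ι) :
    ∑ k, star (HopfAlgebra.antipode ℂ (w k j)) * star (w i k) = if i = j then 1 else 0 := by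
  have := congrArg star (h.mul_antipode i j)
  simp only [star_sum, StarMul.star_mul] at this
  rw [this]
  split_ifs <;> simp

end Star

/-! ### Commutation, covariance and hermiticity of coefficient maps. -/

namespace HorizontalForms

variable {A H : Type*} [Ring A] [HopfAlgebra ℂ A] [StarRing A] [StarModule ℂ A]
    [Ring H] [Algebra ℂ H] [StarAddMonoid H] [StarModule ℂ H] (P : HorizontalForms A H)

lemma star_mul_of_deg_zero {b : H} (hb : b ∈ P.deg 0) (φ : H) :
    star (b * φ) = star φ * star b := by
  induction φ using P.deg_induction with
  | h n φ hφ => simpa using P.star_mul 0 n b hb φ hφ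
  | h0 => simp
  | hadd x y hx hy => simp [mul_add, add_mul, hx, hy]

lemma star_mul_of_deg_zero_right {b : H} (hb : b ∈ P.deg 0) (φ : H) :
    star (φ * b) = star b * star φ := by
  induction φ using P.deg_induction with
  | h n φ hφ => simpa using P.star_mul n 0 φ hφ b hb
  | h0 => simp
  | hadd x y hx hy => simp [mul_add, add_mul, hx, hy]

variable {P} in
lemma IsFamily.star [CompactMatrixQuantumGroup A] {n m : ℕ} {x : Fin m → H}
    {v : Matrix (Fin m) (Fin m) A} (h : P.IsFamily n x v) :
    P.IsFamily n (fun i => Star.star (x i)) (Matrix.of fun i j => Star.star (v i j)) where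
  deg i := P.star_mem n _ (h.deg i)
  coact i := by rw [P.coact_star, h.coact, star_sum]; simp [TensorProduct.star_tmul]
  isCorep := ⟨fun i j => by
      simp only [Matrix.of_apply]
      rw [comul_star, h.isCorep.comul, star_sum]; simp [TensorProduct.star_tmul],
    fun i j => by
      simp only [Matrix.of_apply]
      rw [counit_star, h.isCorep.counit]
      split_ifs <;> simp⟩

/-- `T` is an operator of the form `φ ↦ -∑ σ(φ)ₖ χ(cₖ)` that is a hermitian right-covariant
derivation over elements of degree zero; `σ` is a sign automorphism. -/
structure IsContraction (σ : H →ₐ[ℂ] H) (T : H →ₗ[ℂ] H) (χ : A →ₗ[ℂ] H) : Prop where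
  sign_deg_zero : ∀ b ∈ P.deg 0, σ b = b
  contract : ∀ φ, T φ = -P.contract χ (σ φ)
  leibniz : ∀ b ∈ P.deg 0, ∀ φ, T (b * φ) = T b * φ + b * T φ
  covariant : ∀ φ, P.coact (T φ) = T.rTensor A (P.coact φ)
  hermitian : ∀ φ, T (star φ) = star (T φ)

variable {P} {σ : H →ₐ[ℂ] H} {T : H →ₗ[ℂ] H} {χ : A →ₗ[ℂ] H}

namespace IsContraction

lemma contract_deg_zero (h : P.IsContraction σ T χ) {b : H} (hb : b ∈ P.deg 0) :
    P.contract χ b = -T b := by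
  rw [h.contract, h.sign_deg_zero b hb, neg_neg]

lemma one_mem_deg_zero : (1 : H) ∈ P.deg 0 := SetLike.GradedOne.one_mem

lemma apply_one (h : P.IsContraction σ T χ) : χ 1 = 0 := by
  have h1 := h.leibniz 1 one_mem_deg_zero 1
  have h2 := h.contract 1
  have h3 : T 1 = 0 := by simpa using h1
  rw [h3, map_one] at h2
  simpa [HorizontalForms.contract, Algebra.TensorProduct.one_def] using h2

/-- The commutation rule `χ(a)φ = ∑ σ(φ)ₖ (χ(a cₖ) - ε(a)χ(cₖ))`. -/
lemma mul_eq (h : P.IsContraction σ T χ) (a : A) (φ : H) :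
    χ a * φ = P.contract (χ ∘ₗ LinearMap.mulLeft ℂ a) (σ φ) -
      Coalgebra.counit (R := ℂ) a • P.contract χ (σ φ) := by
  -- both sides as functions of the tensor `1 ⊗ a`
  let L : H ⊗[ℂ] A →ₗ[ℂ] H :=
    evalRight χ ∘ₗ LinearMap.mulRight ℂ (P.coact (σ φ)) - LinearMap.mulRight ℂ φ ∘ₗ evalRight χ -
      LinearMap.mulRight ℂ (P.contract χ (σ φ)) ∘ₗ (TensorProduct.rid ℂ H).toLinearMap ∘ₗ
        (Coalgebra.counit (R := ℂ)).lTensor H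
  have hε : ∀ (q : H) (t : H ⊗[ℂ] A),
      TensorProduct.rid ℂ H ((Coalgebra.counit (R := ℂ)).lTensor H ((q ⊗ₜ 1) * t)) =
      q * TensorProduct.rid ℂ H ((Coalgebra.counit (R := ℂ)).lTensor H t) := by
    intro x t
    induction t with
    | zero => simp
    | add x y hx hy => simp only [mul_add, map_add, hx, hy]
    | tmul x y => simp
  have h0 := P.apply_one_tmul_eq_zero L (LinearMap.mulLeft ℂ)
    (fun q t => by
      simp only [L, LinearMap.sub_apply, LinearMap.comp_apply, LinearMap.mulRight_apply,
        LinearEquiv.coe_coe, hε, evalRight_mul, mul_assoc, LinearMap.mulLeft_apply, mul_sub])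
    -- By freeness the identity needs checking only on F(b), where it is the Leibniz rule for T at
    -- bφ, rewritten by means of T = −(contraction) ∘ σ.
    (fun b hb => by
      have h1 := h.leibniz b hb φ
      have h2 := h.contract (b * φ)
      rw [map_mul σ, h.sign_deg_zero b hb] at h2
      have h3 := h.contract_deg_zero hb
      simp only [L, LinearMap.sub_apply, LinearMap.comp_apply, LinearMap.mulRight_apply,
        LinearEquiv.coe_coe, P.counit, ← map_mul, ← contract_eq, h3]
      rw [h2, h.contract φ] at h1
      rw [neg_eq_iff_eq_neg.1 h1]
      simp) a
  have e1 : evalRight χ ((1 ⊗ₜ a) * P.coact (σ φ)) =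
      P.contract (χ ∘ₗ LinearMap.mulLeft ℂ a) (σ φ) := by
    rw [contract_eq]
    generalize P.coact (σ φ) = t
    induction t with
    | zero => simp
    | add x y hx hy => simp only [mul_add, map_add, hx, hy]
    | tmul x y => simp [evalRight_tmul]
  simp only [L, LinearMap.sub_apply, LinearMap.comp_apply, LinearMap.mulRight_apply,
    LinearEquiv.coe_coe, LinearMap.lTensor_tmul, TensorProduct.rid_tmul, e1, evalRight_tmul,
    one_mul, smul_mul_assoc] at h0
  rw [sub_sub, sub_eq_zero] at h0
  rw [h0, add_sub_cancel_right]

variable [CompactMatrixQuantumGroup A]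

/-- Covariance of T on elements b of degree zero is this identity with the coefficients of b in
front; freeness strips them off. -/
lemma sum_coact (h : P.IsContraction σ T χ) {n : ℕ} (w : Matrix (Fin n) (Fin n) A)
    (hw : IsCorep w) (i j : Fin n) :
    ∑ k, (1 ⊗ₜ[ℂ] w i k) * P.coact (χ (w k j)) = ∑ k, χ (w i k) ⊗ₜ[ℂ] w k j := by
  let G : A →ₗ[ℂ] H ⊗[ℂ] A :=
    LinearMap.mul' ℂ (H ⊗[ℂ] A) ∘ₗ TensorProduct.map (TensorProduct.mk ℂ H A 1)
      (P.coact.toLinearMap ∘ₗ χ) ∘ₗ Coalgebra.comul - χ.rTensor A ∘ₗ Coalgebra.comul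
  have hG : ∀ {n : ℕ} (w : Matrix (Fin n) (Fin n) A), IsCorep w → ∀ i j, G (w i j) =
      ∑ k, (1 ⊗ₜ[ℂ] w i k) * P.coact (χ (w k j)) - ∑ k, χ (w i k) ⊗ₜ[ℂ] w k j := by
    intro n w hw i j
    simp [G, hw.comul]
  let L : H ⊗[ℂ] A →ₗ[ℂ] H ⊗[ℂ] A := LinearMap.mul' ℂ (H ⊗[ℂ] A) ∘ₗ
    TensorProduct.map ((TensorProduct.mk ℂ H A).flip 1) G
  have h0 := P.apply_one_tmul_eq_zero L (fun q => LinearMap.mulLeft ℂ (q ⊗ₜ 1))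
    (fun q t => by
      induction t with
      | zero => simp
      | add x y hx hy => simp only [mul_add, map_add, hx, hy]
      | tmul x y =>
        simp only [L, LinearMap.comp_apply, Algebra.TensorProduct.tmul_mul_tmul, one_mul,
          TensorProduct.map_tmul, LinearMap.mul'_apply, LinearMap.flip_apply,
          TensorProduct.mk_apply, LinearMap.mulLeft_apply, ← mul_assoc, mul_one])
    (fun b hb => by
      refine P.eq_of_family (f := L ∘ₗ P.coact.toLinearMap) (g := 0) (fun m x v hx i => ?_) hb
      have h1 := h.covariant (x i)
      have hT : ∀ i, T (x i) = -∑ j, x j * χ (v j i) := fun i => by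
        rw [← hx.contract, h.contract_deg_zero (hx.deg i), neg_neg]
      simp only [hT, hx.coact, map_neg, map_sum, map_mul, LinearMap.rTensor_tmul, neg_inj,
        TensorProduct.neg_tmul, Finset.sum_neg_distrib, TensorProduct.sum_tmul,
        Finset.sum_mul] at h1
      simp only [LinearMap.comp_apply, AlgHom.toLinearMap_apply, hx.coact, map_sum, L,
        TensorProduct.map_tmul, LinearMap.flip_apply, TensorProduct.mk_apply,
        LinearMap.mul'_apply, hG v hx.isCorep, mul_sub, Finset.sum_sub_distrib, Finset.mul_sum,
        ← mul_assoc, Algebra.TensorProduct.tmul_mul_tmul, mul_one, one_mul, LinearMap.zero_apply]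
      rw [sub_eq_zero, Finset.sum_comm, h1, Finset.sum_comm]) (w i j)
  simp only [L, LinearMap.comp_apply, TensorProduct.map_tmul, LinearMap.flip_apply,
    TensorProduct.mk_apply, LinearMap.mul'_apply, hG w hw, ← Algebra.TensorProduct.one_def,
    one_mul] at h0
  exact sub_eq_zero.1 h0

/-- Covariance of `χ` with respect to the adjoint action. -/
lemma coact_apply (h : P.IsContraction σ T χ) (a : A) :
    P.coact (χ a) = χ.rTensor A (CalcIdeal.ad A a) := by
  refine LinearMap.congr_fun (f := P.coact.toLinearMap ∘ₗ χ) (g := χ.rTensor A ∘ₗ CalcIdeal.ad A)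
    (ext_corep fun n w _ hw l j => ?_) a
  simp only [LinearMap.comp_apply, AlgHom.toLinearMap_apply, hw.ad_apply, map_sum,
    LinearMap.rTensor_tmul]
  -- Multiplying `sum_coact` from the left by κ(w) isolates the coaction on a single χ(w_lj) and
  -- creates the factor κ(w_li) w_kj of the adjoint action.
  calc P.coact (χ (w l j))
      = ∑ k, (∑ i, (1 ⊗ₜ[ℂ] (HopfAlgebra.antipode ℂ (w l i) * w i k))) * P.coact (χ (w k j)) := by
        simp [← TensorProduct.tmul_sum, hw.antipode_mul, TensorProduct.tmul_ite, ite_mul,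
          ← Algebra.TensorProduct.one_def]
    _ = ∑ i, (1 ⊗ₜ[ℂ] HopfAlgebra.antipode ℂ (w l i)) *
          ∑ k, (1 ⊗ₜ[ℂ] w i k) * P.coact (χ (w k j)) := by
        simp only [Finset.sum_mul, Finset.mul_sum]
        rw [Finset.sum_comm]
        simp [← mul_assoc]
    _ = _ := by
        simp only [h.sum_coact w hw, Finset.mul_sum, Algebra.TensorProduct.tmul_mul_tmul, one_mul]

/-- Hermiticity of `χ`. -/
lemma star_apply (h : P.IsContraction σ T χ) (a : A) :
    star (χ a) = -χ (star (HopfAlgebra.antipode ℂ a)) := by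
  let ξ : A →ₗ[ℂ] H :=
    { toFun := fun a => star (χ (star (HopfAlgebra.antipode ℂ a)))
      map_add' := fun x y => by simp
      map_smul' := fun c x => by simp [star_smul] }
  -- Contractions in degree zero determine the coefficient map, so hermiticity of T on degree-zero
  -- families suffices.
  have key : χ = -ξ := by
    refine P.contract_injective fun b hb => ?_
    refine P.eq_of_family (f := P.contract χ) (g := P.contract (-ξ)) (fun m x v hx i => ?_) hb
    rw [h.contract_deg_zero (hx.deg i), ← star_star (T (x i)), ← h.hermitian,
      ← neg_eq_iff_eq_neg.2 (h.contract_deg_zero (P.star_mem 0 _ (hx.deg i))), hx.star.contract,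
      hx.contract, star_neg, neg_neg]
    have e1 : ∀ j, x j * (-ξ) (v j i) =
        -star (χ (star (HopfAlgebra.antipode ℂ (v j i))) * star (x j)) := fun j => by
      rw [P.star_mul_of_deg_zero_right (P.star_mem 0 _ (hx.deg j)), star_star]
      simp [ξ]
    have hx0 : ∀ j, σ (star (x j)) = star (x j) := fun j =>
      h.sign_deg_zero _ (P.star_mem 0 _ (hx.deg j))
    simp only [e1, h.mul_eq, hx0, hx.star.contract, hx.isCorep.counit_star_antipode,
      Finset.sum_neg_distrib, ← star_sum]
    rw [← star_neg]
    congr 1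
    -- Moving χ past x_j* has produced two sums. In the first, ∑_j κ(v_ji)* v_kj* is 1 or 0, and χ
    -- vanishes on both; in the second the counit leaves only the contraction of x_i*.
    rw [Finset.sum_sub_distrib]
    simp only [Matrix.of_apply, LinearMap.comp_apply, LinearMap.mulLeft_apply, ite_smul, one_smul,
      zero_smul, Finset.sum_ite_eq', Finset.mem_univ, if_true]
    rw [Finset.sum_comm]
    simp only [← Finset.mul_sum, ← map_sum, hx.isCorep.star_mul_antipode, apply_ite χ, h.apply_one,
      map_zero, ite_self, mul_zero, Finset.sum_const_zero, zero_sub, neg_neg]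
  have := LinearMap.congr_fun key a
  rw [this]
  simp [ξ]

end IsContraction

end HorizontalForms

/-- A tensor all of whose slices lie in `S` lies in the image of `S ⊗ N`. -/
lemma mem_range_rTensor_of_slices {M N : Type*} [AddCommGroup M] [Module ℂ M] [AddCommGroup N]
    [Module ℂ N] (S : Submodule ℂ M) (t : M ⊗[ℂ] N)
    (h : ∀ f : N →ₗ[ℂ] ℂ, TensorProduct.rid ℂ M (f.lTensor M t) ∈ S) :
    t ∈ LinearMap.range (S.subtype.rTensor N) := by
  classical
  let b := Module.Basis.ofVectorSpace ℂ N
  obtain ⟨d, rfl⟩ := TensorProduct.eq_repr_basis_right b t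
  refine sum_mem fun i hi => ?_
  have := h (b.coord i)
  simp only [Finsupp.sum, map_sum, LinearMap.lTensor_tmul, TensorProduct.rid_tmul,
    Module.Basis.coord_apply, Module.Basis.repr_self, Finsupp.single_apply, ite_smul, one_smul,
    zero_smul] at this
  rw [Finset.sum_ite_eq', if_pos hi] at this
  exact ⟨(⟨d i, this⟩ : S) ⊗ₜ b i, rfl⟩

lemma map_slice {M N L : Type*} [AddCommGroup M] [Module ℂ M] [AddCommGroup N]
    [Module ℂ N] [AddCommGroup L] [Module ℂ L] (X : M →ₗ[ℂ] L) (f : N →ₗ[ℂ] ℂ) (t : M ⊗[ℂ] N) :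
    X (TensorProduct.rid ℂ M (f.lTensor M t)) =
      TensorProduct.rid ℂ L (f.lTensor L (X.rTensor N t)) := by
  induction t with
  | zero => simp
  | add x y hx hy => simp only [map_add, hx, hy]
  | tmul x y => simp

/-! ### The maps χ_E and ϱ_D, and the invariance of the ideal. -/

namespace QuantumPrincipalBundle

variable {A H : Type*} [Ring A] [HopfAlgebra ℂ A] [StarRing A] [StarModule ℂ A]
    [Ring H] [Algebra ℂ H] [StarAddMonoid H] [StarModule ℂ H] {P : QuantumPrincipalBundle A H}

lemma neg_one_pow_smul_smul (n : ℕ) {M : Type*} [AddCommGroup M] [Module ℂ M] (x : M) :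
    (-1 : ℂ) ^ n • (-1 : ℂ) ^ n • x = x := by
  rw [smul_smul, ← mul_pow]; simp

lemma parity_mem_base {x : H} (hx : x ∈ P.base) : P.parity x ∈ P.base := by
  have h := P.comodule.coact_parity x
  change P.coact (P.parity x) = P.parity.toLinearMap.rTensor A (P.coact x) at h
  rw [P.mem_base] at hx ⊢
  rw [h, hx]
  rfl

/-- A degree-one antiderivation. -/
structure IsAntiderivation (P : QuantumPrincipalBundle A H) (D : H →ₗ[ℂ] H) : Prop where
  deg : ∀ n, ∀ φ ∈ P.deg n, D φ ∈ P.deg (n + 1)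
  leibniz : ∀ n, ∀ φ ∈ P.deg n, ∀ ψ, D (φ * ψ) = D φ * ψ + (-1 : ℂ) ^ n • (φ * D ψ)

lemma IsPreconnection.isAntiderivation {D : H →ₗ[ℂ] H} (h : P.IsPreconnection D) :
    P.IsAntiderivation D := ⟨h.deg, h.leibniz⟩

lemma IsVariation.isAntiderivation {D : H →ₗ[ℂ] H} (h : P.IsVariation D) :
    P.IsAntiderivation D := ⟨h.deg, h.leibniz⟩

namespace IsAntiderivation

variable {D : H →ₗ[ℂ] H}

lemma apply_mul (h : P.IsAntiderivation D) (φ ψ : H) :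
    D (φ * ψ) = D φ * ψ + P.parity φ * D ψ := by
  induction φ using P.deg_induction with
  | h n φ hφ => rw [h.leibniz n φ hφ, P.parity_of_mem hφ, smul_mul_assoc]
  | h0 => simp
  | hadd x y hx hy => simp only [add_mul, map_add, hx, hy]; abel

lemma parity_apply (h : P.IsAntiderivation D) (φ : H) : P.parity (D φ) = -D (P.parity φ) := by
  induction φ using P.deg_induction with
  | h n φ hφ =>
    rw [P.parity_of_mem hφ, P.parity_of_mem (h.deg n φ hφ), map_smul, pow_succ]
    simp
  | h0 => simp
  | hadd x y hx hy => simp only [map_add, hx, hy]; abel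

end IsAntiderivation

lemma isChi_iff {E : H →ₗ[ℂ] H} {χ : A →ₗ[ℂ] H} :
    P.IsChi E χ ↔ ∀ φ, E φ = -P.contract χ (P.parity φ) := by
  constructor
  · intro h φ
    induction φ using P.deg_induction with
    | h n φ hφ => rw [h n φ hφ, P.parity_of_mem hφ, map_smul, neg_smul]
    | h0 => simp
    | hadd x y hx hy => simp only [map_add, hx, hy]; abel
  · intro h n φ hφ
    rw [h, P.parity_of_mem hφ, map_smul, neg_smul]

lemma parity_parity (φ : H) : P.parity (P.parity φ) = φ := P.comodule.parity_parity φ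

lemma parity_deg_zero {b : H} (hb : b ∈ P.deg 0) : P.parity b = b := by
  simpa using P.parity_of_mem hb

section

variable [CompactMatrixQuantumGroup A]

/-- E vanishes on the base, and composition with the parity absorbs the sign in its Leibniz rule.
The resulting operator is left linear over the base, so `exists_contract` applies; uniqueness is
freeness. -/
lemma existsUnique_chi {E : H →ₗ[ℂ] H} (hE : P.IsVariation E) : ∃! χ, P.IsChi E χ := by
  obtain ⟨χ, hχ⟩ := P.exists_contract (-E ∘ₗ P.parity.toLinearMap) (fun x hx b hb => by
    have h1 := hE.isAntiderivation.apply_mul (P.parity x) (P.parity b)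
    rw [hE.base _ (parity_mem_base hx), zero_mul, zero_add, parity_parity] at h1
    simp [h1])
  have hχ' : P.IsChi E χ := isChi_iff.2 fun φ => by
    rw [← hχ]
    simp [parity_parity]
  refine ⟨χ, hχ', fun χ' h' => P.contract_injective fun b hb => ?_⟩
  have h1 := hχ' 0 b hb
  have h2 := h' 0 b hb
  rw [h1] at h2
  simpa using h2.symm

lemma isChi_chi {E : H →ₗ[ℂ] H} (hE : P.IsVariation E) : P.IsChi E (P.chi E) := by
  have h : ∃ χ, P.IsChi E χ := (existsUnique_chi hE).exists
  rw [chi, dif_pos h]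
  exact h.choose_spec

lemma isContraction_chi {E : H →ₗ[ℂ] H} (hE : P.IsVariation E) :
    P.IsContraction P.parity E (P.chi E) where
  sign_deg_zero _ hb := parity_deg_zero hb
  contract := isChi_iff.1 (isChi_chi hE)
  leibniz b hb φ := by rw [hE.isAntiderivation.apply_mul, parity_deg_zero hb]
  covariant := hE.covariant
  hermitian := hE.hermitian

lemma IsPreconnection.apply_mem_base {D : H →ₗ[ℂ] H} (hD : P.IsPreconnection D) {x : H}
    (hx : x ∈ P.base) : D x ∈ P.base ∧ D (D x) = 0 := by
  have h1 := hD.base ⟨x, hx⟩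
  refine ⟨h1 ▸ (P.dM ⟨x, hx⟩).2, ?_⟩
  change D x = _ at h1
  rw [h1, hD.base, P.dM_dM]
  rfl

/-- The two mixed terms cancel because D anticommutes with the parity. -/
lemma IsPreconnection.square_mul {D : H →ₗ[ℂ] H} (hD : P.IsPreconnection D) (φ ψ : H) :
    D (D (φ * ψ)) = D (D φ) * ψ + φ * D (D ψ) := by
  have h := hD.isAntiderivation
  rw [h.apply_mul, map_add, h.apply_mul, h.apply_mul, h.parity_apply, parity_parity]
  simp [add_assoc]

/-- D² is a derivation that vanishes on the base, where it is the square of d_M. Hence it is left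
linear over the base and is a contraction. -/
lemma existsUnique_rho {D : H →ₗ[ℂ] H} (hD : P.IsPreconnection D) : ∃! ρ, P.IsRho D ρ := by
  obtain ⟨χ, hχ⟩ := P.exists_contract (-(D ∘ₗ D)) (fun x hx b hb => by
    simp [hD.square_mul, (hD.apply_mem_base hx).2])
  have hχ' : P.IsRho D χ := fun φ => by
    rw [← hχ]; simp
  refine ⟨χ, hχ', fun χ' h' => P.contract_injective fun b hb => ?_⟩
  have h1 := hχ' b
  have h2 := h' b
  rw [h1] at h2
  simpa using h2.symm

lemma isRho_rho {D : H →ₗ[ℂ] H} (hD : P.IsPreconnection D) : P.IsRho D (P.rho D) := by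
  have h : ∃ χ, P.IsRho D χ := (existsUnique_rho hD).exists
  rw [rho, dif_pos h]
  exact h.choose_spec

lemma isContraction_rho {D : H →ₗ[ℂ] H} (hD : P.IsPreconnection D) :
    P.IsContraction (AlgHom.id ℂ H) (D ∘ₗ D) (P.rho D) where
  sign_deg_zero _ _ := rfl
  contract φ := isRho_rho hD φ
  leibniz b _ φ := hD.square_mul b φ
  covariant φ := by
    rw [LinearMap.comp_apply, hD.covariant, hD.covariant, LinearMap.rTensor_comp_apply]
  hermitian φ := by rw [LinearMap.comp_apply, hD.hermitian, hD.hermitian]; rfl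

lemma chi_mem_deg {E : H →ₗ[ℂ] H} (hE : P.IsVariation E) (a : A) : P.chi E a ∈ P.deg 1 :=
  P.apply_mem_deg (fun b hb => by
    rw [(isContraction_chi hE).contract_deg_zero hb]
    exact neg_mem (hE.deg 0 b hb)) a

lemma rho_mem_deg {D : H →ₗ[ℂ] H} (hD : P.IsPreconnection D) (a : A) : P.rho D a ∈ P.deg 2 :=
  P.apply_mem_deg (fun b hb => by
    rw [(isContraction_rho hD).contract_deg_zero hb]
    exact neg_mem (hD.deg 1 _ (hD.deg 0 b hb))) a

lemma chi_unique {E : H →ₗ[ℂ] H} (hE : P.IsVariation E) {χ : A →ₗ[ℂ] H} (h : P.IsChi E χ) :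
    P.chi E = χ := (existsUnique_chi hE).unique (isChi_chi hE) h

lemma contract_add (χ χ' : A →ₗ[ℂ] H) : P.contract (χ + χ') = P.contract χ + P.contract χ' := by
  simp only [HorizontalForms.contract, LinearMap.lTensor_add, LinearMap.comp_add, LinearMap.add_comp]

lemma contract_smul (c : ℂ) (χ : A →ₗ[ℂ] H) : P.contract (c • χ) = c • P.contract χ := by
  simp only [HorizontalForms.contract, LinearMap.lTensor_smul, LinearMap.comp_smul,
    LinearMap.smul_comp]

end

lemma IsVariation.add {E E' : H →ₗ[ℂ] H} (h : P.IsVariation E) (h' : P.IsVariation E') :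
    P.IsVariation (E + E') where
  deg n φ hφ := add_mem (h.deg n φ hφ) (h'.deg n φ hφ)
  covariant φ := by
    rw [LinearMap.rTensor_add, LinearMap.add_apply, map_add, h.covariant, h'.covariant]; rfl
  base φ hφ := by rw [LinearMap.add_apply, h.base φ hφ, h'.base φ hφ, add_zero]
  leibniz n φ hφ ψ := by
    simp only [LinearMap.add_apply, h.leibniz n φ hφ, h'.leibniz n φ hφ, add_mul, mul_add, smul_add]
    abel
  hermitian φ := by simp [h.hermitian, h'.hermitian]

lemma IsPreconnection.sub {D D' : H →ₗ[ℂ] H} (h : P.IsPreconnection D)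
    (h' : P.IsPreconnection D') : P.IsVariation (D - D') where
  deg n φ hφ := sub_mem (h.deg n φ hφ) (h'.deg n φ hφ)
  covariant φ := by
    rw [LinearMap.rTensor_sub, LinearMap.sub_apply, map_sub, h.covariant, h'.covariant]; rfl
  base φ hφ := by
    rw [LinearMap.sub_apply, sub_eq_zero]
    exact (h.base ⟨φ, hφ⟩).trans (h'.base ⟨φ, hφ⟩).symm
  leibniz n φ hφ ψ := by
    simp only [LinearMap.sub_apply, h.leibniz n φ hφ, h'.leibniz n φ hφ, sub_mul, mul_sub, smul_sub]
    abel
  hermitian φ := by simp [h.hermitian, h'.hermitian]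

lemma IsVariation.neg {E : H →ₗ[ℂ] H} (h : P.IsVariation E) : P.IsVariation (-E) where
  deg n φ hφ := neg_mem (h.deg n φ hφ)
  covariant φ := by
    rw [LinearMap.rTensor_neg, LinearMap.neg_apply, map_neg, h.covariant]; rfl
  base φ hφ := by rw [LinearMap.neg_apply, h.base φ hφ, neg_zero]
  leibniz n φ hφ ψ := by
    simp only [LinearMap.neg_apply, h.leibniz n φ hφ, neg_mul, mul_neg, smul_neg]
    abel
  hermitian φ := by simp [h.hermitian]

lemma IsPreconnection.add {D E : H →ₗ[ℂ] H} (h : P.IsPreconnection D)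
    (h' : P.IsVariation E) : P.IsPreconnection (D + E) where
  deg n φ hφ := add_mem (h.deg n φ hφ) (h'.deg n φ hφ)
  covariant φ := by
    rw [LinearMap.rTensor_add, LinearMap.add_apply, map_add, h.covariant, h'.covariant]; rfl
  base φ := by rw [LinearMap.add_apply, h'.base φ φ.2, add_zero, h.base]
  leibniz n φ hφ ψ := by
    simp only [LinearMap.add_apply, h.leibniz n φ hφ, h'.leibniz n φ hφ, add_mul, mul_add, smul_add]
    abel
  hermitian φ := by simp [h.hermitian, h'.hermitian]

section

variable [CompactMatrixQuantumGroup A]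

lemma chi_add {E E' : H →ₗ[ℂ] H} (h : P.IsVariation E) (h' : P.IsVariation E') :
    P.chi (E + E') = P.chi E + P.chi E' :=
  chi_unique (h.add h') (isChi_iff.2 fun φ => by
    rw [contract_add, LinearMap.add_apply, LinearMap.add_apply, isChi_iff.1 (isChi_chi h),
      isChi_iff.1 (isChi_chi h')]
    abel)

lemma chi_zero : P.chi 0 = 0 := by
  have h0 : P.IsVariation 0 :=
    ⟨by simp, by simp, by simp, by simp, by simp⟩
  simpa using chi_add h0 h0

lemma chi_neg {E : H →ₗ[ℂ] H} (h : P.IsVariation E) : P.chi (-E) = -P.chi E := by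
  have := chi_add h h.neg
  rw [add_neg_cancel, chi_zero] at this
  exact (neg_eq_of_add_eq_zero_right this.symm).symm

/-- The square of a variation in terms of `χ`. -/
lemma square_variation {E : H →ₗ[ℂ] H} (h : P.IsVariation E) (φ : H) :
    E (E φ) = -P.contract (LinearMap.mul' ℂ H ∘ₗ TensorProduct.map (P.chi E) (P.chi E) ∘ₗ
      Coalgebra.comul) φ := by
  refine LinearMap.congr_fun (f := E ∘ₗ E) (g := -P.contract (LinearMap.mul' ℂ H ∘ₗ
    TensorProduct.map (P.chi E) (P.chi E) ∘ₗ Coalgebra.comul)) ?_ φ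
  refine P.ext_family fun n m x v hx i => ?_
  have h1 := isChi_chi h (n + 1) (E (x i)) (h.deg n _ (hx.deg i))
  have h2 : P.contract (P.chi E) (E (x i)) = ∑ j, E (x j) * P.chi E (v j i) := by
    simp [HorizontalForms.contract, h.covariant, hx.coact]
  have h3 : ∀ j, E (x j) = -(-1 : ℂ) ^ n • ∑ k, x k * P.chi E (v k j) := fun j => by
    rw [isChi_chi h n (x j) (hx.deg j), hx.contract]
  rw [LinearMap.comp_apply, h1, h2, LinearMap.neg_apply, hx.contract]
  simp only [h3, LinearMap.comp_apply, hx.isCorep.comul, map_sum, TensorProduct.map_tmul,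
    LinearMap.mul'_apply, Finset.mul_sum, smul_mul_assoc, ← Finset.smul_sum, Finset.sum_mul]
  rw [smul_smul, show -(-1 : ℂ) ^ (n + 1) * -(-1) ^ n = -((-1) ^ n * (-1) ^ n) by ring, ← mul_pow,
    Finset.sum_comm]
  simp [mul_assoc]

/-- The products `∑ χ(a₁)χ(a₂)` in terms of curvatures. -/
lemma chi_conv {D E : H →ₗ[ℂ] H} (hD : P.IsPreconnection D) (hE : P.IsVariation E) (a : A) :
    (2 : ℂ) • LinearMap.mul' ℂ H (TensorProduct.map (P.chi E) (P.chi E)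
      (Coalgebra.comul (R := ℂ) a)) =
      P.rho (D + E) a + P.rho (D + -E) a - (2 : ℂ) • P.rho D a := by
  have key : (2 : ℂ) • (LinearMap.mul' ℂ H ∘ₗ TensorProduct.map (P.chi E) (P.chi E) ∘ₗ
      Coalgebra.comul) = P.rho (D + E) + P.rho (D + -E) + (-2 : ℂ) • P.rho D := by
    -- After contraction the claim is the polarization (D+E)² + (D−E)² − 2D² = 2E².
    refine P.contract_injective fun b _ => ?_
    simp only [contract_add, contract_smul, LinearMap.add_apply, LinearMap.smul_apply]
    have h1 := square_variation hE b
    have h2 := isRho_rho hD b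
    have h3 := isRho_rho (hD.add hE) b
    have h4 := isRho_rho (hD.add hE.neg) b
    rw [← neg_eq_iff_eq_neg] at h1 h2 h3 h4
    rw [← h1, ← h2, ← h3, ← h4]
    simp only [LinearMap.add_apply, LinearMap.neg_apply, map_add, map_neg]
    module
  have := LinearMap.congr_fun key a
  simp only [LinearMap.smul_apply, LinearMap.comp_apply, LinearMap.add_apply] at this
  rw [this]
  module

/-- The curvatures of D, D + E and D − E all vanish at `r`. The identity is what allows h_E to
respect the quadratic relations. -/
lemma chi_conv_eq_zero [Nonempty P.preconnections] {E : H →ₗ[ℂ] H} (hE : P.IsVariation E) {r : A}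
    (hr : r ∈ P.ideal.carrier) : LinearMap.mul' ℂ H (TensorProduct.map (P.chi E) (P.chi E)
      (Coalgebra.comul (R := ℂ) r)) = 0 := by
  obtain ⟨D, hD⟩ := ‹Nonempty P.preconnections›
  have := chi_conv hD hE r
  rw [hr.2.2 _ (IsPreconnection.add hD hE), hr.2.2 _ (IsPreconnection.add hD hE.neg), hr.2.2 _ hD]
    at this
  simpa using this

/-- Hermiticity of χ_E and ϱ_D expresses their values at κ(r)* through those at `r`. The star on
left-invariant forms is well defined for this reason. -/
lemma star_antipode_mem {r : A} (hr : r ∈ P.ideal.carrier) :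
    star (HopfAlgebra.antipode ℂ r) ∈ P.ideal.carrier := by
  refine ⟨?_, fun E hE => ?_, fun D hD => ?_⟩
  · rw [counit_star, HopfAlgebra.counit_antipode, hr.1, star_zero]
  · have := (isContraction_chi hE).star_apply r
    rw [hr.2.1 E hE, star_zero] at this
    exact neg_eq_zero.1 this.symm
  · have := (isContraction_rho hD).star_apply r
    rw [hr.2.2 D hD, star_zero] at this
    exact neg_eq_zero.1 this.symm

/-- It suffices that all slices of ad(r) lie in the ideal. By covariance, applying χ_E or ϱ_D to a
slice gives a slice of the coaction on χ_E(r) = 0 or ϱ_D(r) = 0; the counit is handled by the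
antipode axiom. -/
lemma ad_mem {r : A} (hr : r ∈ P.ideal.carrier) :
    CalcIdeal.ad A r ∈ LinearMap.range (P.ideal.carrier.subtype.rTensor A) := by
  refine mem_range_rTensor_of_slices _ _ fun f => ⟨?_, fun E hE => ?_, fun D hD => ?_⟩
  · have : (Coalgebra.counit (R := ℂ) : A →ₗ[ℂ] ℂ).rTensor A ∘ₗ CalcIdeal.ad A =
        TensorProduct.mk ℂ ℂ A 1 ∘ₗ Algebra.linearMap ℂ A ∘ₗ Coalgebra.counit := by
      refine ext_corep fun n w _ hw i j => ?_
      simp only [LinearMap.comp_apply, hw.ad_apply, map_sum, LinearMap.rTensor_tmul, hw.counit,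
        TensorProduct.ite_tmul, Finset.sum_ite_eq, Finset.mem_univ, if_true,
        ← TensorProduct.tmul_sum, hw.antipode_mul]
      by_cases h : i = j <;> simp [h]
    rw [map_slice, ← LinearMap.comp_apply (Coalgebra.counit.rTensor A), this]
    simp [show Coalgebra.counit (R := ℂ) r = 0 from hr.1]
  · rw [map_slice, ← (isContraction_chi hE).coact_apply, hr.2.1 E hE]
    simp
  · rw [map_slice, ← (isContraction_rho hD).coact_apply, hr.2.2 D hD]
    simp

end

end QuantumPrincipalBundle

/-! ### The star on left-invariant forms. -/

section ConjOp

/-- The opposite algebra with the conjugate action of the scalars. -/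
def ConjOp (T : Type*) : Type _ := Tᵐᵒᵖ

variable {M T : Type*} [AddCommGroup M] [Module ℂ M] [Ring T] [Algebra ℂ T]

instance : Ring (ConjOp T) := inferInstanceAs (Ring Tᵐᵒᵖ)
instance : Algebra ℂ (ConjOp T) := Algebra.compHom Tᵐᵒᵖ (starRingEnd ℂ)

/-- A conjugate-linear map as a linear map into the conjugate opposite algebra. -/
def toConjOp (F : M →ₛₗ[starRingEnd ℂ] T) : M →ₗ[ℂ] ConjOp T where
  toFun x := MulOpposite.op (F x)
  map_add' x y := by rw [map_add]; rfl
  map_smul' c x := by rw [map_smulₛₗ]; rfl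

/-- A linear map into the conjugate opposite algebra as a conjugate-linear map. -/
def ofConjOp (F : M →ₗ[ℂ] ConjOp T) : M →ₛₗ[starRingEnd ℂ] T where
  toFun x := MulOpposite.unop (F x)
  map_add' x y := by rw [map_add]; rfl
  map_smul' c x := by rw [map_smul]; rfl

end ConjOp

namespace CalcIdeal

variable {A : Type*} [Ring A] [HopfAlgebra ℂ A] (R : CalcIdeal A)

section Lift

variable {M : Type*} [AddCommGroup M] [Module ℂ M]

/-- Descent of a linear map to left-invariant forms. -/
def invLift (f : A →ₗ[ℂ] M) (hf : ∀ r ∈ R.carrier, f r = 0) (h1 : f 1 = 0) : R.Inv →ₗ[ℂ] M :=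
  Submodule.liftQ _ f (sup_le (fun r hr => hf r hr)
    ((Submodule.span_singleton_le_iff_mem _ _).2 h1))

lemma invLift_proj (f : A →ₗ[ℂ] M) (hf : ∀ r ∈ R.carrier, f r = 0) (h1 : f 1 = 0) (a : A) :
    R.invLift f hf h1 (R.proj a) = f a := rfl

lemma inv_ext {f g : R.Inv →ₗ[ℂ] M} (h : ∀ a, f (R.proj a) = g (R.proj a)) : f = g := by
  ext x
  obtain ⟨a, rfl⟩ := R.proj_surjective x
  exact h a

end Lift

lemma quad_corep {ι : Type*} [Fintype ι] [DecidableEq ι] {w : Matrix ι ι A} (hw : IsCorep w)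
    {T : Type*} [Ring T] [Algebra ℂ T] (f : R.Inv →ₗ[ℂ] T) (i j : ι) :
    R.quad f (w i j) = ∑ k, f (R.proj (w i k)) * f (R.proj (w k j)) := by
  simp [quad, hw.comul]

lemma lift_hom_ext {T : Type*} [Ring T] [Algebra ℂ T] {f g : R.Env →ₐ[ℂ] T}
    (h : ∀ x, f (R.incl x) = g (R.incl x)) : f = g := by
  ext x
  induction x using R.env_induction with
  | halg c => simp
  | hincl x => exact h x
  | hmul x y hx hy => rw [map_mul, map_mul, hx, hy]
  | hadd x y hx hy => rw [map_add, map_add, hx, hy]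

lemma algebraMap_mem_envDeg (c : ℂ) : algebraMap ℂ R.Env c ∈ R.envDeg 0 := by
  rw [envDeg, pow_zero]
  exact Submodule.algebraMap_mem c

lemma one_mem_envDeg : (1 : R.Env) ∈ R.envDeg 0 := by
  simpa using R.algebraMap_mem_envDeg 1

lemma incl_mem_envDeg (x : R.Inv) : R.incl x ∈ R.envDeg 1 := by
  rw [envDeg, pow_one]
  exact ⟨x, rfl⟩

lemma mul_mem_envDeg {m n : ℕ} {x y : R.Env} (hx : x ∈ R.envDeg m) (hy : y ∈ R.envDeg n) :
    x * y ∈ R.envDeg (m + n) := by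
  rw [envDeg, pow_add]
  exact Submodule.mul_mem_mul hx hy

lemma env_deg_induction {p : R.Env → Prop} (h : ∀ n, ∀ x ∈ R.envDeg n, p x)
    (hadd : ∀ x y, p x → p y → p (x + y)) (x : R.Env) : p x := by
  have htop : ∀ x : R.Env, x ∈ ⨆ n, R.envDeg n := by
    intro x
    induction x using R.env_induction with
    | halg c => exact Submodule.mem_iSup_of_mem 0 (R.algebraMap_mem_envDeg c)
    | hincl x => exact Submodule.mem_iSup_of_mem 1 (R.incl_mem_envDeg x)
    | hadd x y hx hy => exact add_mem hx hy
    | hmul x y hx hy =>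
      have h1 : (⨆ n, R.envDeg n) * (⨆ n, R.envDeg n) ≤ ⨆ n, R.envDeg n := by
        rw [Submodule.iSup_mul]
        refine iSup_le fun m => ?_
        rw [Submodule.mul_iSup]
        refine iSup_le fun n => ?_
        exact Submodule.mul_le.2 fun a ha b hb =>
          Submodule.mem_iSup_of_mem (m + n) (R.mul_mem_envDeg ha hb)
      exact h1 (Submodule.mul_mem_mul hx hy)
  exact Submodule.iSup_induction _ (motive := p) (htop x) h (h 0 0 (zero_mem _)) hadd

/-- Induction on the degree through left multiplication by one-forms. -/
lemma envDeg_induction {p : ℕ → R.Env → Prop} (halg : ∀ c : ℂ, p 0 (algebraMap ℂ _ c))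
    (hmul : ∀ n x, ∀ y ∈ R.envDeg n, p n y → p (n + 1) (R.incl x * y))
    (hadd : ∀ n x y, p n x → p n y → p n (x + y)) (n : ℕ) : ∀ x ∈ R.envDeg n, p n x := by
  induction n with
  | zero =>
    intro x hx
    rw [envDeg, pow_zero, Submodule.mem_one] at hx
    obtain ⟨c, rfl⟩ := hx
    exact halg c
  | succ n ih =>
    intro x hx
    rw [envDeg, pow_succ'] at hx
    induction hx using Submodule.mul_induction_on' with
    | mem_mul_mem a ha b hb =>
      obtain ⟨a, rfl⟩ := ha
      exact hmul n a b hb (ih b hb)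
    | add x _ y _ hx hy => exact hadd _ _ _ hx hy

lemma envParity_of_mem {n : ℕ} {x : R.Env} (hx : x ∈ R.envDeg n) :
    R.envParity x = (-1 : ℂ) ^ n • x := by
  refine R.envDeg_induction (p := fun n x => R.envParity x = (-1 : ℂ) ^ n • x)
    (fun c => by simp) (fun n x y _ h => ?_) (fun n x y hx hy => by simp [hx, hy]) n x hx
  rw [map_mul, envParity_incl, h, pow_succ]
  simp

section Star

variable [StarRing A] [StarModule ℂ A]

lemma IsEnvStar.unique {s s' : R.Env →ₛₗ[starRingEnd ℂ] R.Env} (h : R.IsEnvStar s)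
    (h' : R.IsEnvStar s') : s = s' := by
  ext x
  induction x using R.env_deg_induction with
  | hadd x y hx hy => rw [map_add, map_add, hx, hy]
  | h n x hx =>
    refine R.envDeg_induction (p := fun _ x => s x = s' x) (fun c => ?_) (fun n x y hy hyy => ?_)
      (fun n x y hx hy => by rw [map_add, map_add, hx, hy]) n x hx
    · rw [Algebra.algebraMap_eq_smul_one, map_smulₛₗ, map_smulₛₗ, h.one, h'.one]
    · obtain ⟨a, rfl⟩ := R.proj_surjective x
      rw [h.mul 1 n _ (R.incl_mem_envDeg _) y hy, h'.mul 1 n _ (R.incl_mem_envDeg _) y hy, hyy,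
        h.incl, h'.incl]

/-- The conjugate-linear map `a ↦ κ(a)*`. -/
def starAntipode (A : Type*) [Ring A] [HopfAlgebra ℂ A] [StarRing A] [StarModule ℂ A] :
    A →ₛₗ[starRingEnd ℂ] A where
  toFun a := star (HopfAlgebra.antipode ℂ a)
  map_add' x y := by simp
  map_smul' c x := by simp [star_smul]

variable [CompactMatrixQuantumGroup A]

/-- A graded-antimultiplicative map differs from an antimultiplicative one by a factor depending on
the parity. The antimultiplicative map t with t(π(a)) = i π(κ(a)*) comes from the universal property
with values in the conjugate opposite algebra; multiplying t by 1 in even and by i in odd degree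
gives the star, because i² = −1. -/
lemma exists_envStar (hR : ∀ r ∈ R.carrier, star (HopfAlgebra.antipode ℂ r) ∈ R.carrier) :
    ∃ s, R.IsEnvStar s := by
  let g : A →ₛₗ[starRingEnd ℂ] R.Env :=
    (Complex.I • (R.incl ∘ₗ R.proj)).comp (starAntipode A)
  have hg : ∀ a, g a = Complex.I • R.incl (R.proj (star (HopfAlgebra.antipode ℂ a))) :=
    fun _ => rfl
  let f : R.Inv →ₗ[ℂ] ConjOp R.Env := R.invLift (toConjOp g)
    (fun r hr => by
      change MulOpposite.op (g r) = 0
      rw [hg, R.proj_of_mem (hR r hr)]; simp)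
    (by
      change MulOpposite.op (g 1) = 0
      rw [hg, HopfAlgebra.antipode_one, star_one, R.proj_one]; simp)
  -- The map a ↦ κ(a)* reverses neither leg order once the product is opposite, so the relation of r
  -- goes to that of κ(r)*, with the sign i² = −1.
  have hquad : R.quad f = toConjOp ((-(R.quad R.incl)).comp (starAntipode A)) := by
    refine ext_corep fun n w _ hw i j => ?_
    rw [R.quad_corep hw]
    have e : ∀ a b, f (R.proj a) * f (R.proj b) = MulOpposite.op (g b * g a) := fun _ _ => rfl
    have e2 : ∀ a, toConjOp ((-(R.quad R.incl)).comp (starAntipode A)) a =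
      MulOpposite.op (-(R.quad R.incl) (star (HopfAlgebra.antipode ℂ a))) := fun _ => rfl
    rw [e2]
    simp only [e, quad, LinearMap.comp_apply, hw.comul_star_antipode, map_sum,
      TensorProduct.map_tmul, LinearMap.mul'_apply, hg]
    rw [← Finset.sum_neg_distrib]
    refine Eq.trans ?_ (Finset.op_sum (s := Finset.univ) _).symm
    refine Finset.sum_congr rfl fun k _ => congrArg _ ?_
    rw [smul_mul_smul_comm, Complex.I_mul_I]
    simp
  let t := ofConjOp (R.lift f fun r hr => by
    rw [hquad]
    change MulOpposite.op (-(R.quad R.incl) (star (HopfAlgebra.antipode ℂ r))) = 0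
    rw [R.quad_incl (hR r hr)]; simp).toLinearMap
  have ht1 : t 1 = 1 := by
    change MulOpposite.unop (R.lift f _ 1) = 1
    rw [map_one]; rfl
  have htmul : ∀ x y, t (x * y) = t y * t x := fun x y => by
    change MulOpposite.unop (R.lift f _ (x * y)) = _
    rw [map_mul]; rfl
  have htincl : ∀ a, t (R.incl (R.proj a)) =
      Complex.I • R.incl (R.proj (star (HopfAlgebra.antipode ℂ a))) := fun a => by
    change MulOpposite.unop (R.lift f _ (R.incl (R.proj a))) = _
    rw [lift_incl]; rfl
  have htdeg : ∀ n, ∀ x ∈ R.envDeg n, R.envParity (t x) = (-1 : ℂ) ^ n • t x := by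
    refine R.envDeg_induction (fun c => ?_) (fun n x y _ h => ?_) (fun n x y hx hy => ?_)
    · rw [Algebra.algebraMap_eq_smul_one, map_smulₛₗ, ht1]; simp
    · obtain ⟨a, rfl⟩ := R.proj_surjective x
      rw [htmul, map_mul, h, htincl, map_smul, envParity_incl, pow_succ]
      simp only [smul_mul_assoc, mul_smul_comm, smul_neg, mul_neg, mul_one, neg_smul]
      rw [smul_comm]
    · simp only [map_add, hx, hy, smul_add]
  -- The coefficients (1 ± i)/2 combine the identity and the parity into multiplication by 1 on even
  -- and by i on odd elements.
  let s : R.Env →ₛₗ[starRingEnd ℂ] R.Env :=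
    (((1 + Complex.I) / 2) • LinearMap.id + ((1 - Complex.I) / 2) • R.envParity.toLinearMap).comp t
  have hs : ∀ x, s x = ((1 + Complex.I) / 2) • t x + ((1 - Complex.I) / 2) • R.envParity (t x) :=
    fun _ => rfl
  have hsdeg : ∀ n, ∀ x ∈ R.envDeg n, s x =
      ((1 + Complex.I) / 2 + (1 - Complex.I) / 2 * (-1) ^ n) • t x := fun n x hx => by
    rw [hs, htdeg n x hx]; module
  refine ⟨s, ⟨?_, fun a => ?_, fun m n x hx y hy => ?_⟩⟩
  · rw [hs, ht1, map_one, ← add_smul, show (1 + Complex.I) / 2 + (1 - Complex.I) / 2 = 1 by ring,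
      one_smul]
  · rw [hsdeg 1 _ (R.incl_mem_envDeg _), htincl, smul_smul, ← neg_one_smul ℂ]
    congr 1
    linear_combination Complex.I_mul_I
  · rw [hsdeg _ _ (R.mul_mem_envDeg hx hy), hsdeg m x hx, hsdeg n y hy, htmul, smul_mul_smul_comm,
      smul_smul]
    congr 1
    rcases Nat.even_or_odd m with hm | hm <;> rcases Nat.even_or_odd n with hn | hn
    · rw [(hm.add hn).neg_one_pow, hm.neg_one_pow, hn.neg_one_pow, (hm.mul_right n).neg_one_pow]
      ring
    · rw [(hm.add_odd hn).neg_one_pow, hm.neg_one_pow, hn.neg_one_pow, (hm.mul_right n).neg_one_pow]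
      ring
    · rw [(hm.add_even hn).neg_one_pow, hm.neg_one_pow, hn.neg_one_pow, (hn.mul_left m).neg_one_pow]
      ring
    · rw [(hm.add_odd hn).neg_one_pow, hm.neg_one_pow, hn.neg_one_pow, (hm.mul hn).neg_one_pow]
      linear_combination Complex.I_mul_I

lemma isEnvStar_envStar (hR : ∀ r ∈ R.carrier, star (HopfAlgebra.antipode ℂ r) ∈ R.carrier) :
    R.IsEnvStar R.envStar := by
  have h := R.exists_envStar hR
  rw [envStar, dif_pos h]
  exact h.choose_spec

end Star

end CalcIdeal

/-! ### The universal property of the smash product. -/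

namespace Smash

variable {A H : Type*} [Ring A] [HopfAlgebra ℂ A] [Ring H] [Algebra ℂ H]
  (X : ComoduleAlgebra A H) (R : CalcIdeal A)

lemma tmul_mul_tmul (ψ φ : H) (η ϑ : R.Env) : tmul X R ψ η * tmul X R φ ϑ =
    ofTensor X R (outer R ψ ϑ (swap X R (η ⊗ₜ φ))) :=
  congrArg (ofTensor X R) (mulMap_tmul X R ψ φ η ϑ)

/-- The inclusion of the first factor. -/
def inl : H →ₐ[ℂ] Smash X R :=
  AlgHom.ofLinearMap ((ofTensor X R).toLinearMap ∘ₗ (TensorProduct.mk ℂ H R.Env).flip 1) rfl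
    (fun x y => by
      change tmul X R (x * y) 1 = tmul X R x 1 * tmul X R y 1
      rw [tmul_mul_tmul, swap_one_left, outer_tmul, mul_one]; rfl)

/-- The inclusion of the second factor. -/
def inr : R.Env →ₐ[ℂ] Smash X R :=
  AlgHom.ofLinearMap ((ofTensor X R).toLinearMap ∘ₗ TensorProduct.mk ℂ H R.Env 1) rfl
    (fun x y => by
      change tmul X R 1 (x * y) = tmul X R 1 x * tmul X R 1 y
      rw [tmul_mul_tmul, swap_one_right, outer_tmul, mul_one]; rfl)

lemma inl_apply (x : H) : inl X R x = tmul X R x 1 := rfl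
lemma inr_apply (x : R.Env) : inr X R x = tmul X R 1 x := rfl

lemma inl_mul_inr (x : H) (y : R.Env) : inl X R x * inr X R y = tmul X R x y := by
  rw [inl_apply, inr_apply, tmul_mul_tmul, swap_one_left, outer_tmul, mul_one, one_mul]; rfl

lemma induction {p : Smash X R → Prop} (h : ∀ x y, p (inl X R x * inr X R y))
    (hadd : ∀ x y, p x → p y → p (x + y)) (x : Smash X R) : p x := by
  refine TensorProduct.induction_on (motive := fun t => p (ofTensor X R t)) x ?_
    (fun a b => ?_) (fun a b ha hb => ?_)
  · have := h 0 0
    rwa [map_zero, zero_mul] at this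
  · have := h a b
    rwa [inl_mul_inr] at this
  · rw [map_add]; exact hadd _ _ ha hb

lemma inr_mul_inl (η : R.Env) (φ : H) :
    inr X R η * inl X R φ = ofTensor X R (swap X R (η ⊗ₜ φ)) := by
  rw [inl_apply, inr_apply, tmul_mul_tmul]
  congr 1
  generalize swap X R (η ⊗ₜ φ) = t
  induction t with
  | zero => simp
  | add x y hx hy => rw [map_add, hx, hy]
  | tmul x y => rw [outer_tmul, one_mul, mul_one]

lemma swap_incl (x : R.Inv) (φ : H) : swap X R (R.incl x ⊗ₜ φ) =
    (R.incl ∘ₗ R.circ x).lTensor H (X.coact (X.parity φ)) := by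
  have hk : koszul R.envParity.toLinearMap X.parity.toLinearMap (R.incl x ⊗ₜ[ℂ] φ) =
      R.incl x ⊗ₜ X.parity φ := by
    simp only [koszul, LinearMap.smul_apply, LinearMap.add_apply, LinearMap.sub_apply,
      TensorProduct.map_tmul, LinearMap.id_apply, AlgHom.toLinearMap_apply, R.envParity_incl,
      TensorProduct.neg_tmul]
    module
  simp only [swap, LinearMap.comp_apply, hk, LinearMap.lTensor_tmul, AlgHom.toLinearMap_apply]
  generalize X.coact (X.parity φ) = t
  induction t with
  | zero => simp
  | tmul a b => simp [R.circEnv_incl]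
  | add a b ha hb => simp only [TensorProduct.tmul_add, map_add, ha, hb]

/-- The exchange rule for one-forms. -/
lemma inr_incl_mul_inl (x : R.Inv) (φ : H) : inr X R (R.incl x) * inl X R φ =
    LinearMap.mul' ℂ _ (TensorProduct.map (inl X R).toLinearMap
      ((inr X R).toLinearMap ∘ₗ R.incl ∘ₗ R.circ x) (X.coact (X.parity φ))) := by
  rw [inr_mul_inl, swap_incl]
  generalize X.coact (X.parity φ) = t
  induction t with
  | zero => simp
  | tmul a b => simp [inl_mul_inr, ofTensor_tmul]
  | add a b ha hb => simp only [map_add, ha, hb]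

section Lift

variable {X R} {T : Type*} [Ring T] [Algebra ℂ T] (f : H →ₐ[ℂ] T) (g : R.Env →ₐ[ℂ] T)

/-- The map `φ ⊗ η ↦ f(φ)g(η)`. -/
def liftLin : H ⊗[ℂ] R.Env →ₗ[ℂ] T :=
  LinearMap.mul' ℂ T ∘ₗ TensorProduct.map f.toLinearMap g.toLinearMap

variable (X) in
/-- The exchange rule for a pair of homomorphisms, on one-forms. -/
def Exchange : Prop := ∀ x φ, g (R.incl x) * f φ =
  LinearMap.mul' ℂ T (TensorProduct.map f.toLinearMap (g.toLinearMap ∘ₗ R.incl ∘ₗ R.circ x)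
    (X.coact (X.parity φ)))

variable {f g}

lemma liftLin_outer (ψ : H) (ϑ : R.Env) (t : H ⊗[ℂ] R.Env) :
    liftLin f g (outer R ψ ϑ t) = f ψ * liftLin f g t * g ϑ := by
  induction t with
  | zero => simp
  | add x y hx hy => simp only [map_add, hx, hy, mul_add, add_mul]
  | tmul x y => simp [outer_tmul, liftLin, mul_assoc]

/-- The exchange rule is assumed on one-forms only. It spreads to all η because these generate and
`swap_mul` describes the exchange with a product as two successive exchanges. -/
lemma Exchange.liftLin_swap (h : Exchange X f g) (η : R.Env) (φ : H) :
    liftLin f g (swap X R (η ⊗ₜ φ)) = g η * f φ := by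
  induction η using R.env_induction generalizing φ with
  | halg c =>
    rw [Algebra.algebraMap_eq_smul_one, ← TensorProduct.smul_tmul', map_smul, swap_one_left,
      map_smul, map_smul, map_one, smul_mul_assoc, one_mul]
    simp [liftLin]
  | hincl x =>
    rw [h x φ, swap_incl]
    generalize X.coact (X.parity φ) = t
    induction t with
    | zero => simp
    | tmul a b => simp [liftLin]
    | add a b ha hb => simp only [map_add, ha, hb]
  | hadd x y hx hy => simp only [TensorProduct.add_tmul, map_add, hx, hy, add_mul]
  | hmul x y hx hy =>
    rw [swap_mul, map_mul, mul_assoc, ← hy]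
    generalize swap X R (y ⊗ₜ φ) = t
    induction t with
    | zero => simp
    | add a b ha hb => simp only [TensorProduct.tmul_add, map_add, ha, hb, mul_add]
    | tmul a b =>
      rw [mulMap_tmul, liftLin_outer, hx]
      simp [liftLin, mul_assoc]

lemma Exchange.liftLin_mulMap (h : Exchange X f g) (s t : H ⊗[ℂ] R.Env) :
    liftLin f g (mulMap X R (s ⊗ₜ t)) = liftLin f g s * liftLin f g t := by
  induction s with
  | zero => simp
  | add a b ha hb => simp only [TensorProduct.add_tmul, map_add, add_mul, ha, hb]
  | tmul a b =>
    induction t with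
    | zero => simp
    | add a b ha hb => simp only [TensorProduct.tmul_add, map_add, mul_add, ha, hb]
    | tmul c d =>
      rw [mulMap_tmul, liftLin_outer, h.liftLin_swap]
      simp [liftLin, mul_assoc]

/-- The universal property of the smash product. -/
def liftHom (h : Exchange X f g) : Smash X R →ₐ[ℂ] T :=
  AlgHom.ofLinearMap (liftLin f g ∘ₗ (ofTensor X R).symm.toLinearMap)
    (by
      change liftLin f g (1 ⊗ₜ 1) = 1
      simp [liftLin])
    (fun x y => h.liftLin_mulMap x y)

lemma liftHom_inl (h : Exchange X f g) (x : H) : liftHom h (inl X R x) = f x := by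
  change liftLin f g (x ⊗ₜ 1) = _
  simp [liftLin]

lemma liftHom_inr (h : Exchange X f g) (x : R.Env) : liftHom h (inr X R x) = g x := by
  change liftLin f g (1 ⊗ₜ x) = _
  simp [liftLin]

lemma hom_ext {F G : Smash X R →ₐ[ℂ] T} (h1 : ∀ x, F (inl X R x) = G (inl X R x))
    (h2 : ∀ x, F (inr X R (R.incl x)) = G (inr X R (R.incl x))) : F = G := by
  have h3 : F.comp (inr X R) = G.comp (inr X R) := R.lift_hom_ext h2
  ext x
  induction x using Smash.induction X R with
  | h x y =>
    rw [map_mul, map_mul, h1]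
    congr 1
    exact AlgHom.congr_fun h3 y
  | hadd x y hx hy => rw [map_add, map_add, hx, hy]

end Lift

end Smash

/-! ### The graded tensor product and the map ϖ̂. -/

namespace CalcIdeal

variable {A : Type*} [Ring A] [HopfAlgebra ℂ A] (R : CalcIdeal A)

/-- The bilinear map underlying the product of the graded tensor product. -/
def gradedMulLin : R.Env ⊗[ℂ] R.Full →ₗ[ℂ] R.Env ⊗[ℂ] R.Full →ₗ[ℂ] R.Env ⊗[ℂ] R.Full :=
  TensorProduct.curry (LinearMap.mul' ℂ (R.Env ⊗[ℂ] R.Full) ∘ₗ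
    koszul (R.fullParity.lTensor R.Env) (R.envParity.toLinearMap.rTensor R.Full))

lemma gradedMulLin_tmul (w u : R.Env) (α β : R.Full) :
    R.gradedMulLin (w ⊗ₜ α) (u ⊗ₜ β) = (1 / 2 : ℂ) • ((w * u) ⊗ₜ (α * β) +
      (w * u) ⊗ₜ (R.fullParity α * β) + (w * R.envParity u) ⊗ₜ (α * β) -
      (w * R.envParity u) ⊗ₜ (R.fullParity α * β)) := by
  simp [gradedMulLin, koszul]

lemma fullParity_tmul (a : A) (x : R.Env) :
    R.fullParity (Smash.tmul _ R a x) = Smash.tmul _ R a (R.envParity x) := rfl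

lemma fullParity_ofA (a : A) : R.fullParity (R.ofA a) = R.ofA a := by
  change Smash.tmul _ R a (R.envParity 1) = _
  rw [map_one]; rfl

lemma fullParity_mul (α β : R.Full) : R.fullParity (α * β) = R.fullParity α * R.fullParity β := by
  induction α using Smash.induction with
  | hadd x y hx hy => simp only [add_mul, map_add, hx, hy]
  | h b η =>
  induction β using Smash.induction with
  | hadd x y hx hy => simp only [mul_add, map_add, hx, hy]
  | h a ϑ =>
  simp only [Smash.inl_mul_inr, fullParity_tmul, Smash.tmul_mul_tmul]
  have e : ∀ η : R.Env, Smash.swap (ComoduleAlgebra.self A) R (η ⊗ₜ a) =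
      (R.circEnv η).lTensor A (Coalgebra.comul a) := fun η => Smash.good_even rfl η
  rw [e, e]
  generalize (Coalgebra.comul (R := ℂ) a) = t
  induction t with
  | zero => simp
  | add x y hx hy => simp only [map_add, hx, hy]
  | tmul x y =>
    simp only [LinearMap.lTensor_tmul, Smash.outer_tmul, Smash.ofTensor_tmul, fullParity_tmul,
      map_mul, R.envParity_circEnv]

lemma fullParity_fullParity (α : R.Full) : R.fullParity (R.fullParity α) = α := by
  induction α using Smash.induction with
  | hadd x y hx hy => simp only [map_add, hx, hy]
  | h b η => simp only [Smash.inl_mul_inr, fullParity_tmul, R.envParity_envParity]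

/-- The Koszul sign is a combination of parity operators, and both parities are multiplicative and
involutive. Expanding both sides on decomposable tensors therefore gives the same combination. -/
lemma gradedMulLin_assoc (x y z : R.Env ⊗[ℂ] R.Full) :
    R.gradedMulLin (R.gradedMulLin x y) z = R.gradedMulLin x (R.gradedMulLin y z) := by
  induction x with
  | zero => simp
  | add a b ha hb => simp only [map_add, LinearMap.add_apply, ha, hb]
  | tmul w α =>
  induction y with
  | zero => simp
  | add a b ha hb => simp only [map_add, LinearMap.add_apply, ha, hb]
  | tmul u β =>
  induction z with
  | zero => simp
  | add a b ha hb => simp only [map_add, ha, hb]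
  | tmul v γ =>
  simp only [gradedMulLin_tmul, map_smul, map_add, map_sub, LinearMap.smul_apply,
    LinearMap.add_apply, LinearMap.sub_apply, fullParity_mul, fullParity_fullParity, map_mul,
    R.envParity_envParity, mul_assoc]
  module

lemma gradedMulLin_one (x : R.Env ⊗[ℂ] R.Full) : R.gradedMulLin x 1 = x := by
  induction x with
  | zero => simp
  | add a b ha hb => simp only [map_add, LinearMap.add_apply, ha, hb]
  | tmul w α =>
    rw [Algebra.TensorProduct.one_def, gradedMulLin_tmul]
    simp only [map_one, mul_one]
    module

lemma one_gradedMulLin (x : R.Env ⊗[ℂ] R.Full) : R.gradedMulLin 1 x = x := by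
  induction x with
  | zero => simp
  | add a b ha hb => simp only [map_add, ha, hb]
  | tmul w α =>
    have : R.fullParity 1 = 1 := by
      change Smash.tmul _ R 1 (R.envParity 1) = _
      rw [map_one]; rfl
    rw [Algebra.TensorProduct.one_def, gradedMulLin_tmul]
    simp only [this, one_mul]
    module

lemma gradedMulLin_even {w u : R.Env} {α β : R.Full} (h : R.fullParity α = α) :
    R.gradedMulLin (w ⊗ₜ α) (u ⊗ₜ β) = (w * u) ⊗ₜ (α * β) := by
  rw [gradedMulLin_tmul, h]; module

lemma gradedMulLin_odd {w u : R.Env} {α β : R.Full} (h : R.fullParity α = -α) :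
    R.gradedMulLin (w ⊗ₜ α) (u ⊗ₜ β) = (w * R.envParity u) ⊗ₜ (α * β) := by
  rw [gradedMulLin_tmul, h]; simp only [neg_mul, TensorProduct.tmul_neg]; module

lemma IsAdHat.unique {w w' : R.Env →ₗ[ℂ] R.Env ⊗[ℂ] R.Full} (h : R.IsAdHat w)
    (h' : R.IsAdHat w') : w = w' := by
  ext x
  induction x using R.env_induction with
  | halg c => rw [Algebra.algebraMap_eq_smul_one, map_smul, map_smul, h.one, h'.one]
  | hincl x =>
    obtain ⟨a, rfl⟩ := R.proj_surjective x
    rw [h.incl, h'.incl]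
  | hmul x y hx hy => rw [h.mul, h'.mul, hx, hy]
  | hadd x y hx hy => rw [map_add, map_add, hx, hy]

end CalcIdeal

lemma IsCorep.comul_antipode_mul {A : Type*} [Ring A] [HopfAlgebra ℂ A] {ι : Type*} [Fintype ι]
    [DecidableEq ι] {w : Matrix ι ι A} (hw : IsCorep w) (k r s j : ι) :
    Coalgebra.comul (R := ℂ) (HopfAlgebra.antipode ℂ (w k r) * w s j) =
      ∑ t, ∑ u, (HopfAlgebra.antipode ℂ (w t r) * w s u) ⊗ₜ[ℂ]
        (HopfAlgebra.antipode ℂ (w k t) * w u j) := by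
  rw [Bialgebra.comul_mul, hw.comul_antipode, hw.comul]
  simp [Finset.sum_mul_sum]

lemma ad_one (A : Type*) [Ring A] [HopfAlgebra ℂ A] : CalcIdeal.ad A 1 = 1 ⊗ₜ 1 := by
  simp [CalcIdeal.ad, Bialgebra.comul_one, Algebra.TensorProduct.one_def, HopfAlgebra.antipode_one]

namespace CalcIdeal

variable {A : Type*} [Ring A] [HopfAlgebra ℂ A] (R : CalcIdeal A)

/-- The antipode axiom contracts the product of w_ik with κ(w_kr), while the counit term of the
action keeps only k = i. This is the computation behind moving one-forms past ad-covariant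
coefficients. -/
lemma sum_circ {ι : Type*} [Fintype ι] [DecidableEq ι] {w : Matrix ι ι A} (hw : IsCorep w)
    (i r s j : ι) :
    ∑ k, R.circ (R.proj (w i k)) (HopfAlgebra.antipode ℂ (w k r) * w s j) =
      (if i = r then R.proj (w s j) else 0) -
        R.proj (HopfAlgebra.antipode ℂ (w i r) * w s j) := by
  simp only [circ_proj, hw.counit, ite_smul, one_smul, zero_smul, Finset.sum_sub_distrib,
    Finset.sum_ite_eq, Finset.mem_univ, if_true, ← map_sum, ← mul_assoc, ← Finset.sum_mul,
    hw.mul_antipode]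
  split_ifs <;> simp

/-- The ideal is invariant under the adjoint coaction. -/
def IsAdInvariant : Prop :=
  ∀ r ∈ R.carrier, CalcIdeal.ad A r ∈ LinearMap.range (R.carrier.subtype.rTensor A)

variable {R}

lemma IsAdInvariant.map_ad (h : R.IsAdInvariant) {M N : Type*} [AddCommGroup M] [Module ℂ M]
    [AddCommGroup N] [Module ℂ N] {f : A →ₗ[ℂ] M} (hf : ∀ r ∈ R.carrier, f r = 0) (g : A →ₗ[ℂ] N)
    {r : A} (hr : r ∈ R.carrier) : TensorProduct.map f g (CalcIdeal.ad A r) = 0 := by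
  obtain ⟨t, ht⟩ := h r hr
  rw [← ht]
  clear ht
  induction t with
  | zero => simp
  | add a b ha hb => simp only [map_add, ha, hb, add_zero]
  | tmul a b => simp [hf a a.2]

variable (R)

/-- One-forms `π(a)` in the envelope. -/
def theta : A →ₗ[ℂ] R.Full := (Smash.inr (ComoduleAlgebra.self A) R).toLinearMap ∘ₗ R.incl ∘ₗ R.proj

lemma theta_of_mem {r : A} (hr : r ∈ R.carrier) : R.theta r = 0 := by
  simp [theta, R.proj_of_mem hr]

lemma theta_one : R.theta 1 = 0 := by
  simp [theta, R.proj_one]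

lemma fullParity_theta (a : A) : R.fullParity (R.theta a) = -R.theta a := by
  change R.fullParity (Smash.tmul _ R 1 (R.incl (R.proj a))) =
    -(Smash.inr _ R (R.incl (R.proj a)))
  rw [fullParity_tmul, envParity_incl]
  exact map_neg (Smash.inr (ComoduleAlgebra.self A) R) _

lemma ofA_mul (a b : A) : R.ofA (a * b) = R.ofA a * R.ofA b :=
  map_mul (Smash.inl (ComoduleAlgebra.self A) R) a b

lemma ofA_one : R.ofA 1 = 1 := rfl

/-- `c ↦ ∑ c₁ π(c₂)`. -/
def dA : A →ₗ[ℂ] R.Full :=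
  LinearMap.mul' ℂ R.Full ∘ₗ TensorProduct.map R.ofA R.theta ∘ₗ Coalgebra.comul

/-- Exchange of π(w_ik) with the coefficient, followed by `sum_circ` in the last legs. The first
term on the right cancels a mixed term of ϖ̂(π(w_ik)) ϖ̂(π(w_kj)). -/
lemma sum_theta_mul_ofA {ι : Type*} [Fintype ι] [DecidableEq ι] {w : Matrix ι ι A}
    (hw : IsCorep w) (i r s j : ι) :
    ∑ k, R.theta (w i k) * R.ofA (HopfAlgebra.antipode ℂ (w k r) * w s j) =
      ∑ u, R.ofA (HopfAlgebra.antipode ℂ (w i r) * w s u) * R.theta (w u j) -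
        R.dA (HopfAlgebra.antipode ℂ (w i r) * w s j) := by
  have h1 : ∀ (x : A) (c : A), R.theta x * R.ofA c = LinearMap.mul' ℂ R.Full
      (TensorProduct.map R.ofA ((Smash.inr (ComoduleAlgebra.self A) R).toLinearMap ∘ₗ R.incl ∘ₗ
        R.circ (R.proj x)) (Coalgebra.comul c)) := fun x c =>
    Smash.inr_incl_mul_inl (ComoduleAlgebra.self A) R (R.proj x) c
  simp only [h1, dA, LinearMap.comp_apply, hw.comul_antipode_mul, map_sum,
    TensorProduct.map_tmul, LinearMap.mul'_apply, AlgHom.toLinearMap_apply]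
  rw [Finset.sum_comm]
  have h2 : ∀ t : ι, (∑ k, ∑ u, R.ofA (HopfAlgebra.antipode ℂ (w t r) * w s u) *
      Smash.inr (ComoduleAlgebra.self A) R (R.incl (R.circ (R.proj (w i k))
        (HopfAlgebra.antipode ℂ (w k t) * w u j)))) =
      (if i = t then ∑ u, R.ofA (HopfAlgebra.antipode ℂ (w t r) * w s u) * R.theta (w u j) else 0) -
      ∑ u, R.ofA (HopfAlgebra.antipode ℂ (w t r) * w s u) *
        R.theta (HopfAlgebra.antipode ℂ (w i t) * w u j) := by
    intro t
    rw [Finset.sum_comm]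
    simp only [← Finset.mul_sum, ← map_sum, R.sum_circ hw]
    by_cases h : i = t <;> simp [h, theta, mul_sub, Finset.sum_sub_distrib]
  simp only [h2, Finset.sum_sub_distrib]
  simp

variable {R}

/-- The map `π(a) ↦ ϖ(π(a)) + 1 ⊗ π(a)` on left-invariant one-forms. -/
def IsAdInvariant.adOne (h : R.IsAdInvariant) : R.Inv →ₗ[ℂ] R.Env ⊗[ℂ] R.Full :=
  R.invLift (TensorProduct.map (R.incl ∘ₗ R.proj) R.ofA ∘ₗ CalcIdeal.ad A +
      TensorProduct.mk ℂ R.Env R.Full 1 ∘ₗ R.theta)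
    (fun r hr => by
      simp only [LinearMap.add_apply, LinearMap.comp_apply, R.theta_of_mem hr, map_zero, add_zero]
      exact h.map_ad (fun r hr => by simp [R.proj_of_mem hr]) _ hr)
    (by simp [ad_one, R.proj_one, R.theta_one])

lemma IsAdInvariant.adOne_proj (h : R.IsAdInvariant) (a : A) : h.adOne (R.proj a) =
    TensorProduct.map (R.incl ∘ₗ R.proj) R.ofA (CalcIdeal.ad A a) + 1 ⊗ₜ R.theta a := rfl

/-- The two mixed products have opposite signs, since one-forms are odd, and `sum_theta_mul_ofA`
leaves only the term with `dA`. Each of the three terms on the right dies on an ad-invariant ideal,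
so the quadratic relations are respected. -/
lemma IsAdInvariant.sum_gradedMul_adOne (h : R.IsAdInvariant) {n : ℕ}
    {w : Matrix (Fin n) (Fin n) A} (hw : IsCorep w) (i j : Fin n) :
    ∑ k, R.gradedMulLin (h.adOne (R.proj (w i k))) (h.adOne (R.proj (w k j))) =
      TensorProduct.map (R.quad R.incl) R.ofA (CalcIdeal.ad A (w i j)) +
      TensorProduct.map (R.incl ∘ₗ R.proj) R.dA (CalcIdeal.ad A (w i j)) +
      1 ⊗ₜ ∑ k, R.theta (w i k) * R.theta (w k j) := by
  have ev : ∀ (x y : R.Env) (a : A) (β : R.Full),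
      R.gradedMulLin (x ⊗ₜ R.ofA a) (y ⊗ₜ β) = (x * y) ⊗ₜ (R.ofA a * β) := fun x y a β =>
    R.gradedMulLin_even (R.fullParity_ofA a)
  have od : ∀ (x y : R.Env) (a : A) (β : R.Full),
      R.gradedMulLin (x ⊗ₜ R.theta a) (y ⊗ₜ β) = (x * R.envParity y) ⊗ₜ (R.theta a * β) :=
    fun x y a β => R.gradedMulLin_odd (R.fullParity_theta a)
  have h1 : ∑ k, R.gradedMulLin
      (TensorProduct.map (R.incl ∘ₗ R.proj) R.ofA (CalcIdeal.ad A (w i k)))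
      (TensorProduct.map (R.incl ∘ₗ R.proj) R.ofA (CalcIdeal.ad A (w k j))) =
      TensorProduct.map (R.quad R.incl) R.ofA (CalcIdeal.ad A (w i j)) := by
    simp only [hw.ad_apply, map_sum, LinearMap.sum_apply, TensorProduct.map_tmul,
      LinearMap.comp_apply, ev, ← R.ofA_mul, R.quad_corep hw, TensorProduct.sum_tmul]
    calc ∑ k, ∑ p, ∑ s, ∑ q, ∑ r, (R.incl (R.proj (w q r)) * R.incl (R.proj (w p s))) ⊗ₜ[ℂ]
          R.ofA (HopfAlgebra.antipode ℂ (w i q) * w r k * (HopfAlgebra.antipode ℂ (w k p) * w s j))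
        = ∑ p, ∑ s, ∑ q, ∑ r, (R.incl (R.proj (w q r)) * R.incl (R.proj (w p s))) ⊗ₜ[ℂ]
          R.ofA (HopfAlgebra.antipode ℂ (w i q) *
            ((∑ k, w r k * HopfAlgebra.antipode ℂ (w k p)) * w s j)) := by
          simp only [Finset.sum_mul, Finset.mul_sum, map_sum, TensorProduct.tmul_sum, mul_assoc]
          rw [Finset.sum_comm]
          refine Finset.sum_congr rfl fun p _ => ?_
          rw [Finset.sum_comm]
          refine Finset.sum_congr rfl fun s _ => ?_
          rw [Finset.sum_comm]
          refine Finset.sum_congr rfl fun q _ => ?_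
          rw [Finset.sum_comm]
      _ = ∑ p, ∑ s, ∑ q, (R.incl (R.proj (w q p)) * R.incl (R.proj (w p s))) ⊗ₜ[ℂ]
          R.ofA (HopfAlgebra.antipode ℂ (w i q) * w s j) := by
          simp [hw.mul_antipode, ite_mul, apply_ite]
      _ = _ := by
          calc _ = ∑ p, ∑ q, ∑ s, (R.incl (R.proj (w q p)) * R.incl (R.proj (w p s))) ⊗ₜ[ℂ]
                R.ofA (HopfAlgebra.antipode ℂ (w i q) * w s j) :=
                Finset.sum_congr rfl fun p _ => Finset.sum_comm
            _ = ∑ q, ∑ p, ∑ s, (R.incl (R.proj (w q p)) * R.incl (R.proj (w p s))) ⊗ₜ[ℂ]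
                R.ofA (HopfAlgebra.antipode ℂ (w i q) * w s j) := Finset.sum_comm
            _ = _ := Finset.sum_congr rfl fun q _ => Finset.sum_comm
  have h2 : ∑ k, R.gradedMulLin
      (TensorProduct.map (R.incl ∘ₗ R.proj) R.ofA (CalcIdeal.ad A (w i k)))
      (1 ⊗ₜ R.theta (w k j)) = ∑ p, ∑ q, R.incl (R.proj (w p q)) ⊗ₜ[ℂ]
        ∑ k, R.ofA (HopfAlgebra.antipode ℂ (w i p) * w q k) * R.theta (w k j) := by
    simp only [hw.ad_apply, map_sum, LinearMap.sum_apply, TensorProduct.map_tmul,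
      LinearMap.comp_apply, ev, mul_one, TensorProduct.tmul_sum]
    rw [Finset.sum_comm]
    exact Finset.sum_congr rfl fun p _ => Finset.sum_comm
  have h3 : ∑ k, R.gradedMulLin (1 ⊗ₜ R.theta (w i k))
      (TensorProduct.map (R.incl ∘ₗ R.proj) R.ofA (CalcIdeal.ad A (w k j))) =
      -∑ p, ∑ q, R.incl (R.proj (w p q)) ⊗ₜ[ℂ]
        ∑ k, R.theta (w i k) * R.ofA (HopfAlgebra.antipode ℂ (w k p) * w q j) := by
    simp only [hw.ad_apply, map_sum, TensorProduct.map_tmul,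
      LinearMap.comp_apply, od, one_mul, TensorProduct.tmul_sum, envParity_incl,
      TensorProduct.neg_tmul, Finset.sum_neg_distrib]
    rw [Finset.sum_comm]
    exact congrArg _ (Finset.sum_congr rfl fun p _ => Finset.sum_comm)
  have h4 : ∑ k, R.gradedMulLin (1 ⊗ₜ R.theta (w i k)) (1 ⊗ₜ R.theta (w k j)) =
      1 ⊗ₜ ∑ k, R.theta (w i k) * R.theta (w k j) := by
    simp [od, TensorProduct.tmul_sum]
  have h5 : TensorProduct.map (R.incl ∘ₗ R.proj) R.dA (CalcIdeal.ad A (w i j)) =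
      ∑ p, ∑ q, R.incl (R.proj (w p q)) ⊗ₜ[ℂ] R.dA (HopfAlgebra.antipode ℂ (w i p) * w q j) := by
    simp [hw.ad_apply]
  simp only [h.adOne_proj, map_add, LinearMap.add_apply, Finset.sum_add_distrib, h1, h2, h3, h4, h5,
    R.sum_theta_mul_ofA hw, TensorProduct.tmul_sub, Finset.sum_sub_distrib]
  abel

variable [StarRing A] [StarModule ℂ A] [CompactMatrixQuantumGroup A]

lemma IsAdInvariant.exists_adHat (h : R.IsAdInvariant) : ∃ w, R.IsAdHat w := by
  -- The graded tensor product is represented on itself by left graded multiplication, so that the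
  -- universal property of the envelope applies with an endomorphism ring as target.
  let f : R.Inv →ₗ[ℂ] Module.End ℂ (R.Env ⊗[ℂ] R.Full) := R.gradedMulLin ∘ₗ h.adOne
  have hcomp : ∀ x y, R.gradedMulLin x * R.gradedMulLin y = R.gradedMulLin (R.gradedMulLin x y) :=
    fun x y => LinearMap.ext fun z => (R.gradedMulLin_assoc x y z).symm
  have hquad : R.quad f = R.gradedMulLin ∘ₗ
      (TensorProduct.map (R.quad R.incl) R.ofA ∘ₗ CalcIdeal.ad A +
      TensorProduct.map (R.incl ∘ₗ R.proj) R.dA ∘ₗ CalcIdeal.ad A +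
      TensorProduct.mk ℂ R.Env R.Full 1 ∘ₗ
        R.quad ((Smash.inr (ComoduleAlgebra.self A) R).toLinearMap ∘ₗ R.incl)) := by
    refine ext_corep fun n w _ hw i j => ?_
    rw [R.quad_corep hw]
    simp only [f, LinearMap.comp_apply, hcomp, ← map_sum, h.sum_gradedMul_adOne hw,
      LinearMap.add_apply, R.quad_corep hw]
    rfl
  let L := R.lift f (fun r hr => by
    rw [hquad]
    simp only [LinearMap.comp_apply, LinearMap.add_apply, ← R.quad_comp,
      h.map_ad (fun r hr => R.quad_incl hr) R.ofA hr,
      h.map_ad (f := R.incl ∘ₗ R.proj) (fun r hr => by simp [R.proj_of_mem hr]) R.dA hr,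
      R.quad_incl hr, map_zero, add_zero])
  have hLincl : ∀ x, L (R.incl x) = R.gradedMulLin (h.adOne x) := fun x => R.lift_incl _ _ _
  -- Every operator in the image is a left multiplication, by its value at 1. These values form the
  -- map ϖ̂.
  have hL : ∀ x, L x = R.gradedMulLin (L x 1) := by
    intro x
    induction x using R.env_induction with
    | halg c =>
      rw [AlgHom.commutes, Module.algebraMap_end_eq_smul_id]
      ext z
      simp [R.one_gradedMulLin]
    | hincl x => rw [hLincl, R.gradedMulLin_one]
    | hmul x y hx hy =>
      rw [map_mul, hx, hy, hcomp, R.gradedMulLin_one]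
    | hadd x y hx hy => rw [map_add, LinearMap.add_apply, map_add, ← hx, ← hy]
  refine ⟨LinearMap.applyₗ (1 : R.Env ⊗[ℂ] R.Full) ∘ₗ L.toLinearMap, ?_, fun a => ?_, fun x y => ?_⟩
  · change L 1 1 = 1
    rw [map_one L]; rfl
  · change L (R.incl (R.proj a)) 1 = _
    rw [hLincl, R.gradedMulLin_one]
    rfl
  · change L (x * y) 1 = R.gradedMulLin (L x 1) (L y 1)
    rw [map_mul, ← hL x]
    rfl

lemma IsAdInvariant.isAdHat_adHat (h : R.IsAdInvariant) : R.IsAdHat R.adHat := by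
  have h := h.exists_adHat
  rw [adHat, dif_pos h]
  exact h.choose_spec

end CalcIdeal

/-! ### Convolution products and one-forms with horizontal coefficients. -/

section map

variable {M N M' N' : Type*} [AddCommGroup M] [Module ℂ M] [AddCommGroup N] [Module ℂ N]
  [AddCommGroup M'] [Module ℂ M'] [AddCommGroup N'] [Module ℂ N']

lemma map_sub_left (f g : M →ₗ[ℂ] M') (h : N →ₗ[ℂ] N') :
    TensorProduct.map (f - g) h = TensorProduct.map f h - TensorProduct.map g h := by
  ext; simp [TensorProduct.sub_tmul]

lemma map_sub_right (f : M →ₗ[ℂ] M') (g h : N →ₗ[ℂ] N') :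
    TensorProduct.map f (g - h) = TensorProduct.map f g - TensorProduct.map f h := by
  ext; simp [TensorProduct.tmul_sub]

end map

/-- The convolution product of linear maps into an algebra. -/
def convMul {A T : Type*} [Ring A] [HopfAlgebra ℂ A] [Ring T] [Algebra ℂ T] (f g : A →ₗ[ℂ] T) :
    A →ₗ[ℂ] T := LinearMap.mul' ℂ T ∘ₗ TensorProduct.map f g ∘ₗ Coalgebra.comul

section convMul

variable {A T : Type*} [Ring A] [HopfAlgebra ℂ A] [Ring T] [Algebra ℂ T] (f g h : A →ₗ[ℂ] T)

lemma convMul_corep {ι : Type*} [Fintype ι] [DecidableEq ι] {w : Matrix ι ι A} (hw : IsCorep w)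
    (i j : ι) : convMul f g (w i j) = ∑ k, f (w i k) * g (w k j) := by
  simp [convMul, hw.comul]

lemma convMul_sub_left : convMul (f - g) h = convMul f h - convMul g h := by
  ext a; simp [convMul, map_sub_left]

lemma convMul_sub_right : convMul f (g - h) = convMul f g - convMul f h := by
  ext a; simp [convMul, map_sub_right]

end convMul

lemma CalcIdeal.quad_eq_convMul {A : Type*} [Ring A] [HopfAlgebra ℂ A] (R : CalcIdeal A)
    {T : Type*} [Ring T] [Algebra ℂ T] (f : R.Inv →ₗ[ℂ] T) :
    R.quad f = convMul (f ∘ₗ R.proj) (f ∘ₗ R.proj) := rfl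

namespace Smash

variable {A H : Type*} [Ring A] [HopfAlgebra ℂ A] [Ring H] [Algebra ℂ H]
  (X : ComoduleAlgebra A H) (R : CalcIdeal A)

/-- The one-form `1 ⊗ π(a)`. -/
def theta : A →ₗ[ℂ] Smash X R := (inr X R).toLinearMap ∘ₗ R.incl ∘ₗ R.proj

lemma theta_apply (a : A) : theta X R a = inr X R (R.incl (R.proj a)) := rfl

lemma theta_one : theta X R 1 = 0 := by simp [theta, R.proj_one]

lemma convMul_theta_of_mem {r : A} (hr : r ∈ R.carrier) :
    convMul (theta X R) (theta X R) r = 0 := by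
  have := R.quad_comp R.incl (inr X R) r
  rw [R.quad_incl hr, map_zero] at this
  exact this.symm

/-- Contraction of the second leg in the smash product. -/
def inlMul (f : A →ₗ[ℂ] Smash X R) : H ⊗[ℂ] A →ₗ[ℂ] Smash X R :=
  LinearMap.mul' ℂ _ ∘ₗ TensorProduct.map (inl X R).toLinearMap f

lemma inlMul_tmul (f : A →ₗ[ℂ] Smash X R) (x : H) (a : A) :
    inlMul X R f (x ⊗ₜ a) = inl X R x * f a := rfl

lemma inlMul_sub (f g : A →ₗ[ℂ] Smash X R) : inlMul X R (f - g) = inlMul X R f - inlMul X R g := by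
  ext x a
  simp [inlMul, mul_sub]

lemma theta_mul_inl (a : A) (φ : H) : theta X R a * inl X R φ =
    inlMul X R ((inr X R).toLinearMap ∘ₗ R.incl ∘ₗ R.circ (R.proj a)) (X.coact (X.parity φ)) :=
  inr_incl_mul_inl X R _ _

lemma inr_incl_circ (a b : A) : inr X R (R.incl (R.circ (R.proj a) b)) =
    theta X R (a * b) - Coalgebra.counit (R := ℂ) a • theta X R b := by
  simp [R.circ_proj, theta]

variable [StarRing A] [StarModule ℂ A] [CompactMatrixQuantumGroup A]

/-- Moving one-forms past covariant horizontal coefficients. -/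
lemma convMul_theta_inl {χ : A →ₗ[ℂ] H} (s : ℂ)
    (hcov : ∀ a, X.coact (χ a) = χ.rTensor A (CalcIdeal.ad A a))
    (hpar : ∀ a, X.parity (χ a) = s • χ a) (a : A) :
    convMul (theta X R) ((inl X R).toLinearMap ∘ₗ χ) a =
      s • (convMul ((inl X R).toLinearMap ∘ₗ χ) (theta X R) a -
        LinearMap.mul' ℂ _ (TensorProduct.map ((inl X R).toLinearMap ∘ₗ χ) (theta X R)
          (CalcIdeal.ad A a))) := by
  refine LinearMap.congr_fun (f := convMul (theta X R) ((inl X R).toLinearMap ∘ₗ χ))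
    (g := s • (convMul ((inl X R).toLinearMap ∘ₗ χ) (theta X R) -
      LinearMap.mul' ℂ _ ∘ₗ TensorProduct.map ((inl X R).toLinearMap ∘ₗ χ) (theta X R) ∘ₗ
        CalcIdeal.ad A)) (ext_corep fun n w _ hw i j => ?_) a
  have h1 : ∀ k, theta X R (w i k) * inl X R (χ (w k j)) = s • ∑ r, ∑ t, inl X R (χ (w r t)) *
      inr X R (R.incl (R.circ (R.proj (w i k)) (HopfAlgebra.antipode ℂ (w k r) * w t j))) := by
    intro k
    rw [theta_mul_inl, hpar, map_smul, map_smul, hcov, hw.ad_apply]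
    simp [inlMul_tmul]
  simp only [convMul_corep _ _ hw, LinearMap.comp_apply, AlgHom.toLinearMap_apply, h1,
    LinearMap.smul_apply, LinearMap.sub_apply, ← Finset.smul_sum]
  congr 1
  -- Covariance of χ makes the sum over k the one computed in `sum_circ`; its second term is the
  -- contribution of the adjoint action.
  calc ∑ k, ∑ r, ∑ t, inl X R (χ (w r t)) *
      inr X R (R.incl (R.circ (R.proj (w i k)) (HopfAlgebra.antipode ℂ (w k r) * w t j)))
      = ∑ r, ∑ t, inl X R (χ (w r t)) * inr X R (R.incl (∑ k, R.circ (R.proj (w i k))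
          (HopfAlgebra.antipode ℂ (w k r) * w t j))) := by
        simp only [map_sum, Finset.mul_sum]
        rw [Finset.sum_comm]
        exact Finset.sum_congr rfl fun r _ => Finset.sum_comm
    _ = ∑ r, ∑ t, ((if i = r then inl X R (χ (w r t)) * theta X R (w t j) else 0) -
          inl X R (χ (w r t)) * theta X R (HopfAlgebra.antipode ℂ (w i r) * w t j)) := by
        refine Finset.sum_congr rfl fun r _ => Finset.sum_congr rfl fun t _ => ?_
        rw [R.sum_circ hw]
        split_ifs <;> simp [theta, mul_sub]
    _ = _ := by
        simp only [Finset.sum_sub_distrib, hw.ad_apply, map_sum, TensorProduct.map_tmul,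
          LinearMap.mul'_apply, LinearMap.comp_apply, AlgHom.toLinearMap_apply]
        congr 1
        rw [Finset.sum_comm]
        simp

/-- On the ideal the term with the adjoint action vanishes, so θ and χ commute up to the sign `s`:
−1 for the odd χ_E, 1 for the even ϱ_D. -/
lemma convMul_theta_inl_of_mem {χ : A →ₗ[ℂ] H} (s : ℂ) (hR : R.IsAdInvariant)
    (hcov : ∀ a, X.coact (χ a) = χ.rTensor A (CalcIdeal.ad A a))
    (hpar : ∀ a, X.parity (χ a) = s • χ a) (hχ : ∀ r ∈ R.carrier, χ r = 0) {r : A}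
    (hr : r ∈ R.carrier) :
    convMul (theta X R) ((inl X R).toLinearMap ∘ₗ χ) r =
      s • convMul ((inl X R).toLinearMap ∘ₗ χ) (theta X R) r := by
  rw [convMul_theta_inl X R s hcov hpar,
    hR.map_ad (fun r hr => by simp [hχ r hr]) _ hr, map_zero, sub_zero]

end Smash

namespace HorizontalForms.IsContraction

variable {A H : Type*} [Ring A] [HopfAlgebra ℂ A] [StarRing A] [StarModule ℂ A]
    [Ring H] [Algebra ℂ H] [StarAddMonoid H] [StarModule ℂ H] {P : HorizontalForms A H}
    {σ : H →ₐ[ℂ] H} {T : H →ₗ[ℂ] H} {χ : A →ₗ[ℂ] H}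

/-- The commutation rule in terms of the right action on left-invariant forms. -/
lemma invLift_mul (h : P.IsContraction σ T χ) (R : CalcIdeal A) (hR : ∀ r ∈ R.carrier, χ r = 0)
    (x : R.Inv) (φ : H) : R.invLift χ hR h.apply_one x * φ =
      P.contract (R.invLift χ hR h.apply_one ∘ₗ R.circ x) (σ φ) := by
  obtain ⟨a, rfl⟩ := R.proj_surjective x
  have e : R.invLift χ hR h.apply_one ∘ₗ R.circ (R.proj a) =
      χ ∘ₗ LinearMap.mulLeft ℂ a - Coalgebra.counit (R := ℂ) a • χ := by
    ext b
    simp [R.circ_proj, R.invLift_proj]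
  rw [R.invLift_proj, h.mul_eq, e, contract_eq, contract_eq, contract_eq]
  generalize P.coact (σ φ) = t
  induction t with
  | zero => simp
  | add a b ha hb => simp only [map_add, ← ha, ← hb, smul_add]; abel
  | tmul x y => simp [evalRight_tmul, mul_sub]

end HorizontalForms.IsContraction

/-! ### The gluing homomorphisms h_E. -/

namespace QuantumPrincipalBundle

variable {A H : Type*} [Ring A] [HopfAlgebra ℂ A] [StarRing A] [StarModule ℂ A]
    [Ring H] [Algebra ℂ H] [StarAddMonoid H] [StarModule ℂ H] (P : QuantumPrincipalBundle A H)

/-- Horizontal forms in `P.VH`. -/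
abbrev inl : H →ₐ[ℂ] P.VH := Smash.inl P.comodule P.ideal

/-- Left-invariant forms in `P.VH`. -/
abbrev inr : P.Env →ₐ[ℂ] P.VH := Smash.inr P.comodule P.ideal

/-- Left-invariant one-forms in `P.VH`. -/
abbrev theta : A →ₗ[ℂ] P.VH := Smash.theta P.comodule P.ideal

lemma horVH_apply (φ : H) : P.horVH φ = P.inl φ := rfl
lemma verVH_apply (η : P.Env) : P.verVH η = P.inr η := rfl
lemma comodule_coact (φ : H) : P.comodule.coact φ = P.coact φ := rfl
lemma comodule_parity (φ : H) : P.comodule.parity φ = P.parity φ := rfl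

variable [CompactMatrixQuantumGroup A]

variable {P}

lemma isAdInvariant_ideal : P.ideal.IsAdInvariant := fun _ hr => ad_mem hr

/-- `χ_E` on left-invariant one-forms. -/
def chiInv {E : H →ₗ[ℂ] H} (hE : P.IsVariation E) : P.Inv →ₗ[ℂ] H :=
  P.ideal.invLift (P.chi E) (fun _ hr => hr.2.1 E hE) (isContraction_chi hE).apply_one

lemma parity_chi {E : H →ₗ[ℂ] H} (hE : P.IsVariation E) (a : A) :
    P.comodule.parity (P.chi E a) = (-1 : ℂ) • P.chi E a := by
  rw [comodule_parity, P.parity_of_mem (chi_mem_deg hE a), pow_one]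

lemma parity_rho {D : H →ₗ[ℂ] H} (hD : P.IsPreconnection D) (a : A) :
    P.comodule.parity (P.rho D a) = (1 : ℂ) • P.rho D a := by
  rw [comodule_parity, P.parity_of_mem (rho_mem_deg hD a)]
  norm_num

lemma map_contract {T : Type*} [Ring T] [Algebra ℂ T] (F : H →ₐ[ℂ] T) (χ : A →ₗ[ℂ] H) (φ : H) :
    F (P.contract χ φ) = LinearMap.mul' ℂ T (TensorProduct.map F.toLinearMap (F.toLinearMap ∘ₗ χ)
      (P.coact φ)) := by
  rw [HorizontalForms.contract_eq]
  generalize P.coact φ = t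
  induction t with
  | zero => simp
  | add a b ha hb => simp only [map_add, ha, hb]
  | tmul a b => simp [HorizontalForms.evalRight_tmul]

variable [Nonempty P.preconnections]

/-- On the ideal, (θ − χ_E) * (θ − χ_E) vanishes: θ * θ is a relation, χ_E * χ_E is zero by
`chi_conv_eq_zero`, and the mixed terms cancel because χ_E is odd. The exchange rule holds since χ_E
commutes with horizontal forms in the same way as one-forms do. -/
lemma exists_gauge {E : H →ₗ[ℂ] H} (hE : P.IsVariation E) : ∃ h, P.IsGauge E h := by
  let γ : P.Inv →ₗ[ℂ] P.VH :=
    P.inr.toLinearMap ∘ₗ P.ideal.incl - P.inl.toLinearMap ∘ₗ chiInv hE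
  have hγ : γ ∘ₗ P.ideal.proj = P.theta - P.inl.toLinearMap ∘ₗ P.chi E := rfl
  let g := P.ideal.lift γ (fun r hr => by
    rw [CalcIdeal.quad_eq_convMul, hγ]
    simp only [convMul_sub_left, convMul_sub_right, LinearMap.sub_apply,
      Smash.convMul_theta_of_mem _ _ hr]
    rw [Smash.convMul_theta_inl_of_mem _ _ (-1) isAdInvariant_ideal
      (isContraction_chi hE).coact_apply (parity_chi hE) (fun _ hr => hr.2.1 E hE) hr]
    have : convMul (P.inl.toLinearMap ∘ₗ P.chi E) (P.inl.toLinearMap ∘ₗ P.chi E) r = 0 := by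
      rw [← map_zero P.inl, ← chi_conv_eq_zero hE hr]
      simp only [convMul, LinearMap.comp_apply]
      generalize (Coalgebra.comul (R := ℂ) r) = t
      induction t with
      | zero => simp
      | add a b ha hb => simp only [map_add, ha, hb]
      | tmul a b => simp
    rw [this]
    module)
  have hg : ∀ x, g (P.ideal.incl x) = P.inr (P.ideal.incl x) - P.inl (chiInv hE x) :=
    fun x => P.ideal.lift_incl _ _ _
  have hex : Smash.Exchange P.comodule P.inl g := by
    intro x φ
    have e : g.toLinearMap ∘ₗ P.ideal.incl ∘ₗ P.ideal.circ x =
        P.inr.toLinearMap ∘ₗ P.ideal.incl ∘ₗ P.ideal.circ x -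
          P.inl.toLinearMap ∘ₗ (chiInv hE ∘ₗ P.ideal.circ x) :=
      LinearMap.ext fun a => hg _
    rw [hg, e, map_sub_right, LinearMap.sub_apply, map_sub, sub_mul,
      Smash.inr_incl_mul_inl, ← map_mul]
    congr 1
    have h1 := (isContraction_chi hE).invLift_mul P.ideal (fun _ hr => hr.2.1 E hE) x φ
    change chiInv hE x * φ = P.contract (chiInv hE ∘ₗ P.ideal.circ x) (P.parity φ) at h1
    rw [h1, map_contract]
    rfl
  exact ⟨Smash.liftHom hex, fun φ => Smash.liftHom_inl hex φ, fun a => by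
    rw [verVH_apply, Smash.liftHom_inr, hg]; rfl⟩

lemma IsGauge.unique {E : H →ₗ[ℂ] H} {h h' : P.VH →ₐ[ℂ] P.VH} (hh : P.IsGauge E h)
    (hh' : P.IsGauge E h') : h = h' :=
  Smash.hom_ext (fun x => (hh.hor x).trans (hh'.hor x).symm) fun x => by
    obtain ⟨a, rfl⟩ := P.ideal.proj_surjective x
    exact (hh.ver a).trans (hh'.ver a).symm

lemma isGauge_gauge {E : H →ₗ[ℂ] H} (hE : P.IsVariation E) : P.IsGauge E (P.gauge E) := by
  have h := exists_gauge hE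
  rw [gauge, dif_pos h]
  exact h.choose_spec

/-- h_{E'} fixes the horizontal correction χ_E, and χ is additive in E. This is the cocycle
condition for the gluing. -/
lemma gauge_gauge {E E' : H →ₗ[ℂ] H} (hE : P.IsVariation E) (hE' : P.IsVariation E') (x : P.VH) :
    P.gauge E' (P.gauge E x) = P.gauge (E + E') x := by
  refine AlgHom.congr_fun (φ₁ := (P.gauge E').comp (P.gauge E)) (IsGauge.unique
    (E := E + E') ⟨fun φ => ?_, fun a => ?_⟩ (isGauge_gauge (hE.add hE'))) x
  · rw [AlgHom.comp_apply, gauge_hor, gauge_hor]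
  · rw [AlgHom.comp_apply, (isGauge_gauge hE).ver, map_sub, gauge_hor, (isGauge_gauge hE').ver,
      chi_add hE hE', LinearMap.add_apply, map_add]
    abel

lemma gauge_zero (x : P.VH) : P.gauge 0 x = x := by
  have h0 : P.IsVariation (0 : H →ₗ[ℂ] H) := ⟨by simp, by simp, by simp, by simp, by simp⟩
  refine AlgHom.congr_fun (φ₂ := AlgHom.id ℂ _) (IsGauge.unique (isGauge_gauge h0)
    ⟨fun φ => rfl, fun a => ?_⟩) x
  rw [chi_zero]
  simp

end QuantumPrincipalBundle

/-! ### The differential as a corner of upper triangular matrices. -/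

section UpperTriangular

variable {S T : Type*} [Ring S] [Algebra ℂ S] [Ring T] [Algebra ℂ T]

/-- Upper triangular matrices of linear maps. -/
def upper {M : Type*} [AddCommGroup M] [Module ℂ M] (a d b : M →ₗ[ℂ] T) :
    M →ₗ[ℂ] Matrix (Fin 2) (Fin 2) T where
  toFun x := !![a x, d x; 0, b x]
  map_add' x y := by
    ext i j; fin_cases i <;> fin_cases j <;> simp
  map_smul' c x := by
    ext i j; fin_cases i <;> fin_cases j <;> simp

/-- A twisted derivation as a homomorphism to upper triangular matrices. -/
def upperHom (a b : S →ₐ[ℂ] T) (d : S →ₗ[ℂ] T) (hd : ∀ x y, d (x * y) = a x * d y + d x * b y) :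
    S →ₐ[ℂ] Matrix (Fin 2) (Fin 2) T :=
  AlgHom.ofLinearMap (upper a.toLinearMap d b.toLinearMap)
    (by
      have h1 : d 1 = 0 := by simpa using hd 1 1
      ext i j; fin_cases i <;> fin_cases j <;> simp [upper, h1])
    (fun x y => by
      ext i j; fin_cases i <;> fin_cases j <;>
        simp [upper, Matrix.mul_apply, Fin.sum_univ_two, hd])

lemma mul'_map_upper {M N : Type*} [AddCommGroup M] [Module ℂ M] [AddCommGroup N] [Module ℂ N]
    (a d b : M →ₗ[ℂ] T) (a' d' b' : N →ₗ[ℂ] T) (t : M ⊗[ℂ] N) :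
    LinearMap.mul' ℂ _ (TensorProduct.map (upper a d b) (upper a' d' b') t) =
      !![LinearMap.mul' ℂ T (TensorProduct.map a a' t),
        LinearMap.mul' ℂ T (TensorProduct.map a d' t) +
          LinearMap.mul' ℂ T (TensorProduct.map d b' t);
        0, LinearMap.mul' ℂ T (TensorProduct.map b b' t)] := by
  induction t with
  | zero => ext i j; fin_cases i <;> fin_cases j <;> simp
  | add x y hx hy =>
    rw [map_add, map_add, hx, hy]
    ext i j; fin_cases i <;> fin_cases j <;> simp
    abel
  | tmul x y =>
    ext i j; fin_cases i <;> fin_cases j <;>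
      simp [upper, Matrix.mul_apply, Fin.sum_univ_two]

end UpperTriangular

namespace Smash

variable {A H : Type*} [Ring A] [HopfAlgebra ℂ A] [Ring H] [Algebra ℂ H]
  (X : ComoduleAlgebra A H) (R : CalcIdeal A)

lemma convMul_theta (a : A) : convMul (theta X R) (theta X R) a = inr X R (R.quad R.incl a) :=
  (R.quad_comp R.incl (inr X R) a).symm

lemma ofTensor_lTensor (t : H ⊗[ℂ] A) :
    ofTensor X R ((R.incl ∘ₗ R.proj).lTensor H t) = inlMul X R (theta X R) t := by
  induction t with
  | zero => simp
  | add x y hx hy => simp only [map_add, hx, hy]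
  | tmul x a => rw [inlMul_tmul, theta_apply, inl_mul_inr]; rfl

lemma theta_mul_inl' (a : A) (φ : H) : theta X R a * inl X R φ =
    inlMul X R (theta X R ∘ₗ LinearMap.mulLeft ℂ a) (X.coact (X.parity φ)) -
      Coalgebra.counit (R := ℂ) a • inlMul X R (theta X R) (X.coact (X.parity φ)) := by
  have e : (inr X R).toLinearMap ∘ₗ R.incl ∘ₗ R.circ (R.proj a) =
      theta X R ∘ₗ LinearMap.mulLeft ℂ a - Coalgebra.counit (R := ℂ) a • theta X R :=
    LinearMap.ext fun b => inr_incl_circ X R a b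
  rw [theta_mul_inl, e, inlMul_sub, LinearMap.sub_apply]
  congr 1
  simp [inlMul, TensorProduct.map_smul_right]

/-- From π(cd) = ε(c)π(d) + π(c) ∘ d: the first term gives φ times the vertical part of ψ, the
second is the exchange of π(c) with ψ, whose sign is the parity. It is the Leibniz rule for the
vertical part of ∂_D on horizontal forms. -/
lemma inlMul_theta_mul (φ ψ : H) : inlMul X R (theta X R) (X.coact (φ * ψ)) =
    inl X R φ * inlMul X R (theta X R) (X.coact ψ) +
      inlMul X R (theta X R) (X.coact φ) * inl X R (X.parity ψ) := by
  have key : ∀ t : H ⊗[ℂ] A, inlMul X R (theta X R) (t * X.coact ψ) =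
      inl X R (TensorProduct.rid ℂ H ((Coalgebra.counit (R := ℂ)).lTensor H t)) *
        inlMul X R (theta X R) (X.coact ψ) + inlMul X R (theta X R) t * inl X R (X.parity ψ) := by
    intro t
    induction t with
    | zero => simp
    | add x y hx hy => simp only [add_mul, map_add, hx, hy]; abel
    | tmul u c =>
      rw [inlMul_tmul, mul_assoc, theta_mul_inl', X.parity_parity]
      simp only [LinearMap.lTensor_tmul, TensorProduct.rid_tmul, map_smul, smul_mul_assoc,
        mul_sub, mul_smul_comm, add_sub_cancel]
      generalize X.coact ψ = s
      induction s with
      | zero => simp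
      | add x y hx hy => simp only [mul_add, map_add, hx, hy]
      | tmul v d => simp [inlMul_tmul, mul_assoc]
  rw [map_mul, key, X.counit]

lemma inlMul_parity (f : A →ₗ[ℂ] Smash X R) (φ : H) :
    LinearMap.mul' ℂ _ (TensorProduct.map ((inl X R).toLinearMap ∘ₗ X.parity.toLinearMap) f
      (X.coact φ)) = inlMul X R f (X.coact (X.parity φ)) := by
  rw [X.coact_parity, inlMul]
  generalize X.coact φ = t
  induction t with
  | zero => simp
  | add x y hx hy => simp only [map_add, hx, hy]
  | tmul x a => simp

end Smash

namespace Smash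

variable {A H : Type*} [Ring A] [HopfAlgebra ℂ A] [Ring H] [Algebra ℂ H]
  (X : ComoduleAlgebra A H) (R : CalcIdeal A)

/-- The map `b ↦ 1 ⊗ (π(a) ∘ b)`. -/
def thetaCirc (a : A) : A →ₗ[ℂ] Smash X R := (inr X R).toLinearMap ∘ₗ R.incl ∘ₗ R.circ (R.proj a)

lemma thetaCirc_apply (a b : A) : thetaCirc X R a b =
    theta X R (a * b) - Coalgebra.counit (R := ℂ) a • theta X R b := inr_incl_circ X R a b

lemma inlMul_convMul (f g : A →ₗ[ℂ] Smash X R) (φ : H) :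
    inlMul X R (convMul f g) (X.coact φ) =
      LinearMap.mul' ℂ _ (TensorProduct.map (inlMul X R f ∘ₗ X.coact.toLinearMap) g
        (X.coact φ)) := by
  let K : H ⊗[ℂ] (A ⊗[ℂ] A) →ₗ[ℂ] Smash X R :=
    LinearMap.mul' ℂ _ ∘ₗ TensorProduct.map (inl X R).toLinearMap
      (LinearMap.mul' ℂ _ ∘ₗ TensorProduct.map f g)
  have h1 : ∀ t, inlMul X R (convMul f g) t = K ((Coalgebra.comul (R := ℂ)).lTensor H t) := by
    intro t
    induction t with
    | zero => simp
    | add x y hx hy => simp only [map_add, hx, hy]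
    | tmul x a => rfl
  have h2 : ∀ (s : H ⊗[ℂ] A) (c : A), K (TensorProduct.assoc ℂ H A A (s ⊗ₜ c)) =
      inlMul X R f s * g c := by
    intro s c
    induction s with
    | zero => simp
    | add x y hx hy => simp only [TensorProduct.add_tmul, map_add, add_mul, hx, hy]
    | tmul x a => simp [K, inlMul_tmul, mul_assoc]
  rw [h1, ← X.coassoc]
  generalize X.coact φ = t
  induction t with
  | zero => simp
  | add x y hx hy => simp only [map_add, hx, hy]
  | tmul x a => simp [h2]

/-- Exchanging π(a) with the horizontal factor leaves π(a) ∘ c₁ next to f(c₂), by coassociativity.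
-/
lemma theta_mul_inlMul (f : A →ₗ[ℂ] Smash X R) (a : A) (φ : H) :
    theta X R a * inlMul X R f (X.coact (X.parity φ)) =
      inlMul X R (convMul (thetaCirc X R a) f) (X.coact φ) := by
  rw [inlMul_convMul, ← inlMul_parity]
  generalize X.coact φ = t
  induction t with
  | zero => simp
  | add x y hx hy => simp only [map_add, mul_add, hx, hy]
  | tmul x b =>
    simp only [TensorProduct.map_tmul, LinearMap.mul'_apply, LinearMap.comp_apply,
      AlgHom.toLinearMap_apply, ← mul_assoc, theta_mul_inl, X.parity_parity]
    rfl

/-- The left side is the action of b on ∑ π(a₁)π(a₂), expanded by π(a) ∘ b = π(ab) − ε(a)π(b). It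
measures how far dπ is from commuting with the right action. -/
lemma sum_convMul_thetaCirc (a : A) {ι : Type*} (s : Coalgebra.Repr ℂ a ι) :
    ∑ l ∈ s.index, convMul (thetaCirc X R (s.left l)) (thetaCirc X R (s.right l)) =
      convMul (theta X R) (theta X R) ∘ₗ LinearMap.mulLeft ℂ a -
      Coalgebra.counit (R := ℂ) a • convMul (theta X R) (theta X R) -
      convMul (thetaCirc X R a) (theta X R) - convMul (theta X R) (thetaCirc X R a) := by
  have e1 : ∀ x, ∑ l ∈ s.index, Coalgebra.counit (R := ℂ) (s.left l) •
      theta X R (s.right l * x) = theta X R (a * x) := by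
    intro x
    have h := congrArg (fun b => theta X R (b * x)) (Coalgebra.sum_counit_smul (R := ℂ) s)
    simpa only [Finset.sum_mul, map_sum, smul_mul_assoc, map_smul] using h
  have e2 : ∀ x, ∑ l ∈ s.index, Coalgebra.counit (R := ℂ) (s.right l) •
      theta X R (s.left l * x) = theta X R (a * x) := by
    intro x
    have h : ∑ l ∈ s.index, Coalgebra.counit (R := ℂ) (s.right l) • s.left l = a := by
      have h := congrArg (TensorProduct.rid ℂ A) (Coalgebra.sum_tmul_counit_eq (R := ℂ) s)
      simpa only [map_sum, TensorProduct.rid_tmul, one_smul] using h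
    have h := congrArg (fun b => theta X R (b * x)) h
    simpa only [Finset.sum_mul, map_sum, smul_mul_assoc, map_smul] using h
  have e3 : ∑ l ∈ s.index, Coalgebra.counit (R := ℂ) (s.left l) *
      Coalgebra.counit (R := ℂ) (s.right l) = Coalgebra.counit (R := ℂ) a := by
    have h := congrArg (Coalgebra.counit (R := ℂ)) (Coalgebra.sum_counit_smul (R := ℂ) s)
    simpa using h
  refine LinearMap.ext fun b => ?_
  let t := Coalgebra.Repr.arbitrary ℂ b
  have hc : ∀ f g : A →ₗ[ℂ] Smash X R, convMul f g b =
      ∑ j ∈ t.index, f (t.left j) * g (t.right j) := fun f g => by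
    simp [convMul, ← t.eq]
  have hm : convMul (theta X R) (theta X R) (a * b) = ∑ j ∈ t.index, ∑ l ∈ s.index,
      theta X R (s.left l * t.left j) * theta X R (s.right l * t.right j) := by
    simp only [convMul, LinearMap.comp_apply, Bialgebra.comul_mul, ← t.eq, ← s.eq]
    simp only [Finset.sum_mul_sum, map_sum, Algebra.TensorProduct.tmul_mul_tmul,
      TensorProduct.map_tmul, LinearMap.mul'_apply]
    exact Finset.sum_comm
  simp only [LinearMap.sum_apply, LinearMap.sub_apply, LinearMap.smul_apply, LinearMap.comp_apply,
    LinearMap.mulLeft_apply, hc, hm]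
  rw [Finset.sum_comm, Finset.smul_sum, ← Finset.sum_sub_distrib, ← Finset.sum_sub_distrib,
    ← Finset.sum_sub_distrib]
  refine Finset.sum_congr rfl fun j _ => ?_
  generalize t.left j = x
  generalize t.right j = y
  have key : ∀ l, thetaCirc X R (s.left l) x * thetaCirc X R (s.right l) y =
      theta X R (s.left l * x) * theta X R (s.right l * y) -
      (Coalgebra.counit (R := ℂ) (s.right l) • theta X R (s.left l * x)) * theta X R y -
      theta X R x * (Coalgebra.counit (R := ℂ) (s.left l) • theta X R (s.right l * y)) +
      (Coalgebra.counit (R := ℂ) (s.left l) * Coalgebra.counit (R := ℂ) (s.right l)) •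
        (theta X R x * theta X R y) := by
    intro l
    simp only [thetaCirc_apply, sub_mul, mul_sub, smul_mul_assoc, mul_smul_comm]
    module
  simp only [key, Finset.sum_add_distrib, Finset.sum_sub_distrib, ← Finset.sum_mul,
    ← Finset.mul_sum, ← Finset.sum_smul, e1, e2, e3]
  simp only [thetaCirc_apply, sub_mul, mul_sub, smul_mul_assoc, mul_smul_comm]
  module

lemma convMul_theta_mul_inl (a : A) (φ : H) : convMul (theta X R) (theta X R) a * inl X R φ =
    inlMul X R (convMul (theta X R) (theta X R) ∘ₗ LinearMap.mulLeft ℂ a -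
      Coalgebra.counit (R := ℂ) a • convMul (theta X R) (theta X R) -
      convMul (thetaCirc X R a) (theta X R) - convMul (theta X R) (thetaCirc X R a))
      (X.coact φ) := by
  let s := Coalgebra.Repr.arbitrary ℂ a
  have h1 : convMul (theta X R) (theta X R) a =
      ∑ l ∈ s.index, theta X R (s.left l) * theta X R (s.right l) := by
    simp [convMul, ← s.eq]
  have h2 : ∀ (f : A × A → A →ₗ[ℂ] Smash X R) (t : Finset (A × A)) (z : H ⊗[ℂ] A),
      inlMul X R (∑ l ∈ t, f l) z = ∑ l ∈ t, inlMul X R (f l) z := by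
    intro f t z
    induction z with
    | zero => simp
    | add x y hx hy => simp only [map_add, hx, hy, Finset.sum_add_distrib]
    | tmul x b => simp [inlMul_tmul, Finset.mul_sum]
  rw [← sum_convMul_thetaCirc X R a s, h2, h1, Finset.sum_mul]
  refine Finset.sum_congr rfl fun l _ => ?_
  rw [mul_assoc, ← theta_mul_inlMul, theta_mul_inl]
  rfl

end Smash

namespace QuantumPrincipalBundle

variable {A H : Type*} [Ring A] [HopfAlgebra ℂ A] [StarRing A] [StarModule ℂ A]
    [Ring H] [Algebra ℂ H] [StarAddMonoid H] [StarModule ℂ H] (P : QuantumPrincipalBundle A H)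

/-- The differential on horizontal forms. -/
def horDiff (D : H →ₗ[ℂ] H) : H →ₗ[ℂ] P.VH :=
  P.inl.toLinearMap ∘ₗ D + Smash.inlMul P.comodule P.ideal P.theta ∘ₗ P.coact.toLinearMap ∘ₗ
    P.parity.toLinearMap

lemma horDiff_apply (D : H →ₗ[ℂ] H) (φ : H) : P.horDiff D φ = P.inl (D φ) +
    Smash.inlMul P.comodule P.ideal P.theta (P.coact (P.parity φ)) := rfl

variable {P}

/-- D contributes its own Leibniz rule, the vertical part `inlMul_theta_mul`. In this form the map
is a twisted derivation, as required by `upperHom`. -/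
lemma horDiff_mul {D : H →ₗ[ℂ] H} (hD : P.IsAntiderivation D) (φ ψ : H) :
    P.horDiff D (φ * ψ) = P.inl (P.parity φ) * P.horDiff D ψ + P.horDiff D φ * P.inl ψ := by
  have h := Smash.inlMul_theta_mul P.comodule P.ideal (P.parity φ) (P.parity ψ)
  simp only [comodule_coact, comodule_parity, parity_parity] at h
  simp only [horDiff_apply, hD.apply_mul, map_add, map_mul P.inl, map_mul P.parity, h, mul_add,
    add_mul]
  abel

variable [CompactMatrixQuantumGroup A]

/-- `ϱ_D` on left-invariant one-forms. -/
def rhoInv {D : H →ₗ[ℂ] H} (hD : P.IsPreconnection D) : P.Inv →ₗ[ℂ] H :=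
  P.ideal.invLift (P.rho D) (fun _ hr => hr.2.2 D hD) (isContraction_rho hD).apply_one

/-- The differential on left-invariant one-forms. -/
def verDiff {D : H →ₗ[ℂ] H} (hD : P.IsPreconnection D) : P.Inv →ₗ[ℂ] P.VH :=
  P.ideal.invLift (P.inl.toLinearMap ∘ₗ P.rho D - convMul P.theta P.theta)
    (fun r hr => by
      rw [LinearMap.sub_apply, LinearMap.comp_apply, hr.2.2 D hD,
        Smash.convMul_theta_of_mem _ _ hr]
      simp)
    (by simp [(isContraction_rho hD).apply_one, convMul, Algebra.TensorProduct.one_def,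
      Smash.theta_one])

lemma verDiff_proj {D : H →ₗ[ℂ] H} (hD : P.IsPreconnection D) (a : A) :
    verDiff hD (P.ideal.proj a) = P.inl (P.rho D a) - convMul P.theta P.theta a := rfl

end QuantumPrincipalBundle

namespace QuantumPrincipalBundle

variable {A H : Type*} [Ring A] [HopfAlgebra ℂ A] [StarRing A] [StarModule ℂ A]
    [Ring H] [Algebra ℂ H] [StarAddMonoid H] [StarModule ℂ H] {P : QuantumPrincipalBundle A H}

lemma vhDeg_induction {n : ℕ} {p : P.VH → Prop}
    (h : ∀ i j, i + j = n → ∀ x ∈ P.deg i, ∀ y ∈ P.ideal.envDeg j, p (P.inl x * P.inr y))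
    (h0 : p 0) (hadd : ∀ x y, p x → p y → p (x + y)) {x : P.VH} (hx : x ∈ P.vhDeg n) : p x := by
  obtain ⟨t, ht, rfl⟩ := hx
  change p (P.vhMk t)
  refine Submodule.iSup_induction _ (motive := fun t => p (P.vhMk t)) ht (fun q t ht => ?_)
    (by simpa using h0) (fun x y hx hy => by rw [map_add]; exact hadd _ _ hx hy)
  refine Submodule.iSup_induction _ (motive := fun t => p (P.vhMk t)) ht (fun hq t ht => ?_)
    (by simpa using h0) (fun x y hx hy => by rw [map_add]; exact hadd _ _ hx hy)
  rw [Finset.HasAntidiagonal.mem_antidiagonal] at hq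
  rw [Submodule.map₂_eq_span_image2] at ht
  -- The predicate is assumed additive but not stable under scalars, so the span is replaced by an
  -- additive closure; scalars are absorbed into the horizontal factors.
  have ht' : t ∈ AddSubmonoid.closure (Set.image2
      (fun m n => TensorProduct.mk ℂ H P.Env m n) (P.deg q.1) (P.ideal.envDeg q.2)) := by
    induction ht using Submodule.span_induction with
    | mem x hx => exact AddSubmonoid.subset_closure hx
    | zero => exact zero_mem _
    | add x y _ _ hx hy => exact add_mem hx hy
    | smul c x hm hx =>
      clear hm
      induction hx using AddSubmonoid.closure_induction with
      | mem x hx =>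
        obtain ⟨u, hu, v, hv, rfl⟩ := hx
        exact AddSubmonoid.subset_closure ⟨c • u, Submodule.smul_mem _ _ hu, v, hv, rfl⟩
      | zero => rw [smul_zero]; exact zero_mem _
      | add x y _ _ hx hy => rw [smul_add]; exact add_mem hx hy
  clear ht
  induction ht' using AddSubmonoid.closure_induction with
  | mem x hx =>
    obtain ⟨u, hu, v, hv, rfl⟩ := hx
    have := h q.1 q.2 hq u hu v hv
    rw [Smash.inl_mul_inr] at this
    exact this
  | zero => simpa using h0
  | add x y _ _ hx hy => rw [map_add]; exact hadd _ _ hx hy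

lemma mul_mem_vhDeg {i j : ℕ} {x : H} (hx : x ∈ P.deg i) {y : P.Env} (hy : y ∈ P.ideal.envDeg j) :
    P.inl x * P.inr y ∈ P.vhDeg (i + j) := by
  refine ⟨x ⊗ₜ y, ?_, (Smash.inl_mul_inr _ _ x y).symm⟩
  refine Submodule.mem_iSup_of_mem (i, j) (Submodule.mem_iSup_of_mem
    (Finset.HasAntidiagonal.mem_antidiagonal.2 rfl) ?_)
  exact Submodule.apply_mem_map₂ _ hx hy

lemma inl_mem_vhDeg {i : ℕ} {x : H} (hx : x ∈ P.deg i) : P.inl x ∈ P.vhDeg i := by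
  simpa using mul_mem_vhDeg hx P.ideal.one_mem_envDeg

lemma inr_mem_vhDeg {j : ℕ} {y : P.Env} (hy : y ∈ P.ideal.envDeg j) : P.inr y ∈ P.vhDeg j := by
  have h1 : (1 : H) ∈ P.deg 0 := SetLike.GradedOne.one_mem
  simpa using mul_mem_vhDeg h1 hy

variable [CompactMatrixQuantumGroup A]

section Existence

variable {D : H →ₗ[ℂ] H} (hD : P.IsPreconnection D)

/-- The homomorphism to upper triangular matrices whose corner is the differential on horizontal
forms. -/
def horUpper : H →ₐ[ℂ] Matrix (Fin 2) (Fin 2) P.VH :=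
  upperHom (P.inl.comp P.parity) P.inl (P.horDiff D) (fun x y => horDiff_mul hD.isAntiderivation x y)

lemma convMul_assoc_theta (r : A) :
    convMul P.theta (convMul P.theta P.theta) r = convMul (convMul P.theta P.theta) P.theta r := by
  refine LinearMap.congr_fun (f := convMul P.theta (convMul P.theta P.theta))
    (ext_corep fun n w _ hw i j => ?_) r
  simp only [convMul_corep _ _ hw, Finset.mul_sum, Finset.sum_mul, mul_assoc]
  exact Finset.sum_comm

/-- The diagonal entries are the quadratic relation itself. In the corner, θ commutes in convolution
with the even map ϱ_D on the ideal, and the cubic terms cancel by associativity of the convolution.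
-/
lemma verUpper_quad {r : A} (hr : r ∈ P.ideal.carrier) :
    P.ideal.quad (upper (-(P.inr.toLinearMap ∘ₗ P.ideal.incl)) (verDiff hD)
      (P.inr.toLinearMap ∘ₗ P.ideal.incl)) r = 0 := by
  have e : upper (-(P.inr.toLinearMap ∘ₗ P.ideal.incl)) (verDiff hD)
      (P.inr.toLinearMap ∘ₗ P.ideal.incl) ∘ₗ P.ideal.proj =
      upper (-P.theta) (P.inl.toLinearMap ∘ₗ P.rho D - convMul P.theta P.theta) P.theta := rfl
  have h0 : convMul P.theta P.theta r = 0 := Smash.convMul_theta_of_mem _ _ hr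
  have h1 := Smash.convMul_theta_inl_of_mem P.comodule P.ideal 1 isAdInvariant_ideal
    (isContraction_rho hD).coact_apply (parity_rho hD) (fun _ hr => hr.2.2 D hD) hr
  have hneg : ∀ f : A →ₗ[ℂ] P.VH, convMul (-P.theta) f = -convMul P.theta f := by
    intro f
    have := convMul_sub_left 0 P.theta f
    have h0 : convMul 0 f = 0 := by ext; simp [convMul]
    rwa [zero_sub, h0, zero_sub] at this
  rw [CalcIdeal.quad_eq_convMul, e, convMul, LinearMap.comp_apply, LinearMap.comp_apply,
    mul'_map_upper]
  have e1 : ∀ f g : A →ₗ[ℂ] P.VH, LinearMap.mul' ℂ P.VH (TensorProduct.map f g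
      (Coalgebra.comul (R := ℂ) r)) = convMul f g r := fun _ _ => rfl
  have e2 : LinearMap.mul' ℂ P.VH (TensorProduct.map (-P.theta) (-P.theta)
      (Coalgebra.comul (R := ℂ) r)) = 0 := by
    have h2 := convMul_sub_right P.theta 0 P.theta
    have h3 : convMul P.theta 0 = 0 := by ext; simp [convMul]
    rw [zero_sub, h3, zero_sub] at h2
    rw [e1, hneg, h2, neg_neg, h0]
  have e3 : convMul (-P.theta) (P.inl.toLinearMap ∘ₗ P.rho D - convMul P.theta P.theta) r +
      convMul (P.inl.toLinearMap ∘ₗ P.rho D - convMul P.theta P.theta) P.theta r = 0 := by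
    rw [hneg, convMul_sub_right, convMul_sub_left, LinearMap.neg_apply, LinearMap.sub_apply,
      LinearMap.sub_apply, h1, convMul_assoc_theta, one_smul]
    abel
  rw [e2, e1, e1, e1, e3, h0]
  ext i j; fin_cases i <;> fin_cases j <;> rfl

/-- The homomorphism to upper triangular matrices whose corner is the differential on left-invariant
forms. -/
def verUpper : P.Env →ₐ[ℂ] Matrix (Fin 2) (Fin 2) P.VH :=
  P.ideal.lift (upper (-(P.inr.toLinearMap ∘ₗ P.ideal.incl)) (verDiff hD)
    (P.inr.toLinearMap ∘ₗ P.ideal.incl)) (fun _ hr => verUpper_quad hD hr)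

lemma verUpper_incl (x : P.Inv) : verUpper hD (P.ideal.incl x) =
    !![-P.inr (P.ideal.incl x), verDiff hD x; 0, P.inr (P.ideal.incl x)] :=
  P.ideal.lift_incl _ _ _

/-- The left side is the Leibniz expansion of ∂_D(π(a)φ), the right side that of ∂_D applied to the
exchanged product. The terms with D agree by covariance, those with ϱ_D by its commutation rule, and
those of vertical degree two by `Smash.convMul_theta_mul_inl`. -/
lemma theta_mul_horDiff (a : A) (φ : H) :
    -P.theta a * P.horDiff D φ + (P.inl (P.rho D a) - convMul P.theta P.theta a) * P.inl φ =
      Smash.inlMul P.comodule P.ideal (verDiff hD ∘ₗ P.ideal.circ (P.ideal.proj a)) (P.coact φ) +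
      LinearMap.mul' ℂ P.VH (TensorProduct.map (P.horDiff D)
        (Smash.thetaCirc P.comodule P.ideal a) (P.coact (P.parity φ))) := by
  have hcp : ∀ φ, P.coact (P.parity φ) = P.parity.toLinearMap.rTensor A (P.coact φ) :=
    P.comodule.coact_parity
  -- the four contributions
  have h1 : -P.theta a * P.inl (D φ) = Smash.inlMul P.comodule P.ideal
      (Smash.thetaCirc P.comodule P.ideal a) (P.coact (D (P.parity φ))) := by
    rw [neg_mul, Smash.theta_mul_inl, comodule_coact, comodule_parity,
      hD.isAntiderivation.parity_apply, map_neg, map_neg, neg_neg]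
    rfl
  have h2 := Smash.theta_mul_inlMul P.comodule P.ideal P.theta a φ
  have h3 : P.inl (P.rho D a) * P.inl φ = Smash.inlMul P.comodule P.ideal
      (P.inl.toLinearMap ∘ₗ (rhoInv hD ∘ₗ P.ideal.circ (P.ideal.proj a))) (P.coact φ) := by
    have h := (isContraction_rho hD).invLift_mul P.ideal (fun _ hr => hr.2.2 D hD)
      (P.ideal.proj a) φ
    change P.rho D a * φ = P.contract (rhoInv hD ∘ₗ P.ideal.circ (P.ideal.proj a)) φ at h
    rw [← map_mul, h, map_contract]
    rfl
  have h4 := Smash.convMul_theta_mul_inl P.comodule P.ideal a φ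
  have h5 : verDiff hD ∘ₗ P.ideal.circ (P.ideal.proj a) =
      P.inl.toLinearMap ∘ₗ (rhoInv hD ∘ₗ P.ideal.circ (P.ideal.proj a)) -
      (convMul P.theta P.theta ∘ₗ LinearMap.mulLeft ℂ a -
        Coalgebra.counit (R := ℂ) a • convMul P.theta P.theta) := by
    refine LinearMap.ext fun b => ?_
    simp only [LinearMap.comp_apply, P.ideal.circ_proj, map_sub, map_smul, verDiff_proj,
      LinearMap.sub_apply, LinearMap.smul_apply, LinearMap.mulLeft_apply, AlgHom.toLinearMap_apply,
      rhoInv, CalcIdeal.invLift_proj, smul_sub]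
    abel
  have h6 : LinearMap.mul' ℂ P.VH (TensorProduct.map (P.horDiff D)
        (Smash.thetaCirc P.comodule P.ideal a) (P.coact (P.parity φ))) =
      Smash.inlMul P.comodule P.ideal
        (Smash.thetaCirc P.comodule P.ideal a) (P.coact (D (P.parity φ))) +
      Smash.inlMul P.comodule P.ideal (convMul P.theta (Smash.thetaCirc P.comodule P.ideal a))
        (P.coact φ) := by
    have h7 := Smash.inlMul_convMul P.comodule P.ideal P.theta
      (Smash.thetaCirc P.comodule P.ideal a) φ
    simp only [comodule_coact] at h7
    rw [h7, hD.covariant]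
    have h8 : P.coact φ = P.parity.toLinearMap.rTensor A (P.coact (P.parity φ)) := by
      rw [← hcp, parity_parity]
    rw [h8]
    generalize P.coact (P.parity φ) = t
    induction t with
    | zero => simp
    | add x y hx hy => simp only [map_add, hx, hy]; abel
    | tmul x b => simp [horDiff_apply, Smash.inlMul_tmul, add_mul, comodule_coact]
  simp only [comodule_coact, comodule_parity] at h2 h4
  rw [h6, h5, horDiff_apply, mul_add, h1, neg_mul, h2, sub_mul, h3, h4]
  simp only [Smash.inlMul_sub, LinearMap.sub_apply]
  abel

/-- The diagonal entries are the exchange rule of the smash product, in one of them twisted by the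
parity; the corner is `theta_mul_horDiff`. -/
lemma exchange_upper : Smash.Exchange P.comodule (horUpper hD) (verUpper hD) := by
  intro x φ
  obtain ⟨a, rfl⟩ := P.ideal.proj_surjective x
  have e1 : (horUpper hD).toLinearMap = upper (P.inl.toLinearMap ∘ₗ P.parity.toLinearMap)
    (P.horDiff D) P.inl.toLinearMap := rfl
  have e2 : (verUpper hD).toLinearMap ∘ₗ P.ideal.incl ∘ₗ P.ideal.circ (P.ideal.proj a) =
      upper (-(Smash.thetaCirc P.comodule P.ideal a))
        (verDiff hD ∘ₗ P.ideal.circ (P.ideal.proj a)) (Smash.thetaCirc P.comodule P.ideal a) :=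
    LinearMap.ext fun b => verUpper_incl hD _
  rw [e1, e2, mul'_map_upper, verUpper_incl]
  have e3 : horUpper hD φ = !![P.inl (P.parity φ), P.horDiff D φ; 0, P.inl φ] := rfl
  have p1 := Smash.inlMul_parity P.comodule P.ideal (-(Smash.thetaCirc P.comodule P.ideal a))
    (P.parity φ)
  have p2 := Smash.inlMul_parity P.comodule P.ideal (verDiff hD ∘ₗ P.ideal.circ (P.ideal.proj a))
    (P.parity φ)
  have p3 := theta_mul_horDiff hD a φ
  have p4 := Smash.theta_mul_inl P.comodule P.ideal a φ
  have p5 := Smash.theta_mul_inl P.comodule P.ideal a (P.parity φ)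
  simp only [comodule_coact, comodule_parity, parity_parity] at p1 p2 p4 p5 ⊢
  have p6 : Smash.inlMul P.comodule P.ideal (-(Smash.thetaCirc P.comodule P.ideal a)) (P.coact φ) =
      -Smash.inlMul P.comodule P.ideal (Smash.thetaCirc P.comodule P.ideal a) (P.coact φ) := by
    have := Smash.inlMul_sub P.comodule P.ideal 0 (Smash.thetaCirc P.comodule P.ideal a)
    have h0 : Smash.inlMul P.comodule P.ideal 0 = 0 := by ext; simp [Smash.inlMul]
    rw [zero_sub, h0, zero_sub] at this
    rw [this]; rfl
  rw [e3]
  have q1 : -P.theta a * P.inl (P.parity φ) = LinearMap.mul' ℂ P.VH (TensorProduct.map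
      (P.inl.toLinearMap ∘ₗ P.parity.toLinearMap) (-(Smash.thetaCirc P.comodule P.ideal a))
        (P.coact (P.parity φ))) := by
    refine Eq.trans ?_ p1.symm
    rw [p6, neg_mul, p5]; rfl
  have q2 : -P.theta a * P.horDiff D φ + verDiff hD (P.ideal.proj a) * P.inl φ =
      LinearMap.mul' ℂ P.VH (TensorProduct.map
        (P.inl.toLinearMap ∘ₗ P.parity.toLinearMap) (verDiff hD ∘ₗ P.ideal.circ (P.ideal.proj a))
        (P.coact (P.parity φ))) + LinearMap.mul' ℂ P.VH (TensorProduct.map (P.horDiff D)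
        (Smash.thetaCirc P.comodule P.ideal a) (P.coact (P.parity φ))) := by
    rw [verDiff_proj, p3]
    congr 1
    exact p2.symm
  rw [← q1, ← q2]
  have q3 : P.theta a * P.inl φ = LinearMap.mul' ℂ P.VH (TensorProduct.map
      P.inl.toLinearMap (Smash.thetaCirc P.comodule P.ideal a) (P.coact (P.parity φ))) := p4
  rw [← q3, Matrix.mul_fin_two]
  simp [Smash.theta_apply]

lemma liftUpper_apply (x : H) (y : P.Env) :
    Smash.liftHom (exchange_upper hD) (P.inl x * P.inr y) 0 0 =
        P.inl (P.parity x) * P.inr (P.ideal.envParity y) ∧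
      Smash.liftHom (exchange_upper hD) (P.inl x * P.inr y) 1 0 = 0 ∧
      Smash.liftHom (exchange_upper hD) (P.inl x * P.inr y) 1 1 = P.inl x * P.inr y := by
  have e3 : horUpper hD x = !![P.inl (P.parity x), P.horDiff D x; 0, P.inl x] := rfl
  have hy : verUpper hD y 0 0 = P.inr (P.ideal.envParity y) ∧ verUpper hD y 1 0 = 0 ∧
      verUpper hD y 1 1 = P.inr y := by
    induction y using P.ideal.env_induction with
    | halg c => simp [Matrix.algebraMap_eq_diagonal, AlgHom.commutes]
    | hincl x => simp [verUpper_incl, P.ideal.envParity_incl]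
    | hmul x y hx hy =>
      simp only [map_mul, Matrix.mul_apply, Fin.sum_univ_two, hx.1, hx.2.1, hx.2.2, hy.1, hy.2.1,
        hy.2.2]
      simp
    | hadd x y hx hy =>
      simp only [map_add, Matrix.add_apply, hx.1, hx.2.1, hx.2.2, hy.1, hy.2.1, hy.2.2]
      simp
  rw [map_mul, Smash.liftHom_inl, Smash.liftHom_inr, e3]
  simp [Matrix.mul_apply, Fin.sum_univ_two, hy.1, hy.2.1, hy.2.2]

end Existence

lemma exists_differential {D : H →ₗ[ℂ] H} (hD : P.IsPreconnection D) :
    ∃ δ, P.IsTotalDifferential D δ := by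
  -- The upper right corner is ∂_D. Since the diagonal of Φ consists of the total parity and the
  -- identity, the product of matrices gives the graded Leibniz rule.
  let Φ := Smash.liftHom (exchange_upper hD)
  let δ : P.VH →ₗ[ℂ] P.VH :=
    { toFun := fun x => Φ x 0 1
      map_add' := fun x y => by rw [map_add]; rfl
      map_smul' := fun c x => by rw [map_smul]; rfl }
  refine ⟨δ, ⟨fun n φ hφ => ?_, fun a => ?_, fun n x hx y => ?_⟩⟩
  · have h1 : δ (P.horVH φ) = P.horDiff D φ :=
      congrFun (congrFun (Smash.liftHom_inl (exchange_upper hD) φ) 0) 1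
    have h2 := Smash.ofTensor_lTensor P.comodule P.ideal (P.coact φ)
    rw [h1, horDiff_apply, P.parity_of_mem hφ, map_smul, map_smul, ← h2]
    rfl
  · have h1 : δ (P.verVH (P.ideal.incl (P.ideal.proj a))) = verDiff hD (P.ideal.proj a) := by
      refine (congrFun (congrFun (Smash.liftHom_inr (exchange_upper hD) _) 0) 1).trans ?_
      rw [verUpper_incl]; rfl
    rw [h1, verDiff_proj, Smash.convMul_theta]
    rfl
  · have h00 : Φ x 0 0 = (-1 : ℂ) ^ n • x := by
      refine vhDeg_induction (p := fun x => Φ x 0 0 = (-1 : ℂ) ^ n • x)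
        (fun i j hij u hu v hv => ?_) (by simp) (fun x y hx hy => ?_) hx
      · rw [(liftUpper_apply hD u v).1, P.parity_of_mem hu, P.ideal.envParity_of_mem hv, map_smul,
          map_smul, smul_mul_smul_comm, ← pow_add, hij]
      · rw [map_add, Matrix.add_apply, hx, hy, smul_add]
    have h11 : Φ y 1 1 = y := by
      induction y using Smash.induction with
      | h u v => exact (liftUpper_apply hD u v).2.2
      | hadd x y hx hy => rw [map_add, Matrix.add_apply, hx, hy]
    change Φ (x * y) 0 1 = Φ x 0 1 * y + (-1 : ℂ) ^ n • (x * Φ y 0 1)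
    rw [map_mul, Matrix.mul_apply, Fin.sum_univ_two, h00, h11, smul_mul_assoc, add_comm]

lemma IsTotalDifferential.unique {D : H →ₗ[ℂ] H} {δ δ' : P.VH →ₗ[ℂ] P.VH}
    (h : P.IsTotalDifferential D δ) (h' : P.IsTotalDifferential D δ') : δ = δ' := by
  have hhor : ∀ φ, δ (P.inl φ) = δ' (P.inl φ) := by
    intro φ
    induction φ using P.deg_induction with
    | h n φ hφ => exact (h.hor n φ hφ).trans (h'.hor n φ hφ).symm
    | h0 => simp
    | hadd x y hx hy => simp only [map_add, hx, hy]
  have hver : ∀ y, δ (P.inr y) = δ' (P.inr y) := by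
    intro y
    induction y using P.ideal.env_deg_induction with
    | hadd x y hx hy => simp only [map_add, hx, hy]
    | h n y hy =>
      refine P.ideal.envDeg_induction (p := fun _ y => δ (P.inr y) = δ' (P.inr y)) (fun c => ?_)
        (fun n x y _ hy => ?_) (fun n x y hx hy => by simp only [map_add, hx, hy]) n y hy
      · have h1 := hhor (algebraMap ℂ H c)
        rwa [AlgHom.commutes] at h1 ⊢
      · obtain ⟨a, rfl⟩ := P.ideal.proj_surjective x
        have hd := inr_mem_vhDeg (P := P) (P.ideal.incl_mem_envDeg (P.ideal.proj a))
        rw [map_mul, h.leibniz 1 _ hd, h'.leibniz 1 _ hd, hy]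
        congr 2
        exact (h.ver a).trans (h'.ver a).symm
  ext x
  induction x using Smash.induction with
  | hadd x y hx hy => simp only [map_add, hx, hy]
  | h u v =>
    induction u using P.deg_induction with
    | h n φ hφ =>
      have hd := inl_mem_vhDeg (P := P) hφ
      rw [h.leibniz n _ hd, h'.leibniz n _ hd, hver, hhor]
    | h0 => simp
    | hadd x y hx hy => simp only [map_add, add_mul, hx, hy]

lemma isTotalDifferential_partialD {D : H →ₗ[ℂ] H} (hD : P.IsPreconnection D) :
    P.IsTotalDifferential D (P.partialD D) := by
  have h := exists_differential hD
  rw [partialD, dif_pos h]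
  exact h.choose_spec

lemma isWellPosed [Nonempty P.preconnections] : P.IsWellPosed where
  chi _ hE := existsUnique_chi hE
  rho _ hD := existsUnique_rho hD
  envStar := ⟨_, P.ideal.isEnvStar_envStar fun _ hr => star_antipode_mem hr,
    fun _ h => CalcIdeal.IsEnvStar.unique P.ideal h (P.ideal.isEnvStar_envStar fun _ hr => star_antipode_mem hr)⟩
  adHat := ⟨_, isAdInvariant_ideal.isAdHat_adHat,
    fun _ h => CalcIdeal.IsAdHat.unique P.ideal h isAdInvariant_ideal.isAdHat_adHat⟩
  gauge _ hE := ⟨_, isGauge_gauge hE, fun _ h => h.unique (isGauge_gauge hE)⟩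
  differential _ hD := ⟨_, isTotalDifferential_partialD hD,
    fun _ h => h.unique (isTotalDifferential_partialD hD)⟩

end QuantumPrincipalBundle

section AlgHom

lemma map_mul'_map {M N T T' : Type*} [AddCommGroup M] [Module ℂ M] [AddCommGroup N] [Module ℂ N]
    [Ring T] [Algebra ℂ T] [Ring T'] [Algebra ℂ T'] (F : T →ₐ[ℂ] T') (f : M →ₗ[ℂ] T)
    (g : N →ₗ[ℂ] T) (t : M ⊗[ℂ] N) : F (LinearMap.mul' ℂ T (TensorProduct.map f g t)) =
      LinearMap.mul' ℂ T' (TensorProduct.map (F.toLinearMap ∘ₗ f) (F.toLinearMap ∘ₗ g) t) := by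
  induction t with
  | zero => simp
  | add a b ha hb => simp only [map_add, ha, hb]
  | tmul a b => simp

end AlgHom

/-! ### Trivializations of Ω_P and the connections ω_D. -/

namespace QuantumPrincipalBundle

variable {A H : Type*} [Ring A] [HopfAlgebra ℂ A] [StarRing A] [StarModule ℂ A]
    [Ring H] [Algebra ℂ H] [StarAddMonoid H] [StarModule ℂ H] {P : QuantumPrincipalBundle A H}

lemma triv_triv (D D' : P.preconnections) (x : P.Omega) :
    P.triv D' x = P.gauge ((D' : H →ₗ[ℂ] H) - D) (P.triv D x) := x.2 D D'

lemma triv_injective (D : P.preconnections) : Function.Injective (P.triv D) := by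
  intro x y h
  refine Subtype.ext (funext fun D' => ?_)
  change P.triv D' x = P.triv D' y
  rw [triv_triv D D' x, triv_triv D D' y, h]

lemma triv_hor (D : P.preconnections) (φ : H) : P.triv D (P.hor φ) = P.inl φ := rfl

lemma triv_comp_hor (D : P.preconnections) :
    (P.triv D).toLinearMap ∘ₗ P.hor = P.inl.toLinearMap := rfl

lemma family_apply (D : P.preconnections) (x : P.Omega) : P.family x D = P.triv D x := rfl

lemma vhStar_inl_mul_inr (φ : H) (η : P.Env) : P.vhStar (P.inl φ * P.inr η) =
    P.vhMk (((TensorProduct.lift P.ideal.circEnv.flip).lTensor H)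
      (TensorProduct.map (starLinearEquiv ℂ (A := H)).toLinearMap
      (TensorProduct.map (starLinearEquiv ℂ (A := A)).toLinearMap P.ideal.envStar)
      (TensorProduct.assoc ℂ H A P.Env (P.coact φ ⊗ₜ η)))) := by
  rw [Smash.inl_mul_inr]
  rfl

lemma pullbackVH_inl_mul_inr (φ : H) (η : P.Env) : P.pullbackVH (P.inl φ * P.inr η) =
    TensorProduct.map P.vhMk.toLinearMap
      (LinearMap.mul' ℂ P.GForms ∘ₗ P.ideal.ofA.rTensor P.GForms)
    (TensorProduct.tensorTensorTensorComm ℂ H A P.Env P.GForms (P.coact φ ⊗ₜ P.ideal.adHat η)) := by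
  rw [Smash.inl_mul_inr]
  rfl

variable [CompactMatrixQuantumGroup A]

lemma isEnvStar_ideal : P.ideal.IsEnvStar P.ideal.envStar :=
  P.ideal.isEnvStar_envStar fun _ hr => star_antipode_mem hr

lemma isAdHat_ideal : P.ideal.IsAdHat P.ideal.adHat := isAdInvariant_ideal.isAdHat_adHat

lemma star_one_eq (P : QuantumPrincipalBundle A H) : star (1 : H) = 1 := by
  have h1 : (1 : H) ∈ P.deg 0 := SetLike.GradedOne.one_mem
  have h := P.star_mul_of_deg_zero h1 (star 1)
  rw [one_mul, star_star, one_mul] at h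
  exact h.symm

lemma vhStar_inr (η : P.Env) : P.vhStar (P.inr η) = P.inr (P.ideal.envStar η) := by
  have h := vhStar_inl_mul_inr (P := P) 1 η
  rw [map_one, one_mul] at h
  rw [h, map_one, Algebra.TensorProduct.one_def]
  simp only [TensorProduct.assoc_tmul, TensorProduct.map_tmul, LinearMap.lTensor_tmul,
    TensorProduct.lift.tmul]
  change P.vhMk (star (1 : H) ⊗ₜ P.ideal.circEnv (P.ideal.envStar η) (star 1)) = _
  rw [star_one_eq P, star_one, P.ideal.circEnv_apply_one]
  rfl

lemma vhStar_inl (φ : H) : P.vhStar (P.inl φ) = P.inl (star φ) := by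
  have h := vhStar_inl_mul_inr φ (1 : P.Env)
  rw [map_one, mul_one] at h
  rw [h]
  conv_rhs => rw [← P.counit φ]
  generalize P.coact φ = t
  induction t with
  | zero => simp
  | add a b ha hb => simp only [TensorProduct.add_tmul, map_add, star_add, ha, hb]
  | tmul a b =>
    simp only [TensorProduct.assoc_tmul, TensorProduct.map_tmul, LinearMap.lTensor_tmul,
      TensorProduct.lift.tmul, isEnvStar_ideal.one, TensorProduct.rid_tmul, star_smul]
    change P.vhMk (star a ⊗ₜ P.ideal.circEnv 1 (star b)) = _
    rw [P.ideal.circEnv_one, Algebra.algebraMap_eq_smul_one, TensorProduct.tmul_smul, map_smul,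
      map_smul, counit_star]
    rfl

lemma pullbackVH_inr (η : P.Env) :
    P.pullbackVH (P.inr η) = P.inr.toLinearMap.rTensor P.GForms (P.ideal.adHat η) := by
  have h := pullbackVH_inl_mul_inr (P := P) 1 η
  rw [map_one, one_mul] at h
  rw [h, map_one, Algebra.TensorProduct.one_def]
  generalize P.ideal.adHat η = t
  induction t with
  | zero => simp
  | add a b ha hb => simp only [TensorProduct.tmul_add, map_add, ha, hb]
  | tmul a b => simp [P.ideal.ofA_one]; rfl

lemma pullbackVH_inl (φ : H) :
    P.pullbackVH (P.inl φ) = TensorProduct.map P.inl.toLinearMap P.ideal.ofA (P.coact φ) := by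
  have h := pullbackVH_inl_mul_inr φ (1 : P.Env)
  rw [map_one, mul_one] at h
  rw [h, isAdHat_ideal.one, Algebra.TensorProduct.one_def]
  generalize P.coact φ = t
  induction t with
  | zero => simp
  | add a b ha hb => simp only [TensorProduct.add_tmul, map_add, ha, hb]
  | tmul a b => simp; rfl

lemma pullbackVH_theta (a : A) : P.pullbackVH (P.theta a) =
    TensorProduct.map P.theta P.ideal.ofA (CalcIdeal.ad A a) +
      1 ⊗ₜ Smash.tmul _ P.ideal 1 (P.ideal.incl (P.ideal.proj a)) := by
  rw [Smash.theta_apply, pullbackVH_inr, isAdHat_ideal.incl, map_add]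
  congr 1
  generalize CalcIdeal.ad A a = t
  induction t with
  | zero => simp
  | add a b ha hb => simp only [map_add, ha, hb]
  | tmul a b => rfl

variable [Nonempty P.preconnections]

/-- An element of one copy is transported to the others by the gluing maps; the cocycle rule makes
the family compatible. -/
lemma triv_surjective (D : P.preconnections) : Function.Surjective (P.triv D) := by
  intro y
  refine ⟨(⟨fun D' => P.gauge ((D' : H →ₗ[ℂ] H) - D) y, fun D₁ D₂ => ?_⟩ : P.glued), ?_⟩
  · rw [gauge_gauge (IsPreconnection.sub D₁.2 D.2) (IsPreconnection.sub D₂.2 D₁.2)]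
    rw [sub_add_sub_cancel']
  · change P.gauge ((D : H →ₗ[ℂ] H) - D) y = y
    rw [sub_self, gauge_zero]

/-- The trivialization as an isomorphism. -/
def trivEquiv (D : P.preconnections) : P.Omega ≃ₐ[ℂ] P.VH :=
  AlgEquiv.ofBijective (P.triv D) ⟨triv_injective D, triv_surjective D⟩

lemma trivEquiv_apply (D : P.preconnections) (x : P.Omega) : trivEquiv D x = P.triv D x := rfl

/-- The connection associated with a preconnection. -/
abbrev connection (D : P.preconnections) : P.Inv →ₗ[ℂ] P.Omega := P.connectionOf (trivEquiv D)

lemma triv_connection_self (D : P.preconnections) (ϑ : P.Inv) :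
    P.triv D (connection D ϑ) = P.inr (P.ideal.incl ϑ) :=
  (trivEquiv D).apply_symm_apply _

/-- This formula reduces the behaviour of ω_D in an arbitrary trivialization to properties of
one-forms and of χ. -/
lemma triv_connection (D D' : P.preconnections) (a : A) :
    P.triv D' (connection D (P.ideal.proj a)) =
      P.theta a - P.inl (P.chi ((D' : H →ₗ[ℂ] H) - D) a) := by
  rw [triv_triv D D', triv_connection_self]
  exact (isGauge_gauge (IsPreconnection.sub D'.2 D.2)).ver a

/-- The conditions are imposed in all trivializations, so the correction χ_{D'−D} must have degree
one, be hermitian and be ad-covariant; the remaining term is θ, for which they hold by construction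
of the star and of ϖ̂. -/
lemma isConnection_connection (D : P.preconnections) : P.IsConnection (connection D) where
  deg D' ϑ := by
    obtain ⟨a, rfl⟩ := P.ideal.proj_surjective ϑ
    rw [triv_connection]
    exact sub_mem (inr_mem_vhDeg (P.ideal.incl_mem_envDeg _))
      (inl_mem_vhDeg (chi_mem_deg (IsPreconnection.sub D'.2 D.2) a))
  hermitian D' a := by
    rw [map_neg, map_neg, triv_connection, triv_connection, map_sub, Smash.theta_apply,
      Smash.theta_apply, vhStar_inr, vhStar_inl, isEnvStar_ideal.incl,
      (isContraction_chi (IsPreconnection.sub D'.2 D.2)).star_apply]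
    simp only [map_neg]
    abel
  covariant D' a := by
    have e : (P.triv D').toLinearMap ∘ₗ connection D ∘ₗ P.ideal.proj =
        P.theta - P.inl.toLinearMap ∘ₗ P.chi ((D' : H →ₗ[ℂ] H) - D) :=
      LinearMap.ext fun a => triv_connection D D' a
    rw [triv_connection, e, map_sub, pullbackVH_theta, pullbackVH_inl, map_sub_left,
      (isContraction_chi (IsPreconnection.sub D'.2 D.2)).coact_apply, LinearMap.sub_apply,
      ← LinearMap.comp_apply (TensorProduct.map _ _) (LinearMap.rTensor A _), LinearMap.rTensor,
      ← TensorProduct.map_comp, LinearMap.comp_id]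
    abel

/-- Regularity is an identity in Ω_P, so it can be tested in the trivialization D, where it is the
exchange rule of the smash product. -/
lemma isRegularConnection_connection (D : P.preconnections) :
    P.IsRegularConnection (connection D) where
  toIsConnection := isConnection_connection D
  regular n φ hφ ϑ := by
    refine triv_injective D ?_
    have e : (P.triv D).toLinearMap ∘ₗ connection D ∘ₗ P.ideal.circ ϑ =
        P.inr.toLinearMap ∘ₗ P.ideal.incl ∘ₗ P.ideal.circ ϑ :=
      LinearMap.ext fun a => triv_connection_self D _
    rw [map_smul, map_mul'_map, e, map_mul, triv_connection_self, triv_hor,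
      Smash.inr_incl_mul_inl, comodule_parity, P.parity_of_mem hφ, map_smul, map_smul, map_smul]
    rfl

lemma isMultiplicative_connection (D : P.preconnections) : P.IsMultiplicative (connection D) := by
  intro r hr
  refine triv_injective D ?_
  have e : (P.triv D).toLinearMap ∘ₗ connection D = P.inr.toLinearMap ∘ₗ P.ideal.incl :=
    LinearMap.ext fun a => triv_connection_self D _
  rw [CalcIdeal.quad_comp, e, ← CalcIdeal.quad_comp, P.ideal.quad_incl hr, map_zero, map_zero]

lemma trivEquiv_symm_vhMk (D : P.preconnections) (t : H ⊗[ℂ] P.Env) :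
    (trivEquiv D).symm (P.vhMk t) =
      P.decomposition (connection D) (isMultiplicative_connection D) t := by
  rw [AlgEquiv.symm_apply_eq, trivEquiv_apply]
  have e : (P.triv D).comp (P.ideal.lift (connection D) (isMultiplicative_connection D)) = P.inr :=
    P.ideal.lift_hom_ext fun x => by
      rw [AlgHom.comp_apply]
      exact (congrArg (P.triv D) (P.ideal.lift_incl _ (isMultiplicative_connection D) x)).trans
        (triv_connection_self D x)
  induction t with
  | zero => simp
  | add a b ha hb => simp only [map_add, ha, hb]
  | tmul a b =>
    have h := AlgHom.congr_fun e b
    rw [AlgHom.comp_apply] at h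
    simp only [decomposition, LinearMap.comp_apply, TensorProduct.map_tmul, LinearMap.mul'_apply,
      map_mul, triv_hor, AlgHom.toLinearMap_apply, h, Smash.inl_mul_inr]
    rfl

/-- In the trivialization D' the vertical parts of d_P(φ) and of ω_D cancel. What remains is D'(φ) +
(−1)^{∂φ} ∑ φₖ χ_{D'−D}(cₖ), which is D(φ) by definition of χ. -/
lemma isCovariantDerivative_connection (D : P.preconnections) :
    P.IsCovariantDerivative (connection D) D := by
  intro n φ hφ
  funext D'
  have h1 := (isTotalDifferential_partialD D'.2).hor n φ hφ
  have e : (P.triv D').toLinearMap ∘ₗ connection D ∘ₗ P.ideal.proj =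
        P.theta - P.inl.toLinearMap ∘ₗ P.chi ((D' : H →ₗ[ℂ] H) - D) :=
      LinearMap.ext fun a => triv_connection D D' a
  have h2 := isChi_chi (IsPreconnection.sub D'.2 D.2) n φ hφ
  have h3 : P.vhMk ((P.ideal.incl ∘ₗ P.ideal.proj).lTensor H (P.coact φ)) =
      LinearMap.mul' ℂ P.VH (TensorProduct.map P.inl.toLinearMap P.theta (P.coact φ)) :=
    Smash.ofTensor_lTensor P.comodule P.ideal (P.coact φ)
  rw [Pi.sub_apply, Pi.smul_apply, family_apply, family_apply, triv_hor, map_mul'_map,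
    triv_comp_hor, e, map_sub_right, LinearMap.sub_apply, map_sub, ← map_contract]
  change P.inl ((D : H →ₗ[ℂ] H) φ) = P.partialD D' (P.horVH φ) - _
  rw [h1, h3, horVH_apply]
  have h4 : (D : H →ₗ[ℂ] H) φ = (D' : H →ₗ[ℂ] H) φ + (-1 : ℂ) ^ n •
      P.contract (P.chi ((D' : H →ₗ[ℂ] H) - D)) φ := by
    rw [LinearMap.sub_apply, neg_smul] at h2
    rw [← sub_eq_zero, ← sub_sub_sub_cancel_left _ _ ((D' : H →ₗ[ℂ] H) φ), h2]
    simp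
  rw [h4, map_add, map_smul, smul_sub]
  abel

end QuantumPrincipalBundle

/-! ### The horizontal part of an arbitrary connection. -/

section

variable {A : Type*} [Ring A] [HopfAlgebra ℂ A] [StarRing A] [StarModule ℂ A]
  [CompactMatrixQuantumGroup A]

/-- Under the counit in the second leg, the factors κ(a₁) and a₃ of the adjoint action disappear. -/
lemma ad_counit (a : A) :
    TensorProduct.rid ℂ A ((Coalgebra.counit (R := ℂ)).lTensor A (CalcIdeal.ad A a)) = a := by
  refine LinearMap.congr_fun (f := (TensorProduct.rid ℂ A).toLinearMap ∘ₗ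
    (Coalgebra.counit (R := ℂ)).lTensor A ∘ₗ CalcIdeal.ad A) (g := LinearMap.id)
    (ext_corep fun n w _ hw i j => ?_) a
  simp only [LinearMap.comp_apply, hw.ad_apply, map_sum, LinearMap.lTensor_tmul,
    Bialgebra.counit_mul, HopfAlgebra.counit_antipode, hw.counit, LinearEquiv.coe_coe,
    TensorProduct.rid_tmul]
  simp

end

/-- The degree zero part of left-invariant forms. -/
def CalcIdeal.envScalar {A : Type*} [Ring A] [HopfAlgebra ℂ A] (R : CalcIdeal A) :
    R.Env →ₐ[ℂ] ℂ :=
  R.lift 0 (fun r _ => by rw [CalcIdeal.quad_eq_convMul]; simp [convMul])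

namespace Smash

variable {A H : Type*} [Ring A] [HopfAlgebra ℂ A] [Ring H] [Algebra ℂ H]
  (X : ComoduleAlgebra A H) (R : CalcIdeal A)

/-- The component in `H ⊗ ℂ`. -/
def horPart : Smash X R →ₗ[ℂ] H :=
  (TensorProduct.rid ℂ H).toLinearMap ∘ₗ R.envScalar.toLinearMap.lTensor H ∘ₗ
    (ofTensor X R).symm.toLinearMap

lemma horPart_inl (x : H) : horPart X R (inl X R x) = x := by
  change TensorProduct.rid ℂ H (x ⊗ₜ R.envScalar 1) = x
  simp

lemma horPart_theta (a : A) : horPart X R (theta X R a) = 0 := by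
  change TensorProduct.rid ℂ H (1 ⊗ₜ R.envScalar (R.incl (R.proj a))) = 0
  rw [CalcIdeal.envScalar, R.lift_incl]
  simp

/-- The map `c ⊗ η ↦ ε(c)η` from forms on the structure group. -/
def verPart : R.Full →ₗ[ℂ] Smash X R :=
  (inr X R).toLinearMap ∘ₗ (TensorProduct.lid ℂ R.Env).toLinearMap ∘ₗ
    (Coalgebra.counit (R := ℂ)).rTensor R.Env ∘ₗ (ofTensor (ComoduleAlgebra.self A) R).symm.toLinearMap

lemma verPart_tmul (c : A) (η : R.Env) :
    verPart X R (tmul (ComoduleAlgebra.self A) R c η) =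
      Coalgebra.counit (R := ℂ) c • inr X R η := by
  change inr X R (TensorProduct.lid ℂ R.Env (Coalgebra.counit (R := ℂ) c ⊗ₜ η)) = _
  simp

lemma verPart_ofA (c : A) : verPart X R (R.ofA c) = Coalgebra.counit (R := ℂ) c • 1 := by
  have := verPart_tmul X R c 1
  rwa [map_one] at this

lemma verPart_ofA_mul (c : A) (β : R.Full) :
    verPart X R (R.ofA c * β) = Coalgebra.counit (R := ℂ) c • verPart X R β := by
  induction β using Smash.induction with
  | hadd x y hx hy => simp only [mul_add, map_add, smul_add, hx, hy]
  | h b η =>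
    have e : R.ofA c = inl (ComoduleAlgebra.self A) R c := rfl
    rw [e, ← mul_assoc, ← map_mul, inl_mul_inr, inl_mul_inr, verPart_tmul, verPart_tmul,
      Bialgebra.counit_mul, mul_smul]

end Smash

namespace QuantumPrincipalBundle

variable {A H : Type*} [Ring A] [HopfAlgebra ℂ A] [StarRing A] [StarModule ℂ A]
    [Ring H] [Algebra ℂ H] [StarAddMonoid H] [StarModule ℂ H] {P : QuantumPrincipalBundle A H}

variable (P) in
/-- The map `x ⊗ (c ⊗ η) ↦ ε(c)xη`. -/
def slice : P.VH ⊗[ℂ] P.GForms →ₗ[ℂ] P.VH :=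
  LinearMap.mul' ℂ P.VH ∘ₗ TensorProduct.map LinearMap.id (Smash.verPart P.comodule P.ideal)

lemma slice_tmul (x : P.VH) (β : P.GForms) :
    P.slice (x ⊗ₜ β) = x * Smash.verPart P.comodule P.ideal β := rfl

/-- The counit is multiplicative on the coefficient in `A`, so it undoes the coaction on φ. -/
lemma slice_pullbackVH (φ : H) (η : P.Env) : P.slice (P.pullbackVH (P.inl φ * P.inr η)) =
    P.inl φ * P.slice (P.inr.toLinearMap.rTensor P.GForms (P.ideal.adHat η)) := by
  rw [pullbackVH_inl_mul_inr]
  conv_rhs => rw [← P.counit φ]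
  generalize P.coact φ = s
  generalize P.ideal.adHat η = w
  induction s with
  | zero => simp
  | add a b ha hb => simp only [TensorProduct.add_tmul, map_add, add_mul, ha, hb]
  | tmul h c =>
    induction w with
    | zero => simp
    | add a b ha hb => simp only [TensorProduct.tmul_add, map_add, mul_add, ha, hb]
    | tmul u β =>
      simp only [TensorProduct.tensorTensorTensorComm_tmul, TensorProduct.map_tmul,
        LinearMap.comp_apply, LinearMap.rTensor_tmul, LinearMap.mul'_apply, slice_tmul,
        LinearMap.lTensor_tmul, TensorProduct.rid_tmul, map_smul, Smash.verPart_ofA_mul,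
        AlgHom.toLinearMap_apply, LinearEquiv.coe_coe, mul_smul_comm, smul_mul_assoc]
      rw [← mul_assoc, Smash.inl_mul_inr]
      rfl

variable [CompactMatrixQuantumGroup A]

lemma slice_map_ofA {M : Type*} [AddCommGroup M] [Module ℂ M] (f : M →ₗ[ℂ] P.VH)
    (t : M ⊗[ℂ] A) : P.slice (TensorProduct.map f P.ideal.ofA t) =
      f (TensorProduct.rid ℂ M ((Coalgebra.counit (R := ℂ)).lTensor M t)) := by
  induction t with
  | zero => simp
  | add a b ha hb => simp only [map_add, ha, hb]
  | tmul a b =>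
    rw [TensorProduct.map_tmul, slice_tmul, Smash.verPart_ofA, LinearMap.lTensor_tmul,
      TensorProduct.rid_tmul, map_smul, mul_smul_comm, mul_one]

lemma slice_one_tmul (x : P.Inv) : P.slice (1 ⊗ₜ Smash.tmul _ P.ideal 1 (P.ideal.incl x)) =
    P.inr (P.ideal.incl x) := by
  rw [slice_tmul, Smash.verPart_tmul, Bialgebra.counit_one, one_smul, one_mul]

lemma slice_pullbackVH_theta (a : A) : P.slice (P.pullbackVH (P.theta a)) = P.theta a + P.theta a := by
  rw [pullbackVH_theta, map_add, slice_map_ofA, ad_counit, slice_one_tmul]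
  rfl

/-- The pull-back followed by `slice` doubles the vertical component of a one-form and fixes the
horizontal one, so the deficit from 2x is the horizontal component. -/
lemma slice_pullbackVH_of_mem {x : P.VH} (hx : x ∈ P.vhDeg 1) :
    ∃ u ∈ P.deg 1, P.slice (P.pullbackVH x) + P.inl u = x + x := by
  refine vhDeg_induction (p := fun x => ∃ u ∈ P.deg 1, P.slice (P.pullbackVH x) + P.inl u = x + x)
    (fun i j hij φ hφ y hy => ?_) ⟨0, zero_mem _, by simp⟩ (fun x y hx hy => ?_) hx
  · obtain ⟨rfl, rfl⟩ | ⟨rfl, rfl⟩ : (i = 0 ∧ j = 1) ∨ (i = 1 ∧ j = 0) := by omega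
    · rw [CalcIdeal.envDeg, pow_one] at hy
      obtain ⟨ϑ, rfl⟩ := hy
      obtain ⟨a, rfl⟩ := P.ideal.proj_surjective ϑ
      have h := slice_pullbackVH_theta (P := P) a
      rw [Smash.theta_apply, pullbackVH_inr] at h
      exact ⟨0, zero_mem _, by rw [slice_pullbackVH, h, map_zero, add_zero, mul_add]⟩
    · rw [CalcIdeal.envDeg, pow_zero, Submodule.mem_one] at hy
      obtain ⟨c, rfl⟩ := hy
      refine ⟨c • φ, Submodule.smul_mem _ _ hφ, ?_⟩
      have e : P.inl φ * P.inr (algebraMap ℂ _ c) = P.inl (c • φ) := by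
        rw [AlgHom.commutes, ← Algebra.commutes, ← Algebra.smul_def, map_smul]
      rw [e, pullbackVH_inl, slice_map_ofA, P.counit]
      rfl
  · obtain ⟨u, hu, hx⟩ := hx
    obtain ⟨v, hv, hy⟩ := hy
    refine ⟨u + v, add_mem hu hv, ?_⟩
    rw [map_add, map_add, map_add, add_add_add_comm, hx, hy, add_add_add_comm]

section Converse

variable {ω : P.Inv →ₗ[ℂ] P.Omega} (D : P.preconnections)

/-- The horizontal component of a connection in a trivialization. -/
def connHor (ω : P.Inv →ₗ[ℂ] P.Omega) : A →ₗ[ℂ] H :=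
  Smash.horPart P.comodule P.ideal ∘ₗ (P.triv D).toLinearMap ∘ₗ ω ∘ₗ P.ideal.proj

lemma connHor_one : connHor D ω 1 = 0 := by simp [connHor, P.ideal.proj_one]

lemma connHor_spec (hω : P.IsConnection ω) (a : A) : connHor D ω a ∈ P.deg 1 ∧
    P.triv D (ω (P.ideal.proj a)) = P.theta a + P.inl (connHor D ω a) := by
  obtain ⟨u, hu, h⟩ := slice_pullbackVH_of_mem (hω.deg D (P.ideal.proj a))
  have h2 : P.triv D (ω (P.ideal.proj a)) = P.theta a + P.inl u := by
    -- For a connection, covariance evaluates the slice as ω + θ. Comparison with 2ω − u gives ω = θ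
    -- + u, so the vertical part of ω is forced.
    rw [hω.covariant, map_add, slice_map_ofA, ad_counit, slice_one_tmul, add_assoc] at h
    exact (add_left_cancel h).symm
  have h3 : connHor D ω a = u := by
    change Smash.horPart P.comodule P.ideal (P.triv D (ω (P.ideal.proj a))) = u
    rw [h2, map_add, Smash.horPart_theta, Smash.horPart_inl, zero_add]
  rw [h3]
  exact ⟨hu, h2⟩

lemma triv_comp_proj (hω : P.IsConnection ω) : (P.triv D).toLinearMap ∘ₗ ω ∘ₗ P.ideal.proj =
    P.theta + P.inl.toLinearMap ∘ₗ connHor D ω :=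
  LinearMap.ext fun a => (connHor_spec D hω a).2

lemma inl_injective : Function.Injective P.inl :=
  Function.LeftInverse.injective (g := Smash.horPart P.comodule P.ideal)
    (Smash.horPart_inl P.comodule P.ideal)

lemma map_inl_ofA_injective : Function.Injective (TensorProduct.map P.inl.toLinearMap P.ideal.ofA) :=
  Function.LeftInverse.injective (g := TensorProduct.map (Smash.horPart P.comodule P.ideal)
    (Smash.horPart (ComoduleAlgebra.self A) P.ideal)) fun t => by
    induction t with
    | zero => simp
    | add a b ha hb => simp only [map_add, ha, hb]
    | tmul a b =>
      have e : P.ideal.ofA b = Smash.inl (ComoduleAlgebra.self A) P.ideal b := rfl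
      rw [TensorProduct.map_tmul, TensorProduct.map_tmul, e, Smash.horPart_inl,
        AlgHom.toLinearMap_apply, Smash.horPart_inl]

lemma coact_connHor (hω : P.IsConnection ω) (a : A) : P.coact (connHor D ω a) =
    (connHor D ω).rTensor A (CalcIdeal.ad A a) := by
  have h := hω.covariant D a
  rw [triv_comp_proj D hω, (connHor_spec D hω a).2, map_add, pullbackVH_theta, pullbackVH_inl,
    TensorProduct.map_add_left, LinearMap.add_apply] at h
  refine map_inl_ofA_injective (P := P) ?_
  have e : TensorProduct.map P.inl.toLinearMap P.ideal.ofA ((connHor D ω).rTensor A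
      (CalcIdeal.ad A a)) = TensorProduct.map (P.inl.toLinearMap ∘ₗ connHor D ω) P.ideal.ofA
        (CalcIdeal.ad A a) := by
    rw [← LinearMap.comp_apply, LinearMap.rTensor, ← TensorProduct.map_comp, LinearMap.comp_id]
  rw [e]
  rw [add_right_comm, add_left_inj] at h
  exact add_left_cancel h

lemma star_connHor (hω : P.IsConnection ω) (a : A) :
    star (connHor D ω a) = -connHor D ω (star (HopfAlgebra.antipode ℂ a)) := by
  have h := hω.hermitian D a
  rw [map_neg, map_neg, (connHor_spec D hω a).2, (connHor_spec D hω _).2, map_add,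
    Smash.theta_apply, Smash.theta_apply, vhStar_inr, vhStar_inl, isEnvStar_ideal.incl,
    map_neg, neg_add] at h
  rw [← map_neg] at h
  exact (inl_injective (add_left_cancel h)).symm

/-- Regularity of ω minus the exchange rule for θ leaves this rule for the horizontal part, the same
as that of χ_E. -/
lemma connHor_mul (hω : P.IsRegularConnection ω) {n : ℕ} {φ : H} (hφ : φ ∈ P.deg n) (a : A) :
    connHor D ω a * φ = (-1 : ℂ) ^ n • (P.contract (connHor D ω ∘ₗ LinearMap.mulLeft ℂ a) φ -
      Coalgebra.counit (R := ℂ) a • P.contract (connHor D ω) φ) := by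
  have h := congrArg (P.triv D) (hω.regular n φ hφ (P.ideal.proj a))
  have e : (P.triv D).toLinearMap ∘ₗ ω ∘ₗ P.ideal.circ (P.ideal.proj a) =
      Smash.thetaCirc P.comodule P.ideal a + P.inl.toLinearMap ∘ₗ
        (connHor D ω ∘ₗ LinearMap.mulLeft ℂ a - Coalgebra.counit (R := ℂ) a • connHor D ω) := by
    refine LinearMap.ext fun b => ?_
    change P.triv D (ω (P.ideal.circ (P.ideal.proj a) b)) = _
    rw [P.ideal.circ_proj, map_sub, map_sub, map_smul, map_smul,
      (connHor_spec D hω.toIsConnection _).2, (connHor_spec D hω.toIsConnection _).2,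
      LinearMap.add_apply, Smash.thetaCirc_apply]
    simp only [LinearMap.comp_apply, LinearMap.sub_apply, LinearMap.smul_apply,
      LinearMap.mulLeft_apply, AlgHom.toLinearMap_apply, map_sub, map_smul, smul_add]
    abel
  have h1 := Smash.theta_mul_inl P.comodule P.ideal a φ
  rw [comodule_parity, P.parity_of_mem hφ, map_smul, map_smul] at h1
  rw [map_mul, map_smul, map_mul'_map, triv_hor, triv_comp_hor, e, TensorProduct.map_add_right,
    LinearMap.add_apply, map_add, ← map_contract, (connHor_spec D hω.toIsConnection _).2, add_mul,
    smul_add, h1, ← map_mul, ← map_smul P.inl] at h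
  refine (inl_injective (add_left_cancel h)).trans ?_
  congr 1
  have e2 : connHor D ω ∘ₗ LinearMap.mulLeft ℂ a - Coalgebra.counit (R := ℂ) a • connHor D ω =
      connHor D ω ∘ₗ LinearMap.mulLeft ℂ a + (-Coalgebra.counit (R := ℂ) a) • connHor D ω := by
    ext b
    simp [sub_eq_add_neg]
  rw [e2, contract_add, contract_smul, LinearMap.add_apply, LinearMap.smul_apply, neg_smul,
    sub_eq_add_neg]

end Converse

end QuantumPrincipalBundle

/-! ### Regular connections and preconnections. -/

namespace QuantumPrincipalBundle

variable {A H : Type*} [Ring A] [HopfAlgebra ℂ A] [StarRing A] [StarModule ℂ A]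
    [Ring H] [Algebra ℂ H] [StarAddMonoid H] [StarModule ℂ H] {P : QuantumPrincipalBundle A H}
    [CompactMatrixQuantumGroup A] {ω : P.Inv →ₗ[ℂ] P.Omega} (D : P.preconnections)

/-- The difference between the covariant derivative of `ω` and `D`. -/
def connVariation (ω : P.Inv →ₗ[ℂ] P.Omega) : H →ₗ[ℂ] H :=
  -(P.contract (connHor D ω) ∘ₗ P.parity.toLinearMap)

lemma connVariation_apply (φ : H) :
    connVariation D ω φ = -P.contract (connHor D ω) (P.parity φ) := rfl

/-- The commutation rule of the horizontal part splits its value at a product of coefficients into a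
counit term and a term moved past ψ. This yields the Leibniz rule of `connVariation`. -/
lemma contract_connHor_mul (hω : P.IsRegularConnection ω) (φ ψ : H) :
    P.contract (connHor D ω) (φ * ψ) = φ * P.contract (connHor D ω) ψ +
      P.contract (connHor D ω) φ * P.parity ψ := by
  induction ψ using P.deg_induction with
  | h0 => simp
  | hadd x y hx hy => simp only [mul_add, map_add, hx, hy]; abel
  | h n ψ hψ =>
    have key : ∀ t : H ⊗[ℂ] A, HorizontalForms.evalRight (connHor D ω) (t * P.coact ψ) =
        TensorProduct.rid ℂ H ((Coalgebra.counit (R := ℂ)).lTensor H t) *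
          P.contract (connHor D ω) ψ +
        HorizontalForms.evalRight (connHor D ω) t * P.parity ψ := by
      intro t
      induction t with
      | zero => simp
      | add x y hx hy => simp only [add_mul, map_add, hx, hy]; abel
      | tmul u c =>
        have h : HorizontalForms.evalRight (connHor D ω) ((u ⊗ₜ c) * P.coact ψ) =
            u * P.contract (connHor D ω ∘ₗ LinearMap.mulLeft ℂ c) ψ := by
          rw [HorizontalForms.contract_eq]
          generalize P.coact ψ = s
          induction s with
          | zero => simp
          | add x y hx hy => simp only [mul_add, map_add, hx, hy]
          | tmul v d => simp [HorizontalForms.evalRight_tmul, mul_assoc]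
        rw [h, HorizontalForms.evalRight_tmul, P.parity_of_mem hψ, mul_smul_comm, mul_assoc,
          connHor_mul D hω hψ, mul_smul_comm, neg_one_pow_smul_smul]
        simp [mul_sub]
    rw [HorizontalForms.contract_eq, map_mul, key, P.counit]
    rfl

lemma connVariation_family {n m : ℕ} {x : Fin m → H} {v : Matrix (Fin m) (Fin m) A}
    (hx : P.IsFamily n x v) (i : Fin m) :
    connVariation D ω (x i) = -(-1 : ℂ) ^ n • ∑ j, x j * connHor D ω (v j i) := by
  rw [connVariation_apply, P.parity_of_mem (hx.deg i), map_smul, hx.contract, neg_smul]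

/-- The argument of `IsContraction.star_apply` in the opposite direction: the horizontal part is
moved past x_j*, the sum with the antipode gives its value at 1 or 0, which is zero, and the counit
term remains. -/
lemma connVariation_star (hω : P.IsRegularConnection ω) {n m : ℕ} {x : Fin m → H}
    {v : Matrix (Fin m) (Fin m) A} (hx : P.IsFamily n x v) (i : Fin m) :
    connVariation D ω (star (x i)) = star (connVariation D ω (x i)) := by
  have h1 : ∀ j, star (x j * connHor D ω (v j i)) = -((-1 : ℂ) ^ n •
      (connHor D ω (star (HopfAlgebra.antipode ℂ (v j i))) * star (x j))) := by
    intro j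
    rw [P.star_mul n 1 _ (hx.deg j) _ (connHor_spec D hω.toIsConnection _).1,
      star_connHor D hω.toIsConnection, mul_one, neg_mul, smul_neg]
  have h2 : ∀ j, connHor D ω (star (HopfAlgebra.antipode ℂ (v j i))) * star (x j) =
      (-1 : ℂ) ^ n • (∑ k, star (x k) * connHor D ω (star (HopfAlgebra.antipode ℂ (v j i)) *
        star (v k j)) - (if j = i then (1 : ℂ) else 0) •
          ∑ k, star (x k) * connHor D ω (star (v k j))) := by
    intro j
    rw [connHor_mul D hω (hx.star.deg j), hx.star.contract, hx.star.contract,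
      hx.isCorep.counit_star_antipode]
    rfl
  have h3 : ∑ j, ∑ k, star (x k) * connHor D ω (star (HopfAlgebra.antipode ℂ (v j i)) *
        star (v k j)) = 0 := by
    rw [Finset.sum_comm]
    refine Finset.sum_eq_zero fun k _ => ?_
    rw [← Finset.mul_sum, ← map_sum, hx.isCorep.star_mul_antipode]
    split_ifs <;> simp [connHor_one]
  rw [connVariation_family D hx.star, connVariation_family D hx]
  simp only [star_smul, star_sum, h1, h2, Finset.sum_neg_distrib, neg_one_pow_smul_smul,
    Finset.sum_sub_distrib, h3]
  simp

lemma isVariation_connVariation (hω : P.IsRegularConnection ω) :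
    P.IsVariation (connVariation D ω) where
  deg n φ hφ := by
    rw [connVariation_apply, P.parity_of_mem hφ, map_smul]
    refine neg_mem (Submodule.smul_mem _ _ ?_)
    obtain ⟨t, ht⟩ := P.coact_deg n φ hφ
    rw [HorizontalForms.contract_eq, ← ht]
    clear ht
    induction t with
    | zero => simp
    | add x y hx hy => simp only [map_add]; exact add_mem hx hy
    | tmul x a =>
      exact SetLike.GradedMul.mul_mem x.2 (connHor_spec D hω.toIsConnection a).1
  covariant φ := by
    refine LinearMap.congr_fun (f := P.coact.toLinearMap ∘ₗ connVariation D ω)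
      (g := (connVariation D ω).rTensor A ∘ₗ P.coact.toLinearMap)
      (P.ext_family fun n m x v hx i => ?_) φ
    simp only [LinearMap.comp_apply, AlgHom.toLinearMap_apply, hx.coact, map_sum,
      LinearMap.rTensor_tmul, connVariation_family D hx]
    rw [map_smul, map_sum]
    simp only [map_mul, hx.coact, coact_connHor D hω.toIsConnection, hx.isCorep.ad_apply, map_sum,
      LinearMap.rTensor_tmul, ← TensorProduct.smul_tmul', ← Finset.smul_sum,
      TensorProduct.sum_tmul]
    congr 1
    -- The sum over j contracts v_kj with the factor κ(v_jr) of the adjoint action.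
    calc ∑ j, (∑ k, x k ⊗ₜ[ℂ] v k j) * ∑ r, ∑ s, connHor D ω (v r s) ⊗ₜ[ℂ]
          (HopfAlgebra.antipode ℂ (v j r) * v s i)
        = ∑ k, ∑ r, ∑ s, (x k * connHor D ω (v r s)) ⊗ₜ[ℂ]
          ((∑ j, v k j * HopfAlgebra.antipode ℂ (v j r)) * v s i) := by
          simp only [Finset.sum_mul, Finset.mul_sum, TensorProduct.tmul_sum,
            Algebra.TensorProduct.tmul_mul_tmul, mul_assoc]
          calc _ = ∑ j, ∑ k, ∑ r, ∑ s, (x k * connHor D ω (v r s)) ⊗ₜ[ℂ]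
                (v k j * (HopfAlgebra.antipode ℂ (v j r) * v s i)) :=
                Finset.sum_congr rfl fun j _ => (Finset.sum_congr rfl fun r _ =>
                  Finset.sum_comm).trans Finset.sum_comm
            _ = _ := Finset.sum_comm.trans (Finset.sum_congr rfl fun k _ => Finset.sum_comm.trans
                  (Finset.sum_congr rfl fun r _ => Finset.sum_comm))
      _ = ∑ k, ∑ s, (x k * connHor D ω (v k s)) ⊗ₜ[ℂ] v s i := by
          simp only [hx.isCorep.mul_antipode, ite_mul, one_mul, zero_mul]
          refine Finset.sum_congr rfl fun k _ => ?_
          rw [Finset.sum_eq_single k (fun r _ hr => by simp [Ne.symm hr]) (by simp)]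
          simp
      _ = _ := Finset.sum_comm
  base φ hφ := by
    rw [connVariation_apply, HorizontalForms.contract_eq, P.mem_base.1 (parity_mem_base hφ),
      HorizontalForms.evalRight_tmul, connHor_one, mul_zero, neg_zero]
  leibniz n φ hφ ψ := by
    rw [connVariation_apply, map_mul, contract_connHor_mul D hω, parity_parity,
      connVariation_apply, connVariation_apply, P.parity_of_mem hφ]
    simp only [smul_mul_assoc, mul_neg, smul_neg, neg_mul, neg_add]
    abel
  hermitian φ := by
    induction φ using P.deg_induction with
    | h0 => simp
    | hadd x y hx hy => simp only [map_add, star_add, hx, hy]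
    | h n φ hφ =>
      -- Conjugating by the star makes both sides of the hermiticity condition linear, so that it
      -- can be checked on families.
      let f : H →ₗ[ℂ] H :=
        { toFun := fun φ => star (connVariation D ω (star φ))
          map_add' := fun x y => by simp
          map_smul' := fun c x => by simp [star_smul] }
      have hf : f φ = connVariation D ω φ := by
        refine P.eq_of_family (fun m x v hx i => ?_) hφ
        exact (congrArg star (connVariation_star D hω hx i)).trans (star_star _)
      exact star_injective (hf.trans (star_star _).symm)

variable [Nonempty P.preconnections]

lemma chi_connVariation (hω : P.IsRegularConnection ω) :
    P.chi (connVariation D ω) = connHor D ω :=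
  chi_unique (isVariation_connVariation D hω) (isChi_iff.2 fun _ => rfl)

/-- In the trivialization D the horizontal part of ω_{D'} is −χ_{D−D'} = χ_{D'−D}, and the operator
with this coefficient map is D' − D. -/
lemma connVariation_connection (D' : P.preconnections) :
    connVariation D (connection D') = (D' : H →ₗ[ℂ] H) - D := by
  have hv := IsPreconnection.sub D.2 D'.2
  have h1 : connHor D (connection D') = P.chi ((D' : H →ₗ[ℂ] H) - D) := by
    refine LinearMap.ext fun a => ?_
    change Smash.horPart P.comodule P.ideal (P.triv D (connection D' (P.ideal.proj a))) = _
    rw [triv_connection, map_sub, Smash.horPart_theta, Smash.horPart_inl, zero_sub,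
      ← neg_sub (D : H →ₗ[ℂ] H) D', chi_neg hv]
    rfl
  refine LinearMap.ext fun φ => ?_
  rw [connVariation_apply, h1,
    ← isChi_iff.1 (isChi_chi (IsPreconnection.sub D'.2 D.2)) φ]

/-- With E the variation whose χ_E is the horizontal part of ω in the trivialization D, both ω and
ω_{D+E} read θ + χ_E there. Uniqueness holds because D' is recovered from ω_{D'} by
`connVariation_connection`. -/
lemma existsUnique_connection (hω : P.IsRegularConnection ω) :
    ∃! D : P.preconnections, ω = connection D := by
  obtain ⟨D⟩ := ‹Nonempty P.preconnections›
  have hE := isVariation_connVariation D hω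
  refine ⟨⟨D + connVariation D ω, IsPreconnection.add D.2 hE⟩, ?_, fun D' hD' => ?_⟩
  · refine P.ideal.inv_ext fun a => triv_injective D ?_
    have e : (D : H →ₗ[ℂ] H) - (D + connVariation D ω) = -connVariation D ω := by abel
    rw [triv_connection, e, chi_neg hE, chi_connVariation D hω,
      (connHor_spec D hω.toIsConnection a).2]
    simp
  · refine Subtype.ext ?_
    change (D' : H →ₗ[ℂ] H) = D + connVariation D ω
    rw [hD', connVariation_connection, add_sub_cancel]

/-- The covariant derivative of a regular connection as a real-affine function of the connection. -/
def covDerivative (D : P.preconnections) : (P.Inv →ₗ[ℂ] P.Omega) →ᵃ[ℝ] (H →ₗ[ℂ] H) :=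
  LinearMap.toAffineMap
    ({ toFun := connVariation D
       map_add' := fun ω ω' => by
        have e : connHor D (ω + ω') = connHor D ω + connHor D ω' := by
          ext a; simp [connHor]
        ext φ
        rw [LinearMap.add_apply]
        simp only [connVariation_apply, e, contract_add, LinearMap.add_apply]
        abel
       map_smul' := fun c ω => by
        have e : connHor D (c • ω) = (c : ℂ) • connHor D ω := by
          refine LinearMap.ext fun a => ?_
          change Smash.horPart P.comodule P.ideal
            (P.triv D ((c : ℂ) • ω (P.ideal.proj a))) = _
          rw [map_smul, map_smul]; rfl
        refine LinearMap.ext fun φ => ?_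
        change connVariation D (c • ω) φ = (c : ℂ) • connVariation D ω φ
        rw [connVariation_apply, connVariation_apply, e, contract_smul, LinearMap.smul_apply,
          smul_neg] } : (P.Inv →ₗ[ℂ] P.Omega) →ₗ[ℝ] (H →ₗ[ℂ] H)) +
    AffineMap.const ℝ _ (D : H →ₗ[ℂ] H)

lemma covDerivative_apply (ω : P.Inv →ₗ[ℂ] P.Omega) :
    covDerivative D ω = connVariation D ω + D := rfl

lemma covDerivative_connection (D D' : P.preconnections) :
    covDerivative D (connection D') = D' := by
  rw [covDerivative_apply, connVariation_connection, sub_add_cancel]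

variable (P) in
-- The inverse map ω ↦ D + E_ω, for a fixed reference D, is visibly affine because E_ω depends
-- linearly on ω. It is restricted to regular connections, shown to be bijective and then inverted.
lemma exists_affineEquiv : ∃ (_ : Nonempty P.regularConnections)
    (Φ : P.preconnections ≃ᵃ[ℝ] P.regularConnections),
      ∀ D, (Φ D : P.Inv →ₗ[ℂ] P.Omega) = connection D := by
  obtain ⟨D⟩ := ‹Nonempty P.preconnections›
  have : Nonempty P.preconnections := ⟨D⟩
  have hne : Nonempty P.regularConnections := ⟨⟨connection D, isRegularConnection_connection D⟩⟩
  have hle : P.regularConnections.map (covDerivative D) ≤ P.preconnections := by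
    rintro _ ⟨ω, hω, rfl⟩
    obtain ⟨D', rfl, -⟩ := existsUnique_connection hω
    rw [covDerivative_connection]
    exact D'.2
  have happ : ∀ D' : P.preconnections, (covDerivative D).restrict hle
      ⟨connection D', isRegularConnection_connection D'⟩ = D' := fun D' =>
    Subtype.ext (covDerivative_connection D D')
  have hb : Function.Bijective ((covDerivative D).restrict hle) := by
    refine ⟨fun ω₁ ω₂ h => ?_, fun D' => ⟨_, happ D'⟩⟩
    obtain ⟨ω₁, h₁⟩ := ω₁
    obtain ⟨ω₂, h₂⟩ := ω₂
    obtain ⟨D₁, rfl, -⟩ := existsUnique_connection h₁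
    obtain ⟨D₂, rfl, -⟩ := existsUnique_connection h₂
    rw [happ D₁, happ D₂] at h
    subst h
    rfl
  refine ⟨hne, (AffineEquiv.ofBijective hb).symm, fun D' => ?_⟩
  have : (AffineEquiv.ofBijective hb).symm D' =
      ⟨connection D', isRegularConnection_connection D'⟩ := by
    rw [AffineEquiv.symm_apply_eq]
    exact (happ D').symm
  rw [this]

end QuantumPrincipalBundle

end QPB

end

theorem proposition3p2 {A H : Type*} [Ring A] [HopfAlgebra ℂ A] [StarRing A] [StarModule ℂ A]
    [QPB.CompactMatrixQuantumGroup A] [Ring H] [Algebra ℂ H] [StarAddMonoid H] [StarModule ℂ H]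
    (P : QPB.QuantumPrincipalBundle A H) [Nonempty P.preconnections] :
    P.IsWellPosed ∧
    ∃ τ : P.preconnections → (P.Omega ≃ₐ[ℂ] P.VH),
      (∀ D x, τ D x = P.triv D x) ∧
      (∀ D, P.IsRegularConnection (P.connectionOf (τ D)) ∧
        P.IsCovariantDerivative (P.connectionOf (τ D)) D ∧
        ∃ hω : P.IsMultiplicative (P.connectionOf (τ D)),
          ∀ t, (τ D).symm (P.vhMk t) = P.decomposition (P.connectionOf (τ D)) hω t) ∧
      (∀ ω, P.IsRegularConnection ω → ∃! D, ω = P.connectionOf (τ D)) ∧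
      ∃ (_ : Nonempty P.regularConnections)
        (Φ : P.preconnections ≃ᵃ[ℝ] P.regularConnections),
        ∀ D, (Φ D : P.Inv →ₗ[ℂ] P.Omega) = P.connectionOf (τ D) := by
  exact ⟨QPB.QuantumPrincipalBundle.isWellPosed, QPB.QuantumPrincipalBundle.trivEquiv,
    QPB.QuantumPrincipalBundle.trivEquiv_apply,
    fun D => ⟨QPB.QuantumPrincipalBundle.isRegularConnection_connection D,
      QPB.QuantumPrincipalBundle.isCovariantDerivative_connection D,
      QPB.QuantumPrincipalBundle.isMultiplicative_connection D,
      QPB.QuantumPrincipalBundle.trivEquiv_symm_vhMk D⟩,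
    fun _ hω => QPB.QuantumPrincipalBundle.existsUnique_connection hω,
    P.exists_affineEquiv⟩
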